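/- **Notation.** For a finite set $\mathcal X$, let $\mathcal P(\mathcal X)$ be the set of probability measures on $\mathcal X$, and for $\nu_1,\nu_2\in\mathcal P(\mathcal X)$ let $\Pi(\nu_1,\nu_2)$ be the set of probability measures on $\mathcal X\times\mathcal X$ with first marginal $\nu_1$ and second marginal $\nu_2$. For $\pi\in\Pi(\nu_1,\nu_2)$, $(p_x)_{x\in\mathcal X}$ denotes any family of probability measures with $\pi(x,y)=\nu_1(x)p_x(y)$ for all $x,y\in\mathcal X$ (the costs below do not depend on its choice). The relative entropy is $H(\nu|\mu)=\int\log\frac{d\nu}{d\mu}\,d\nu$ if $\nu\ll\mu$, and $H(\nu|\mu)=+\infty$ otherwise. For a distance $d$ on $\mathcal X$ put $$W_1(\nu_1,\nu_2)=\inf_{\pi\in\Pi(\nu_1,\nu_2)}\iint d(x,y)\,d\pi(x,y),\qquad \widetilde T_2(\nu_2|\nu_1)=\inf_{\pi\in\Pi(\nu_1,\nu_2)}\int\Big(\int d(x,y)\,dp_x(y)\Big)^2d\nu_1(x),$$ and, when $\mathcal X$ is a set of words $x=(x_1,\dots,x_n)$ of length $n$, $$\widehat T_2(\nu_2|\nu_1)=\inf_{\pi\in\Pi(\nu_1,\nu_2)}\int\sum_{i=1}^n\Big(\int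 \mathbf 1_{x_i\ne y_i}\,dp_x(y)\Big)^2d\nu_1(x).$$ **Theorem.** Let $n\ge 1$ and $0\le k\le n$, let $\mathcal X_{k,n-k}=\{x\in\{0,1\}^n:\sum_{i=1}^n x_i=k\}$, with the distance $d_h(x,y)=\frac12\sum_{i=1}^n\mathbf 1_{x_i\ne y_i}$, let $\mu_{k,n-k}$ be the uniform law on $\mathcal X_{k,n-k}$, and let $C_{k,n-k}=\min(k,n-k)$. (a) For all probability measures $\nu_1,\nu_2$ on $\mathcal X_{k,n-k}$, with $W_1$ and $\widetilde T_2$ taken for $d=d_h$, $$2\,W_1^2(\nu_1,\nu_2)\le C_{k,n-k}\Big(\sqrt{H(\nu_1|\mu_{k,n-k})}+\sqrt{H(\nu_2|\mu_{k,n-k})}\Big)^2$$ and $$\frac12\,\widetilde T_2(\nu_2|\nu_1)\le C_{k,n-k}\Big(\sqrt{H(\nu_1|\mu_{k,n-k})}+\sqrt{H(\nu_2|\mu_{k,n-k})}\Big)^2 .$$ (b) For all probability measures $\nu_1,\nu_2$ on $\mathcal X_{k,n-k}$, $$\frac18\,\widehat T_2(\nu_2|\nu_1)\le\Big(\sqrt{H(\nu_1|\mu_{k,n-k})}+\sqrt{H(\nu_2|\mu_{k,n-k})}\Big)^2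 .$$ (c) (Multinomial laws.) Let $E=\{e_1,\dots,e_m\}$ be a set of cardinality $m$, let $k_1,\dots,k_m\ge1$ be integers with $k_1+\dots+k_m=n$, and let $\mu_{k_1,\dots,k_m}$ be the uniform law on $$\mathcal X_{k_1,\dots,k_m}=\big\{x\in E^n:\ \#\{i: x_i=e_l\}=k_l\ \text{ for all } l\in\{1,\dots,m\}\big\}.$$ Then for all probability measures $\nu_1,\nu_2$ on $\mathcal X_{k_1,\dots,k_m}$, $$\frac18\,\widehat T_2(\nu_2|\nu_1)\le\Big(\sqrt{H(\nu_1|\mu_{k_1,\dots,k_m})}+\sqrt{H(\nu_2|\mu_{k_1,\dots,k_m})}\Big)^2 .$$ -/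

import Mathlib

open MeasureTheory ProbabilityTheory InformationTheory
open scoped ENNReal

noncomputable section

/-- The slice `{x ∈ {0,1}ⁿ : x₁ + ⋯ + xₙ = k}` of the discrete cube. -/
def slice (n k : ℕ) : Set (Fin n → Fin 2) :=
  {x | ∑ i, (x i : ℕ) = k}

/-- The words of length `n` over an alphabet with `m` letters in which the letter `l` occurs
exactly `k l` times. -/
def multislice {m : ℕ} (n : ℕ) (k : Fin m → ℕ) : Set (Fin n → Fin m) :=
  {x | ∀ l, (Finset.univ.filter fun i => x i = l).card = k l}

/-- The uniform probability measure on a finite nonempty type. -/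
def uniformLaw (X : Type*) [MeasurableSpace X] : Measure X :=
  uniformOn (Set.univ : Set X)

/-- `Π(ν₁, ν₂)`: the probability measures on `X × X` with marginals `ν₁` and `ν₂`. -/
def couplings {X : Type*} [MeasurableSpace X] (ν₁ ν₂ : Measure X) : Set (Measure (X × X)) :=
  {π | IsProbabilityMeasure π ∧ π.map Prod.fst = ν₁ ∧ π.map Prod.snd = ν₂}

/-- `p` is a family of conditional laws of `π` given the first coordinate, whose law is `ν`:
every `p x` is a probability measure and `π(x, y) = ν(x) pₓ(y)`.
To be used on finite spaces, where points determine a measure. -/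
def IsDisintegration {X : Type*} [MeasurableSpace X] (π : Measure (X × X)) (ν : Measure X)
    (p : X → Measure X) : Prop :=
  (∀ x, IsProbabilityMeasure (p x)) ∧ ∀ x y, π {(x, y)} = ν {x} * p x {y}

/-- The Wasserstein cost `W₁(ν₁, ν₂)` associated with `d`. -/
def wasserstein {X : Type*} [MeasurableSpace X] (d : X → X → ℝ≥0∞) (ν₁ ν₂ : Measure X) : ℝ≥0∞ :=
  ⨅ π ∈ couplings ν₁ ν₂, ∫⁻ z, d z.1 z.2 ∂π

/-- The weak transport cost `T̃₂(ν₂ | ν₁)` associated with `d`. The arguments are in the order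
`ν₂`, `ν₁`. -/
def weakCostTilde {X : Type*} [MeasurableSpace X] (d : X → X → ℝ≥0∞) (ν₂ ν₁ : Measure X) :
    ℝ≥0∞ :=
  ⨅ (π ∈ couplings ν₁ ν₂) (p : X → Measure X) (_ : IsDisintegration π ν₁ p),
    ∫⁻ x, (∫⁻ y, d x y ∂(p x)) ^ 2 ∂ν₁

/-- The weak transport cost `T̂₂(ν₂ | ν₁)` on a set of words of length `n`; the inner integral
`∫ 1_{xᵢ ≠ yᵢ} dpₓ(y)` is the mass that `pₓ` gives to `{y : xᵢ ≠ yᵢ}`. The arguments are in the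
order `ν₂`, `ν₁`. -/
def weakCostHat {n : ℕ} {E : Type*} [DecidableEq E] [MeasurableSpace E] {S : Set (Fin n → E)}
    (ν₂ ν₁ : Measure S) : ℝ≥0∞ :=
  ⨅ (π ∈ couplings ν₁ ν₂) (p : S → Measure S) (_ : IsDisintegration π ν₁ p),
    ∫⁻ x, ∑ i, (∫⁻ y, (if x.1 i ≠ y.1 i then 1 else 0) ∂(p x)) ^ 2 ∂ν₁

/-- The halved Hamming distance on a set of words: half the number of differing coordinates. -/
def halvedHamming {n : ℕ} {E : Type*} [DecidableEq E] {S : Set (Fin n → E)} (x y : S) : ℝ≥0∞ :=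
  (hammingDist x.1 y.1 : ℝ≥0∞) / 2

/-- `(√H(ν₁|μ) + √H(ν₂|μ))²`, where `H` is the relative entropy. -/
def entropyBound {X : Type*} [MeasurableSpace X] (μ ν₁ ν₂ : Measure X) : ℝ≥0∞ :=
  (klDiv ν₁ μ ^ (1 / 2 : ℝ) + klDiv ν₂ μ ^ (1 / 2 : ℝ)) ^ 2

end

/-!
If one of the two laws is uniform, a kernel of small cost is built by induction on the permutation
group: fixing one more value of `σ` splits a coset into fibres which are exchanged by
transpositions, the law of that value is transported optimally for total variation, and inside the
fibres the kernel of the previous step is used. The relative entropy is additive along this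
decomposition, and a pointwise inequality for `u log u - u + 1` pays for the mass moved by the
total variation transport. For the cost with one term per coordinate, averaging over the coordinate
that is fixed makes the constant independent of `n`; for the halved Hamming distance it is enough
to fix the coordinates carrying one chosen letter, which gives the factor `min(k, n - k)`.

Two arbitrary laws are compared through the uniform law by composing two such kernels, since the
square roots of the costs are subadditive under composition; this is where the sum of the two square
roots of entropies comes from. Finally a set of words with prescribed letter counts is an orbit of
the permutations, hence a quotient of the group by a map with fibres of constant size, and kernels
descend to it without increase of cost or change of entropy.
-/

noncomputable section

section OneVariable

lemma isMinOn_of_sub_mul_deriv_nonneg {s : Set ℝ} (hs : s.OrdConnected) {f f' : ℝ → ℝ} {a : ℝ}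
    (ha : a ∈ s) (hf : ∀ x ∈ s, HasDerivAt f (f' x) x) (hf' : ∀ x ∈ s, 0 ≤ (x - a) * f' x) :
    IsMinOn f s a := by
  intro x hx
  rcases le_total a x with h | h
  · have hsub : Set.Icc a x ⊆ s := hs.out ha hx
    refine monotoneOn_of_hasDerivWithinAt_nonneg (convex_Icc a x)
      (fun y hy => (hf y (hsub hy)).continuousAt.continuousWithinAt)
      (fun y hy => (hf y (hsub (interior_subset hy))).hasDerivWithinAt) (fun y hy => ?_)
      (Set.left_mem_Icc.2 h) (Set.right_mem_Icc.2 h) h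
    rw [interior_Icc] at hy
    exact nonneg_of_mul_nonneg_right (hf' y (hsub ⟨hy.1.le, hy.2.le⟩)) (sub_pos.2 hy.1)
  · have hsub : Set.Icc x a ⊆ s := hs.out hx ha
    refine antitoneOn_of_hasDerivWithinAt_nonpos (convex_Icc x a)
      (fun y hy => (hf y (hsub hy)).continuousAt.continuousWithinAt)
      (fun y hy => (hf y (hsub (interior_subset hy))).hasDerivWithinAt) (fun y hy => ?_)
      (Set.left_mem_Icc.2 h) (Set.right_mem_Icc.2 h) h
    rw [interior_Icc] at hy
    exact nonpos_of_mul_nonneg_right (hf' y (hsub ⟨hy.1.le, hy.2.le⟩)) (sub_neg.2 hy.2)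

lemma sub_one_mul_div_le_log {x : ℝ} (hx : 0 < x) :
    (x - 1) * (5 * x + 1) / (2 * x * (x + 2)) ≤ Real.log x := by
  have hmin : IsMinOn (fun y => Real.log y - (y - 1) * (5 * y + 1) / (2 * y * (y + 2)))
      (Set.Ioi 0) 1 := by
    refine isMinOn_of_sub_mul_deriv_nonneg (f' := fun y => (y - 1) ^ 3 / (y * (y + 2)) ^ 2)
      Set.ordConnected_Ioi (Set.mem_Ioi.2 one_pos) (fun y (hy : 0 < y) => ?_) fun y _ => ?_
    · have hnum := ((hasDerivAt_id y).sub_const 1).mul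
        (((hasDerivAt_id y).const_mul 5).add_const 1)
      have hden := ((hasDerivAt_id y).const_mul 2).mul ((hasDerivAt_id y).add_const 2)
      refine ((Real.hasDerivAt_log hy.ne').sub
        (hnum.div hden (mul_pos (mul_pos two_pos hy) (by positivity)).ne')).congr_deriv ?_
      simp only [id_eq, Pi.mul_apply]
      field_simp
      ring
    · calc 0 ≤ (y - 1) ^ 4 / (y * (y + 2)) ^ 2 := by positivity
        _ = (y - 1) * ((y - 1) ^ 3 / (y * (y + 2)) ^ 2) := by ring
  simpa using hmin (Set.mem_Ioi.2 hx)

lemma three_mul_sub_one_sq_le_klFun {x : ℝ} (hx : 0 ≤ x) :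
    3 * (x - 1) ^ 2 ≤ 2 * (x + 2) * klFun x := by
  rcases hx.eq_or_lt with rfl | hx
  · norm_num [klFun_zero]
  have hlog := sub_one_mul_div_le_log hx
  rw [div_le_iff₀ (by positivity)] at hlog
  rw [klFun_apply]
  linarith

lemma one_sub_sq_le_two_mul_klFun {x : ℝ} (hx : 0 ≤ x) (hx1 : x ≤ 1) :
    (1 - x) ^ 2 ≤ 2 * klFun x := by
  nlinarith [three_mul_sub_one_sq_le_klFun hx, klFun_nonneg hx]

lemma sub_one_sq_div_le_two_mul_klFun {x : ℝ} (hx : 1 ≤ x) :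
    (x - 1) ^ 2 / x ≤ 2 * klFun x := by
  have hx0 : 0 ≤ x := by linarith
  rw [div_le_iff₀ (by linarith)]
  nlinarith [three_mul_sub_one_sq_le_klFun hx0, klFun_nonneg hx0]

lemma sq_sub_one_le_two_mul_log {a : ℝ} (ha : 0 < a) (ha1 : a ≤ 1) :
    a ^ 2 - 1 ≤ 2 * a * Real.log a := by
  have h := Real.sinh_le_self_iff.2 (Real.log_nonpos ha.le ha1)
  rw [Real.sinh_log ha] at h
  calc a ^ 2 - 1 = 2 * a * ((a - a⁻¹) / 2) := by field_simp
    _ ≤ 2 * a * Real.log a := by gcongr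

lemma two_mul_sub_one_le_add_one_mul_log {b : ℝ} (hb : 1 ≤ b) :
    2 * (b - 1) ≤ (b + 1) * Real.log b := by
  have h := Real.le_log_one_add_of_nonneg (sub_nonneg.2 hb)
  rw [add_sub_cancel, div_le_iff₀ (by linarith)] at h
  linarith

/-- A function `c` chosen so that the mean-zero terms `(a - 1) c(b) + (b - 1) c(a)` make the
bound of `(a - b)² / a` by relative entropies hold pointwise, for densities `b ≤ a` at two
points. -/
def pairCorrection (b : ℝ) : ℝ := if 1 ≤ b then -Real.log b else 1 - b

lemma sq_div_le_mul_log_sub_mul_log {a b : ℝ} (ha : 0 < a) (hb : 0 ≤ b) (hab : b ≤ a) :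
    (a - b) ^ 2 / a ≤ 2 * (b * Real.log b - b * Real.log a) - 2 * b + 2 * a := by
  have hlog : b * Real.log (b / a) = b * Real.log b - b * Real.log a := by
    rcases hb.eq_or_lt with rfl | hb0
    · simp
    · rw [Real.log_div hb0.ne' ha.ne']; ring
  rw [← hlog]
  calc (a - b) ^ 2 / a = a * (1 - b / a) ^ 2 := by field_simp
    _ ≤ a * (2 * klFun (b / a)) := by
      gcongr
      exact one_sub_sq_le_two_mul_klFun (div_nonneg hb ha.le) (div_le_one_of_le₀ hab ha.le)
    _ = _ := by rw [klFun_apply]; field_simp; ring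

lemma sq_div_le_mul_log_sub_log {a b : ℝ} (hb : 0 < b) (hab : b ≤ a) :
    (a - b) ^ 2 / a ≤ 2 * a * (Real.log a - Real.log b) - 2 * a + 2 * b := by
  have ha : 0 < a := hb.trans_le hab
  rw [← Real.log_div ha.ne' hb.ne']
  calc (a - b) ^ 2 / a = b * ((a / b - 1) ^ 2 / (a / b)) := by field_simp
    _ ≤ b * (2 * klFun (a / b)) := by
      gcongr
      exact sub_one_sq_div_le_two_mul_klFun ((one_le_div hb).2 hab)
    _ = _ := by rw [klFun_apply]; field_simp; ring

lemma sq_div_le_of_lt_one {a b : ℝ} (ha : 0 < a) (ha1 : a < 1) (hb : 0 ≤ b) (hab : b ≤ a) :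
    (a - b) ^ 2 / a ≤ 2 * klFun a + 2 * klFun b +
      (a - 1) * pairCorrection b + (b - 1) * pairCorrection a := by
  rw [pairCorrection, if_neg (by linarith), pairCorrection, if_neg (by linarith), klFun_apply,
    klFun_apply]
  nlinarith [sq_div_le_mul_log_sub_mul_log ha hb hab, sq_sub_one_le_two_mul_log ha ha1.le,
    mul_nonneg (sub_nonneg.2 hab) (sub_nonneg.2 (Real.log_le_sub_one_of_pos ha))]

lemma sq_div_le_of_lt_one_of_one_le {a b : ℝ} (ha1 : 1 ≤ a) (hb : 0 ≤ b) (hb1 : b < 1) :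
    (a - b) ^ 2 / a ≤ 2 * klFun a + 2 * klFun b +
      (a - 1) * pairCorrection b + (b - 1) * pairCorrection a := by
  have ha : 0 < a := one_pos.trans_le ha1
  rw [pairCorrection, if_neg hb1.not_ge, pairCorrection, if_pos ha1]
  have hexpand : (a - b) ^ 2 / a ≤
      (a - 1) ^ 2 / a + (1 - b) ^ 2 + (a - 1) * (1 - b) + (1 - b) * (1 - a⁻¹) := by
    rw [← sub_nonneg]
    have hdiff : (a - 1) ^ 2 / a + (1 - b) ^ 2 + (a - 1) * (1 - b) + (1 - b) * (1 - a⁻¹) -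
        (a - b) ^ 2 / a = ((1 - b) ^ 2 * (a - 1) + (1 - b) * (a - 1) ^ 2) / a := by
      field_simp
      ring
    have := sub_nonneg.2 ha1
    have := sub_nonneg.2 hb1.le
    rw [hdiff]
    positivity
  nlinarith [sub_one_sq_div_le_two_mul_klFun ha1, one_sub_sq_le_two_mul_klFun hb hb1.le,
    mul_le_mul_of_nonneg_left (Real.one_sub_inv_le_log_of_pos ha) (sub_nonneg.2 hb1.le)]

lemma sq_div_le_of_one_le {a b : ℝ} (hb1 : 1 ≤ b) (hab : b ≤ a) :
    (a - b) ^ 2 / a ≤ 2 * klFun a + 2 * klFun b +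
      (a - 1) * pairCorrection b + (b - 1) * pairCorrection a := by
  have hb : 0 < b := one_pos.trans_le hb1
  have ha : 0 < a := hb.trans_le hab
  have hlog : (b - 1) * (Real.log a - Real.log b) ≤ (a - b) * Real.log b := by
    calc (b - 1) * (Real.log a - Real.log b) = (b - 1) * Real.log (a / b) := by
          rw [Real.log_div ha.ne' hb.ne']
      _ ≤ (b - 1) * (a / b - 1) := mul_le_mul_of_nonneg_left
          (Real.log_le_sub_one_of_pos (by positivity)) (sub_nonneg.2 hb1)
      _ = (a - b) * (1 - b⁻¹) := by field_simp
      _ ≤ (a - b) * Real.log b := mul_le_mul_of_nonneg_left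
          (Real.one_sub_inv_le_log_of_pos hb) (sub_nonneg.2 hab)
  rw [pairCorrection, if_pos hb1, pairCorrection, if_pos (hb1.trans hab), klFun_apply, klFun_apply]
  nlinarith [sq_div_le_mul_log_sub_log hb hab, two_mul_sub_one_le_add_one_mul_log hb1]

lemma sq_div_le_klFun_add_pairCorrection {a b : ℝ} (hb : 0 ≤ b) (hab : b ≤ a) :
    (a - b) ^ 2 / a ≤ 2 * klFun a + 2 * klFun b +
      (a - 1) * pairCorrection b + (b - 1) * pairCorrection a := by
  rcases (hb.trans hab).eq_or_lt with rfl | ha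
  · obtain rfl : b = 0 := le_antisymm hab hb
    norm_num [klFun_zero, pairCorrection]
  rcases lt_or_ge a 1 with ha1 | ha1
  · exact sq_div_le_of_lt_one ha ha1 hb hab
  rcases lt_or_ge b 1 with hb1 | hb1
  · exact sq_div_le_of_lt_one_of_one_le ha1 hb hb1
  · exact sq_div_le_of_one_le hb1 hab

end OneVariable

section FiniteKernels

/-- The weights `ν` form a probability on the finite set `s`; their values outside `s` are
irrelevant, as in all the notions below. -/
structure IsProbOn {X : Type*} (s : Finset X) (ν : X → ℝ) : Prop where
  nonneg : ∀ x ∈ s, 0 ≤ ν x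
  sum_eq : ∑ x ∈ s, ν x = 1

/-- The uniform probability on `s`. -/
def unifOn {X : Type*} (s : Finset X) : X → ℝ := fun _ => (s.card : ℝ)⁻¹

/-- The relative entropy of `ν` with respect to the uniform probability on `s`. The convention
`log 0 = 0` gives the points of mass `0` their correct contribution. -/
def entOn {X : Type*} (s : Finset X) (ν : X → ℝ) : ℝ :=
  ∑ x ∈ s, ν x * Real.log (s.card * ν x)

/-- `P` is a Markov kernel on `s`: the conditional laws of a coupling given its first
coordinate. -/
structure IsKernelOn {X : Type*} (s : Finset X) (P : X → X → ℝ) : Prop where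
  nonneg : ∀ x ∈ s, ∀ y ∈ s, 0 ≤ P x y
  sum_eq : ∀ x ∈ s, ∑ y ∈ s, P x y = 1

/-- The kernel `P` transports `ν₁` to `ν₂`. -/
def Pushes {X : Type*} (s : Finset X) (P : X → X → ℝ) (ν₁ ν₂ : X → ℝ) : Prop :=
  ∀ y ∈ s, ∑ x ∈ s, ν₁ x * P x y = ν₂ y

/-- The weak transport cost of the kernel `P` started from `ν`: the squared `L²(ν)` norm of the
vector of the mean displacements measured by the `D i`. It covers both `T̃₂` (one `D i`, the
distance) and `T̂₂` (the indicators `D i x y = 1_{xᵢ ≠ yᵢ}`). -/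
def weakCostOn {X ι : Type*} (s : Finset X) (I : Finset ι) (D : ι → X → X → ℝ) (ν : X → ℝ)
    (P : X → X → ℝ) : ℝ :=
  ∑ x ∈ s, ν x * ∑ i ∈ I, (∑ y ∈ s, P x y * D i x y) ^ 2

/-- The transport cost of the kernel `P` started from `ν`, for the cost function `d`. -/
def linCostOn {X : Type*} (s : Finset X) (d : X → X → ℝ) (ν : X → ℝ) (P : X → X → ℝ) : ℝ :=
  ∑ x ∈ s, ν x * ∑ y ∈ s, P x y * d x y

variable {X Y ι : Type*}

lemma IsProbOn.nonempty {s : Finset X} {ν : X → ℝ} (h : IsProbOn s ν) : s.Nonempty := by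
  rw [Finset.nonempty_iff_ne_empty]
  rintro rfl
  simpa using h.sum_eq

lemma IsProbOn.card_pos {s : Finset X} {ν : X → ℝ} (h : IsProbOn s ν) : (0 : ℝ) < s.card := by
  exact_mod_cast h.nonempty.card_pos

lemma isProbOn_unifOn {s : Finset X} (hs : s.Nonempty) : IsProbOn s (unifOn s) where
  nonneg _ _ := by unfold unifOn; positivity
  sum_eq := by
    have : (s.card : ℝ) ≠ 0 := by exact_mod_cast hs.card_pos.ne'
    simp [unifOn, this]

lemma entOn_unifOn (s : Finset X) : entOn s (unifOn s) = 0 := by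
  refine Finset.sum_eq_zero fun x hx => ?_
  have : (s.card : ℝ) ≠ 0 := by exact_mod_cast (Finset.card_pos.2 ⟨x, hx⟩).ne'
  simp [unifOn, this]

lemma entOn_eq_klFun {s : Finset X} {ν : X → ℝ} (h : IsProbOn s ν) :
    entOn s ν = (s.card : ℝ)⁻¹ * ∑ x ∈ s, klFun (s.card * ν x) := by
  have hs := h.card_pos.ne'
  simp only [klFun_apply, Finset.sum_sub_distrib, Finset.sum_add_distrib, ← Finset.mul_sum,
    h.sum_eq]
  simp only [mul_assoc, ← Finset.mul_sum, entOn]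
  simp [hs]

lemma entOn_nonneg {s : Finset X} {ν : X → ℝ} (h : IsProbOn s ν) : 0 ≤ entOn s ν := by
  rw [entOn_eq_klFun h]
  exact mul_nonneg (by positivity) (Finset.sum_nonneg fun x hx =>
    klFun_nonneg (mul_nonneg (by positivity) (h.nonneg x hx)))

lemma entOn_congr {s : Finset X} {ν ν' : X → ℝ} (h : ∀ x ∈ s, ν x = ν' x) :
    entOn s ν = entOn s ν' :=
  Finset.sum_congr rfl fun x hx => by rw [h x hx]

lemma exists_isKernelOn (s : Finset X) : ∃ P : X → X → ℝ, IsKernelOn s P := by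
  rcases s.eq_empty_or_nonempty with rfl | hs
  · exact ⟨fun _ _ => 0, by simp, by simp⟩
  · exact ⟨fun _ => unifOn s, fun _ _ => (isProbOn_unifOn hs).nonneg,
      fun _ _ => (isProbOn_unifOn hs).sum_eq⟩

lemma linCostOn_nonneg {s : Finset X} {d P : X → X → ℝ} {ν : X → ℝ} (hν : ∀ x ∈ s, 0 ≤ ν x)
    (hP : IsKernelOn s P) (hd : ∀ x ∈ s, ∀ y ∈ s, 0 ≤ d x y) : 0 ≤ linCostOn s d ν P :=
  Finset.sum_nonneg fun x hx => mul_nonneg (hν x hx)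
    (Finset.sum_nonneg fun y hy => mul_nonneg (hP.nonneg x hx y hy) (hd x hx y hy))

section Composition

/-- The composition of two kernels: first `P`, then `Q`. -/
def compKernel (s : Finset X) (P Q : X → X → ℝ) : X → X → ℝ := fun x z => ∑ y ∈ s, P x y * Q y z

variable {s : Finset X} {P Q : X → X → ℝ} {ν₁ ν₂ ν₃ : X → ℝ}

lemma IsKernelOn.comp (hP : IsKernelOn s P) (hQ : IsKernelOn s Q) :
    IsKernelOn s (compKernel s P Q) where
  nonneg x hx z hz := Finset.sum_nonneg fun y hy =>
    mul_nonneg (hP.nonneg x hx y hy) (hQ.nonneg y hy z hz)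
  sum_eq x hx := by
    simp only [compKernel]
    rw [Finset.sum_comm, ← hP.sum_eq x hx]
    refine Finset.sum_congr rfl fun y hy => ?_
    rw [← Finset.mul_sum, hQ.sum_eq y hy, mul_one]

lemma Pushes.comp (hP : Pushes s P ν₁ ν₂) (hQ : Pushes s Q ν₂ ν₃) :
    Pushes s (compKernel s P Q) ν₁ ν₃ := fun z hz => by
  simp only [compKernel, Finset.mul_sum]
  rw [Finset.sum_comm, ← hQ z hz]
  refine Finset.sum_congr rfl fun y hy => ?_
  rw [← hP y hy, Finset.sum_mul]
  exact Finset.sum_congr rfl fun x _ => by ring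

lemma sum_compKernel_le (hP : IsKernelOn s P) (hQ : IsKernelOn s Q) {d : X → X → ℝ}
    (hd : ∀ x ∈ s, ∀ y ∈ s, ∀ z ∈ s, d x z ≤ d x y + d y z) {x : X} (hx : x ∈ s) :
    ∑ z ∈ s, compKernel s P Q x z * d x z ≤
      ∑ y ∈ s, P x y * d x y + ∑ y ∈ s, P x y * ∑ z ∈ s, Q y z * d y z := by
  simp only [compKernel, Finset.sum_mul]
  rw [Finset.sum_comm, ← Finset.sum_add_distrib]
  refine Finset.sum_le_sum fun y hy => ?_
  calc ∑ z ∈ s, P x y * Q y z * d x z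
      ≤ ∑ z ∈ s, P x y * Q y z * (d x y + d y z) := Finset.sum_le_sum fun z hz =>
        mul_le_mul_of_nonneg_left (hd x hx y hy z hz)
          (mul_nonneg (hP.nonneg x hx y hy) (hQ.nonneg y hy z hz))
    _ = P x y * d x y * ∑ z ∈ s, Q y z + P x y * ∑ z ∈ s, Q y z * d y z := by
        rw [Finset.mul_sum, Finset.mul_sum, ← Finset.sum_add_distrib]
        exact Finset.sum_congr rfl fun z _ => by ring
    _ = _ := by rw [hQ.sum_eq y hy, mul_one]

lemma Pushes.mul_eq_zero (hp : Pushes s P ν₁ ν₂) (hP : IsKernelOn s P)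
    (hν : ∀ x ∈ s, 0 ≤ ν₁ x) {x y : X} (hx : x ∈ s) (hy : y ∈ s) (h0 : ν₂ y = 0) :
    ν₁ x * P x y = 0 := by
  rw [← hp y hy] at h0
  exact (Finset.sum_eq_zero_iff_of_nonneg fun x hx =>
    mul_nonneg (hν x hx) (hP.nonneg x hx y hy)).1 h0 x hx

lemma Pushes.sum_le (hp : Pushes s P ν₁ ν₂) (hP : IsKernelOn s P) (hν : ∀ x ∈ s, 0 ≤ ν₁ x)
    {f : X → X → ℝ} {e₁ e₂ : X → ℝ}
    (hf : ∀ x ∈ s, ∀ y ∈ s, ν₁ x ≠ 0 → ν₂ y ≠ 0 → f x y ≤ e₁ x + e₂ y) :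
    ∑ x ∈ s, ∑ y ∈ s, ν₁ x * P x y * f x y ≤ ∑ x ∈ s, ν₁ x * e₁ x + ∑ y ∈ s, ν₂ y * e₂ y := by
  have hsplit : ∑ x ∈ s, ν₁ x * e₁ x + ∑ y ∈ s, ν₂ y * e₂ y =
      ∑ x ∈ s, ∑ y ∈ s, ν₁ x * P x y * (e₁ x + e₂ y) := by
    simp only [mul_add, Finset.sum_add_distrib]
    congr 1
    · refine Finset.sum_congr rfl fun x hx => ?_
      rw [← Finset.sum_mul, ← Finset.mul_sum, hP.sum_eq x hx, mul_one]
    · rw [Finset.sum_comm]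
      refine Finset.sum_congr rfl fun y hy => ?_
      rw [← Finset.sum_mul, hp y hy]
  rw [hsplit]
  refine Finset.sum_le_sum fun x hx => Finset.sum_le_sum fun y hy => ?_
  by_cases h0 : ν₁ x * P x y = 0
  · simp [h0]
  · exact mul_le_mul_of_nonneg_left (hf x hx y hy (left_ne_zero_of_mul h0) fun hb => h0
      (hp.mul_eq_zero hP hν hx hy hb)) (mul_nonneg (hν x hx) (hP.nonneg x hx y hy))

lemma Pushes.sum_eq (h : Pushes s P ν₁ ν₂) (g : X → ℝ) :
    ∑ x ∈ s, ν₁ x * ∑ y ∈ s, P x y * g y = ∑ y ∈ s, ν₂ y * g y := by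
  simp only [Finset.mul_sum]
  rw [Finset.sum_comm]
  refine Finset.sum_congr rfl fun y hy => ?_
  rw [← h y hy, Finset.sum_mul]
  exact Finset.sum_congr rfl fun x _ => by ring

lemma linCostOn_comp_le (hν : ∀ x ∈ s, 0 ≤ ν₁ x) (hP : IsKernelOn s P) (hQ : IsKernelOn s Q)
    (hPp : Pushes s P ν₁ ν₂) {d : X → X → ℝ}
    (hd : ∀ x ∈ s, ∀ y ∈ s, ∀ z ∈ s, d x z ≤ d x y + d y z) :
    linCostOn s d ν₁ (compKernel s P Q) ≤ linCostOn s d ν₁ P + linCostOn s d ν₂ Q := by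
  unfold linCostOn
  rw [← hPp.sum_eq, ← Finset.sum_add_distrib]
  refine Finset.sum_le_sum fun x hx => ?_
  rw [← mul_add]
  exact mul_le_mul_of_nonneg_left (sum_compKernel_le hP hQ hd hx) (hν x hx)

lemma sq_sum_mul_le {t : Finset X} {w f : X → ℝ} (hw : ∀ x ∈ t, 0 ≤ w x)
    (hw1 : ∑ x ∈ t, w x ≤ 1) : (∑ x ∈ t, w x * f x) ^ 2 ≤ ∑ x ∈ t, w x * f x ^ 2 := by
  have hnonneg : ∀ x ∈ t, 0 ≤ w x * f x ^ 2 := fun x hx => mul_nonneg (hw x hx) (sq_nonneg _)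
  calc (∑ x ∈ t, w x * f x) ^ 2 ≤ (∑ x ∈ t, w x) * ∑ x ∈ t, w x * f x ^ 2 :=
        Finset.sum_sq_le_sum_mul_sum_of_sq_le_mul t hw hnonneg fun x _ => le_of_eq (by ring)
    _ ≤ ∑ x ∈ t, w x * f x ^ 2 := mul_le_of_le_one_left (Finset.sum_nonneg hnonneg) hw1

lemma sum_mul_add_sq_le {t : Finset X} {w f g : X → ℝ} (hw : ∀ x ∈ t, 0 ≤ w x) :
    ∑ x ∈ t, w x * (f x + g x) ^ 2 ≤
      (√(∑ x ∈ t, w x * f x ^ 2) + √(∑ x ∈ t, w x * g x ^ 2)) ^ 2 := by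
  have hf : ∀ x ∈ t, 0 ≤ w x * f x ^ 2 := fun x hx => mul_nonneg (hw x hx) (sq_nonneg _)
  have hg : ∀ x ∈ t, 0 ≤ w x * g x ^ 2 := fun x hx => mul_nonneg (hw x hx) (sq_nonneg _)
  have hcross : ∑ x ∈ t, w x * f x * g x ≤
      √(∑ x ∈ t, w x * f x ^ 2) * √(∑ x ∈ t, w x * g x ^ 2) := by
    rw [← Real.sqrt_mul (Finset.sum_nonneg hf)]
    exact Real.le_sqrt_of_sq_le
      (Finset.sum_sq_le_sum_mul_sum_of_sq_le_mul t hf hg fun x _ => le_of_eq (by ring))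
  have hexpand : ∑ x ∈ t, w x * (f x + g x) ^ 2 =
      ∑ x ∈ t, w x * f x ^ 2 + 2 * ∑ x ∈ t, w x * f x * g x + ∑ x ∈ t, w x * g x ^ 2 := by
    rw [Finset.mul_sum, ← Finset.sum_add_distrib, ← Finset.sum_add_distrib]
    exact Finset.sum_congr rfl fun x _ => by ring
  rw [hexpand, add_sq, Real.sq_sqrt (Finset.sum_nonneg hf), Real.sq_sqrt (Finset.sum_nonneg hg)]
  linarith

lemma Pushes.sum_mul_sum_sq_le (hp : Pushes s P ν₁ ν₂) (hP : IsKernelOn s P)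
    (hν : ∀ x ∈ s, 0 ≤ ν₁ x) (I : Finset ι) (h : ι → X → ℝ) :
    ∑ x ∈ s, ν₁ x * ∑ i ∈ I, (∑ y ∈ s, P x y * h i y) ^ 2 ≤
      ∑ y ∈ s, ν₂ y * ∑ i ∈ I, h i y ^ 2 := by
  rw [← hp.sum_eq]
  refine Finset.sum_le_sum fun x hx => mul_le_mul_of_nonneg_left ?_ (hν x hx)
  simp only [Finset.mul_sum]
  rw [Finset.sum_comm]
  exact Finset.sum_le_sum fun i _ => sq_sum_mul_le (hP.nonneg x hx) (hP.sum_eq x hx).le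

lemma weakCostOn_comp_le (hν : ∀ x ∈ s, 0 ≤ ν₁ x) (hP : IsKernelOn s P) (hQ : IsKernelOn s Q)
    (hPp : Pushes s P ν₁ ν₂) {I : Finset ι} {D : ι → X → X → ℝ}
    (hD0 : ∀ i ∈ I, ∀ x ∈ s, ∀ y ∈ s, 0 ≤ D i x y)
    (hD : ∀ i ∈ I, ∀ x ∈ s, ∀ y ∈ s, ∀ z ∈ s, D i x z ≤ D i x y + D i y z) :
    weakCostOn s I D ν₁ (compKernel s P Q) ≤
      (√(weakCostOn s I D ν₁ P) + √(weakCostOn s I D ν₂ Q)) ^ 2 := by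
  let F : X × ι → ℝ := fun p => ∑ y ∈ s, P p.1 y * D p.2 p.1 y
  let G : X × ι → ℝ := fun p => ∑ y ∈ s, P p.1 y * ∑ z ∈ s, Q y z * D p.2 y z
  have hF : ∑ p ∈ s ×ˢ I, ν₁ p.1 * F p ^ 2 = weakCostOn s I D ν₁ P := by
    rw [Finset.sum_product]
    exact Finset.sum_congr rfl fun x _ => by rw [Finset.mul_sum]
  have hG : ∑ p ∈ s ×ˢ I, ν₁ p.1 * G p ^ 2 ≤ weakCostOn s I D ν₂ Q := by
    rw [Finset.sum_product]
    simp only [← Finset.mul_sum]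
    exact hPp.sum_mul_sum_sq_le hP hν I fun i y => ∑ z ∈ s, Q y z * D i y z
  calc weakCostOn s I D ν₁ (compKernel s P Q) ≤ ∑ p ∈ s ×ˢ I, ν₁ p.1 * (F p + G p) ^ 2 := by
        simp only [Finset.sum_product, ← Finset.mul_sum]
        refine Finset.sum_le_sum fun x hx => ?_
        refine mul_le_mul_of_nonneg_left (Finset.sum_le_sum fun i hi => ?_) (hν x hx)
        exact pow_le_pow_left₀ (Finset.sum_nonneg fun z hz =>
          mul_nonneg ((hP.comp hQ).nonneg x hx z hz) (hD0 i hi x hx z hz))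
          (sum_compKernel_le hP hQ (hD i hi) hx) 2
    _ ≤ (√(∑ p ∈ s ×ˢ I, ν₁ p.1 * F p ^ 2) + √(∑ p ∈ s ×ˢ I, ν₁ p.1 * G p ^ 2)) ^ 2 :=
        sum_mul_add_sq_le fun p hp => hν p.1 (Finset.mem_product.1 hp).1
    _ ≤ (√(weakCostOn s I D ν₁ P) + √(weakCostOn s I D ν₂ Q)) ^ 2 := by
        rw [hF]
        gcongr

end Composition

section Fibration

/-- The fibre of `φ` over `i` in `s`. -/
def fiberOn [DecidableEq Y] (s : Finset X) (φ : X → Y) (i : Y) : Finset X :=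
  s.filter fun x => φ x = i

/-- The image of the weights `ν` on `s` under `φ`. -/
def margOn [DecidableEq Y] (s : Finset X) (φ : X → Y) (ν : X → ℝ) (i : Y) : ℝ :=
  ∑ x ∈ fiberOn s φ i, ν x

/-- The weights `ν` on `s` conditioned by `φ = i`. -/
def condOn [DecidableEq Y] (s : Finset X) (φ : X → Y) (ν : X → ℝ) (i : Y) (x : X) : ℝ :=
  ν x / margOn s φ ν i

/-- `φ : s → V` with bijections between its fibres, which serve to compare kernels on different
fibres: `T j` maps any fibre to the one over `j`, and the inverse of its restriction to the fibre
over `i` is `T i`. -/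
structure IsTwisted (s : Finset X) (V : Finset Y) (φ : X → Y) (T : Y → X → X) : Prop where
  map_mem : ∀ x ∈ s, φ x ∈ V
  twist_mem : ∀ x ∈ s, ∀ j ∈ V, T j x ∈ s
  map_twist : ∀ x ∈ s, ∀ j ∈ V, φ (T j x) = j
  twist_twist : ∀ x ∈ s, ∀ j ∈ V, T (φ x) (T j x) = x

variable [DecidableEq Y] {s : Finset X} {V : Finset Y} {φ : X → Y} {T : Y → X → X}
  {ν ν₁ ν₂ : X → ℝ}

lemma mem_fiberOn {i : Y} {x : X} : x ∈ fiberOn s φ i ↔ x ∈ s ∧ φ x = i := Finset.mem_filter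

lemma sum_fiberOn (hφ : ∀ x ∈ s, φ x ∈ V) (g : X → ℝ) :
    ∑ i ∈ V, ∑ x ∈ fiberOn s φ i, g x = ∑ x ∈ s, g x :=
  Finset.sum_fiberwise_of_maps_to hφ g

lemma IsTwisted.sum_twist (h : IsTwisted s V φ T) {i j : Y} (hi : i ∈ V) (hj : j ∈ V)
    (g : X → ℝ) : ∑ y ∈ fiberOn s φ i, g (T j y) = ∑ y ∈ fiberOn s φ j, g y := by
  refine Finset.sum_bij' (fun y _ => T j y) (fun y _ => T i y) ?_ ?_ ?_ ?_ ?_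
  · intro y hy
    rw [mem_fiberOn] at hy ⊢
    exact ⟨h.twist_mem y hy.1 j hj, h.map_twist y hy.1 j hj⟩
  · intro y hy
    rw [mem_fiberOn] at hy ⊢
    exact ⟨h.twist_mem y hy.1 i hi, h.map_twist y hy.1 i hi⟩
  · intro y hy
    obtain ⟨hys, hyi⟩ := mem_fiberOn.1 hy
    simpa [hyi] using h.twist_twist y hys j hj
  · intro y hy
    obtain ⟨hys, hyi⟩ := mem_fiberOn.1 hy
    simpa [hyi] using h.twist_twist y hys i hi
  · intro y _
    rfl

lemma IsTwisted.card_fiberOn_eq (h : IsTwisted s V φ T) {i j : Y} (hi : i ∈ V) (hj : j ∈ V) :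
    (fiberOn s φ i).card = (fiberOn s φ j).card := by
  have := h.sum_twist hi hj (fun _ => 1)
  simp only [Finset.sum_const, nsmul_eq_mul, mul_one] at this
  exact_mod_cast this

lemma IsTwisted.card_mul (h : IsTwisted s V φ T) {i : Y} (hi : i ∈ V) :
    (V.card : ℝ) * (fiberOn s φ i).card = s.card := by
  have hcard : s.card = V.card * (fiberOn s φ i).card := by
    rw [Finset.card_eq_sum_card_fiberwise h.map_mem]
    exact Finset.sum_const_nat fun j hj => (h.card_fiberOn_eq hi hj).symm
  exact_mod_cast hcard.symm

lemma IsTwisted.card_ne_zero (h : IsTwisted s V φ T) {i : Y} (hi : i ∈ V) (hs : s.Nonempty) :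
    (V.card : ℝ) ≠ 0 ∧ ((fiberOn s φ i).card : ℝ) ≠ 0 := by
  rw [← mul_ne_zero_iff, h.card_mul hi]
  exact_mod_cast hs.card_pos.ne'

lemma sum_mul_comp (hφ : ∀ x ∈ s, φ x ∈ V) (ν : X → ℝ) (g : Y → ℝ) :
    ∑ x ∈ s, ν x * g (φ x) = ∑ i ∈ V, margOn s φ ν i * g i := by
  rw [← sum_fiberOn hφ]
  refine Finset.sum_congr rfl fun i _ => ?_
  rw [margOn, Finset.sum_mul]
  exact Finset.sum_congr rfl fun x hx => by rw [(mem_fiberOn.1 hx).2]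

lemma margOn_nonneg (hν : ∀ x ∈ s, 0 ≤ ν x) (i : Y) : 0 ≤ margOn s φ ν i :=
  Finset.sum_nonneg fun x hx => hν x (mem_fiberOn.1 hx).1

lemma IsProbOn.marg (hν : IsProbOn s ν) (hφ : ∀ x ∈ s, φ x ∈ V) : IsProbOn V (margOn s φ ν) where
  nonneg i _ := margOn_nonneg hν.nonneg i
  sum_eq := (sum_fiberOn hφ ν).trans hν.sum_eq

lemma IsProbOn.cond (hν : IsProbOn s ν) {i : Y} (hi : margOn s φ ν i ≠ 0) :
    IsProbOn (fiberOn s φ i) (condOn s φ ν i) where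
  nonneg x hx := div_nonneg (hν.nonneg x (mem_fiberOn.1 hx).1) (margOn_nonneg hν.nonneg i)
  sum_eq := by
    simp only [condOn, ← Finset.sum_div]
    exact div_self hi

lemma eq_zero_of_margOn_eq_zero (hν : ∀ x ∈ s, 0 ≤ ν x) {i : Y} (hi : margOn s φ ν i = 0)
    {x : X} (hx : x ∈ fiberOn s φ i) : ν x = 0 :=
  (Finset.sum_eq_zero_iff_of_nonneg fun y hy => hν y (mem_fiberOn.1 hy).1).1 hi x hx

lemma margOn_mul_condOn (hν : ∀ x ∈ s, 0 ≤ ν x) {i : Y} {x : X} (hx : x ∈ fiberOn s φ i) :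
    margOn s φ ν i * condOn s φ ν i x = ν x := by
  by_cases hi : margOn s φ ν i = 0
  · rw [hi, zero_mul, eq_zero_of_margOn_eq_zero hν hi hx]
  · exact mul_div_cancel₀ _ hi

lemma IsTwisted.margOn_unifOn (h : IsTwisted s V φ T) {i : Y} (hi : i ∈ V) (hs : s.Nonempty) :
    margOn s φ (unifOn s) i = unifOn V i := by
  obtain ⟨hV, hfiber⟩ := h.card_ne_zero hi hs
  simp only [margOn, unifOn, Finset.sum_const, nsmul_eq_mul, ← h.card_mul hi]
  field_simp

lemma IsTwisted.condOn_unifOn (h : IsTwisted s V φ T) {i : Y} (hi : i ∈ V)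
    (hs : s.Nonempty) (x : X) :
    condOn s φ (unifOn s) i x = unifOn (fiberOn s φ i) x := by
  obtain ⟨hV, hfiber⟩ := h.card_ne_zero hi hs
  rw [condOn, h.margOn_unifOn hi hs]
  simp only [unifOn, ← h.card_mul hi]
  field_simp

/-- The conditional relative entropy of `ν` given `φ`: the average over the law of `φ` of the
entropies of the conditioned weights relative to the uniform weights of the fibres. -/
def condEntOn (s : Finset X) (V : Finset Y) (φ : X → Y) (ν : X → ℝ) : ℝ :=
  ∑ i ∈ V, margOn s φ ν i * entOn (fiberOn s φ i) (condOn s φ ν i)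

lemma condEntOn_nonneg (hν : IsProbOn s ν) : 0 ≤ condEntOn s V φ ν :=
  Finset.sum_nonneg fun i _ => by
    rcases eq_or_ne (margOn s φ ν i) 0 with hi | hi
    · rw [hi, zero_mul]
    · exact mul_nonneg (margOn_nonneg hν.nonneg i) (entOn_nonneg (hν.cond hi))

lemma IsTwisted.entOn_eq_add_condEntOn (h : IsTwisted s V φ T) (hν : IsProbOn s ν) :
    entOn s ν = entOn V (margOn s φ ν) + condEntOn s V φ ν := by
  have hfibers : ∀ i ∈ V, ∑ x ∈ fiberOn s φ i, ν x * Real.log (s.card * ν x) =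
      margOn s φ ν i * Real.log (V.card * margOn s φ ν i) +
        margOn s φ ν i * entOn (fiberOn s φ i) (condOn s φ ν i) := by
    intro i hi
    conv_rhs => enter [1, 1]; rw [margOn]
    rw [entOn, Finset.mul_sum, Finset.sum_mul, ← Finset.sum_add_distrib]
    refine Finset.sum_congr rfl fun x hx => ?_
    rw [← mul_assoc, margOn_mul_condOn hν.nonneg hx, ← mul_add]
    by_cases hx0 : ν x = 0
    · simp [hx0]
    have hm : margOn s φ ν i ≠ 0 := fun h0 => hx0 (eq_zero_of_margOn_eq_zero hν.nonneg h0 hx)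
    obtain ⟨hV, hfiber⟩ := h.card_ne_zero hi hν.nonempty
    have hc : condOn s φ ν i x ≠ 0 := div_ne_zero hx0 hm
    rw [← Real.log_mul (mul_ne_zero hV hm) (mul_ne_zero hfiber hc), mul_mul_mul_comm,
      h.card_mul hi, margOn_mul_condOn hν.nonneg hx]
  rw [entOn, ← sum_fiberOn h.map_mem, Finset.sum_congr rfl hfibers, Finset.sum_add_distrib, entOn,
    condEntOn]

lemma IsTwisted.isProbOn_twist (h : IsTwisted s V φ T) {i j : Y} (hi : i ∈ V) (hj : j ∈ V)
    (hν : IsProbOn (fiberOn s φ j) ν) : IsProbOn (fiberOn s φ i) fun y => ν (T j y) where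
  nonneg y hy := hν.nonneg _ <| by
    rw [mem_fiberOn] at hy ⊢
    exact ⟨h.twist_mem y hy.1 j hj, h.map_twist y hy.1 j hj⟩
  sum_eq := (h.sum_twist hi hj ν).trans hν.sum_eq

lemma IsTwisted.entOn_twist (h : IsTwisted s V φ T) {i j : Y} (hi : i ∈ V) (hj : j ∈ V)
    (ν : X → ℝ) : entOn (fiberOn s φ i) (fun y => ν (T j y)) = entOn (fiberOn s φ j) ν := by
  rw [entOn, entOn, ← h.sum_twist hi hj, h.card_fiberOn_eq hi hj]

/-- The kernel that lifts `p` from the base to the total space of `φ`: it moves `φ x = i` to some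
`j` by `p`, moves `x` inside its fibre by `P i j`, and then applies `T j`. -/
def stepKernel (φ : X → Y) (T : Y → X → X) (p : Y → Y → ℝ) (P : Y → Y → X → X → ℝ) :
    X → X → ℝ :=
  fun x y => p (φ x) (φ y) * P (φ x) (φ y) x (T (φ x) y)

variable {p : Y → Y → ℝ} {P : Y → Y → X → X → ℝ}

lemma IsTwisted.sum_stepKernel (h : IsTwisted s V φ T) {x : X} (hx : x ∈ s) (g : X → ℝ) :
    ∑ y ∈ s, stepKernel φ T p P x y * g y =
      ∑ j ∈ V, p (φ x) j * ∑ y ∈ fiberOn s φ (φ x), P (φ x) j x y * g (T j y) := by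
  rw [← sum_fiberOn h.map_mem]
  refine Finset.sum_congr rfl fun j hj => ?_
  rw [← h.sum_twist (h.map_mem x hx) hj, Finset.mul_sum]
  refine Finset.sum_congr rfl fun y hy => ?_
  obtain ⟨hy, hyx⟩ := mem_fiberOn.1 hy
  rw [stepKernel, h.map_twist y hy j hj, ← hyx, h.twist_twist y hy j hj, mul_assoc]

lemma IsTwisted.isKernelOn_step (h : IsTwisted s V φ T) (hp : IsKernelOn V p)
    (hP : ∀ i ∈ V, ∀ j ∈ V, IsKernelOn (fiberOn s φ i) (P i j)) :
    IsKernelOn s (stepKernel φ T p P) where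
  nonneg x hx y hy := mul_nonneg (hp.nonneg _ (h.map_mem x hx) _ (h.map_mem y hy))
    ((hP _ (h.map_mem x hx) _ (h.map_mem y hy)).nonneg x (mem_fiberOn.2 ⟨hx, rfl⟩) _
      (mem_fiberOn.2 ⟨h.twist_mem y hy _ (h.map_mem x hx), h.map_twist y hy _ (h.map_mem x hx)⟩))
  sum_eq x hx := by
    have hsum := h.sum_stepKernel (p := p) (P := P) hx (fun _ => 1)
    simp only [mul_one] at hsum
    rw [hsum, ← hp.sum_eq _ (h.map_mem x hx)]
    refine Finset.sum_congr rfl fun j hj => ?_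
    rw [(hP _ (h.map_mem x hx) _ hj).sum_eq x (mem_fiberOn.2 ⟨hx, rfl⟩), mul_one]

lemma mul_stepKernel_eq (hν : ∀ x ∈ s, 0 ≤ ν x) {i : Y} {x : X} (hx : x ∈ fiberOn s φ i) (y : X) :
    ν x * stepKernel φ T p P x y =
      margOn s φ ν i * p i (φ y) * (condOn s φ ν i x * P i (φ y) x (T i y)) := by
  rw [stepKernel, (mem_fiberOn.1 hx).2, ← margOn_mul_condOn hν hx]
  ring

lemma IsTwisted.pushes_step (h : IsTwisted s V φ T) (hν₁ : IsProbOn s ν₁) (hν₂ : IsProbOn s ν₂)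
    (hp : IsKernelOn V p) (hpp : Pushes V p (margOn s φ ν₁) (margOn s φ ν₂))
    (hP : ∀ i ∈ V, ∀ j ∈ V, margOn s φ ν₁ i ≠ 0 → margOn s φ ν₂ j ≠ 0 →
      Pushes (fiberOn s φ i) (P i j) (condOn s φ ν₁ i) fun y => condOn s φ ν₂ j (T j y)) :
    Pushes s (stepKernel φ T p P) ν₁ ν₂ := by
  intro y hy
  have hj := h.map_mem y hy
  have hfibers : ∀ i ∈ V, ∑ x ∈ fiberOn s φ i, ν₁ x * stepKernel φ T p P x y =
      margOn s φ ν₁ i * p i (φ y) * condOn s φ ν₂ (φ y) y := by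
    intro i hi
    rw [Finset.sum_congr rfl fun x hx => mul_stepKernel_eq hν₁.nonneg hx y, ← Finset.mul_sum]
    by_cases hzero : margOn s φ ν₁ i * p i (φ y) = 0
    · rw [hzero, zero_mul, zero_mul]
    have hb : margOn s φ ν₂ (φ y) ≠ 0 := fun hb =>
      hzero (hpp.mul_eq_zero hp (fun i _ => margOn_nonneg hν₁.nonneg i) hi hj hb)
    have hmem : T i y ∈ fiberOn s φ i :=
      mem_fiberOn.2 ⟨h.twist_mem y hy i hi, h.map_twist y hy i hi⟩
    exact congrArg _ ((hP i hi (φ y) hj (left_ne_zero_of_mul hzero) hb (T i y) hmem).trans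
      (congrArg _ (h.twist_twist y hy i hi)))
  rw [← sum_fiberOn h.map_mem, Finset.sum_congr rfl hfibers, ← Finset.sum_mul, hpp _ hj]
  exact margOn_mul_condOn hν₂.nonneg (mem_fiberOn.2 ⟨hy, rfl⟩)

lemma IsTwisted.sum_step_eq (h : IsTwisted s V φ T) (hν₁ : IsProbOn s ν₁) (G : Y → Y → X → ℝ) :
    ∑ x ∈ s, ν₁ x * ∑ j ∈ V, p (φ x) j * G (φ x) j x =
      ∑ i ∈ V, ∑ j ∈ V, margOn s φ ν₁ i * p i j *
        ∑ x ∈ fiberOn s φ i, condOn s φ ν₁ i x * G i j x := by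
  rw [← sum_fiberOn h.map_mem]
  refine Finset.sum_congr rfl fun i _ => ?_
  simp only [Finset.mul_sum]
  rw [Finset.sum_comm]
  refine Finset.sum_congr rfl fun j _ => Finset.sum_congr rfl fun x hx => ?_
  rw [(mem_fiberOn.1 hx).2, ← margOn_mul_condOn hν₁.nonneg hx]
  ring

lemma IsTwisted.sum_sum_mul_le_condEntOn (h : IsTwisted s V φ T) (hν₁ : IsProbOn s ν₁)
    (hp : IsKernelOn V p) (hpp : Pushes V p (margOn s φ ν₁) (margOn s φ ν₂)) {B : Y → Y → ℝ}
    {c : ℝ} (hB : ∀ i ∈ V, ∀ j ∈ V, margOn s φ ν₁ i ≠ 0 → margOn s φ ν₂ j ≠ 0 →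
      B i j ≤ c * (entOn (fiberOn s φ i) (condOn s φ ν₁ i) +
        entOn (fiberOn s φ i) fun x => condOn s φ ν₂ j (T j x))) :
    ∑ i ∈ V, ∑ j ∈ V, margOn s φ ν₁ i * p i j * B i j ≤
      c * (condEntOn s V φ ν₁ + condEntOn s V φ ν₂) := by
  refine (hpp.sum_le hp (fun i _ => margOn_nonneg hν₁.nonneg i)
    (e₁ := fun i => c * entOn (fiberOn s φ i) (condOn s φ ν₁ i))
    (e₂ := fun j => c * entOn (fiberOn s φ j) (condOn s φ ν₂ j))
    fun i hi j hj ha hb => ?_).trans_eq ?_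
  · rw [← h.entOn_twist hi hj (condOn s φ ν₂ j), ← mul_add]
    exact hB i hi j hj ha hb
  · simp only [condEntOn, mul_add, Finset.mul_sum, mul_left_comm c]

lemma IsTwisted.sum_step_le (h : IsTwisted s V φ T) (hν₁ : IsProbOn s ν₁)
    (hp : IsKernelOn V p) (hpp : Pushes V p (margOn s φ ν₁) (margOn s φ ν₂))
    {G : Y → Y → X → ℝ} {c : ℝ}
    (hG : ∀ i ∈ V, ∀ j ∈ V, margOn s φ ν₁ i ≠ 0 → margOn s φ ν₂ j ≠ 0 →
      ∑ x ∈ fiberOn s φ i, condOn s φ ν₁ i x * G i j x ≤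
        c * (entOn (fiberOn s φ i) (condOn s φ ν₁ i) +
          entOn (fiberOn s φ i) fun x => condOn s φ ν₂ j (T j x))) :
    ∑ x ∈ s, ν₁ x * ∑ j ∈ V, p (φ x) j * G (φ x) j x ≤
      c * (condEntOn s V φ ν₁ + condEntOn s V φ ν₂) := by
  rw [h.sum_step_eq hν₁]
  exact h.sum_sum_mul_le_condEntOn hν₁ hp hpp hG

lemma IsTwisted.sq_sum_step_le (h : IsTwisted s V φ T) (hν₁ : IsProbOn s ν₁)
    (hp : IsKernelOn V p) (hpp : Pushes V p (margOn s φ ν₁) (margOn s φ ν₂))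
    {G : Y → Y → X → ℝ} {c : ℝ}
    (hG : ∀ i ∈ V, ∀ j ∈ V, margOn s φ ν₁ i ≠ 0 → margOn s φ ν₂ j ≠ 0 →
      (∑ x ∈ fiberOn s φ i, condOn s φ ν₁ i x * G i j x) ^ 2 ≤
        c * (entOn (fiberOn s φ i) (condOn s φ ν₁ i) +
          entOn (fiberOn s φ i) fun x => condOn s φ ν₂ j (T j x))) :
    (∑ x ∈ s, ν₁ x * ∑ j ∈ V, p (φ x) j * G (φ x) j x) ^ 2 ≤
      c * (condEntOn s V φ ν₁ + condEntOn s V φ ν₂) := by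
  rw [h.sum_step_eq hν₁, ← Finset.sum_product']
  refine le_trans ?_ (h.sum_sum_mul_le_condEntOn hν₁ hp hpp hG)
  rw [← Finset.sum_product']
  refine sq_sum_mul_le (fun q hq => ?_) (le_of_eq ?_)
  · rw [Finset.mem_product] at hq
    exact mul_nonneg (margOn_nonneg hν₁.nonneg _) (hp.nonneg _ hq.1 _ hq.2)
  · rw [Finset.sum_product, ← (hν₁.marg h.map_mem).sum_eq]
    refine Finset.sum_congr rfl fun i hi => ?_
    dsimp only
    rw [← Finset.mul_sum, hp.sum_eq i hi, mul_one]

end Fibration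

section Average

variable {s : Finset X} {A : Finset ι} {P : ι → X → X → ℝ} {ν₁ ν₂ : X → ℝ}

/-- The average of a finite family of kernels. -/
def avgKernel (A : Finset ι) (P : ι → X → X → ℝ) : X → X → ℝ :=
  fun x y => (A.card : ℝ)⁻¹ * ∑ l ∈ A, P l x y

lemma sum_avgKernel (x : X) (g : X → ℝ) : ∑ y ∈ s, avgKernel A P x y * g y =
    (A.card : ℝ)⁻¹ * ∑ l ∈ A, ∑ y ∈ s, P l x y * g y := by
  rw [Finset.sum_comm, Finset.mul_sum]
  refine Finset.sum_congr rfl fun y _ => ?_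
  rw [avgKernel, mul_assoc, Finset.sum_mul]

lemma isKernelOn_avg (hA : A.Nonempty) (hP : ∀ l ∈ A, IsKernelOn s (P l)) :
    IsKernelOn s (avgKernel A P) where
  nonneg x hx y hy := mul_nonneg (by positivity)
    (Finset.sum_nonneg fun l hl => (hP l hl).nonneg x hx y hy)
  sum_eq x hx := by
    have hsum := sum_avgKernel (s := s) (A := A) (P := P) x (fun _ => 1)
    simp only [mul_one] at hsum
    rw [hsum, Finset.sum_congr rfl fun l hl => (hP l hl).sum_eq x hx]
    have : (A.card : ℝ) ≠ 0 := by exact_mod_cast hA.card_pos.ne'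
    simp [this]

lemma pushes_avg (hA : A.Nonempty) (hP : ∀ l ∈ A, Pushes s (P l) ν₁ ν₂) :
    Pushes s (avgKernel A P) ν₁ ν₂ := fun y hy => by
  have : (A.card : ℝ) ≠ 0 := by exact_mod_cast hA.card_pos.ne'
  have hsum : ∑ x ∈ s, ν₁ x * avgKernel A P x y = (A.card : ℝ)⁻¹ *
      ∑ l ∈ A, ∑ x ∈ s, ν₁ x * P l x y := by
    rw [Finset.sum_comm, Finset.mul_sum]
    refine Finset.sum_congr rfl fun x _ => ?_
    rw [avgKernel, ← Finset.mul_sum]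
    ring
  rw [hsum, Finset.sum_congr rfl fun l hl => hP l hl y hy]
  simp [this]

end Average

section OneStep

variable {V : Finset Y} {a b : Y → ℝ}

lemma IsProbOn.sum_card_mul_sub_one (ha : IsProbOn V a) : ∑ i ∈ V, (V.card * a i - 1) = 0 := by
  rw [Finset.sum_sub_distrib, ← Finset.mul_sum, ha.sum_eq]
  simp

lemma IsProbOn.sq_sum_abs_sub_unifOn_le (ha : IsProbOn V a) :
    (∑ i ∈ V, |a i - unifOn V i|) ^ 2 ≤ 2 * entOn V a := by
  have hN := ha.card_pos
  have hf0 : ∀ i ∈ V, 0 ≤ V.card * a i := fun i hi => mul_nonneg hN.le (ha.nonneg i hi)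
  have hpoint : ∀ i ∈ V, |a i - unifOn V i| ^ 2 ≤
      2 / 3 * (a i + 2 * (V.card : ℝ)⁻¹) * ((V.card : ℝ)⁻¹ * klFun (V.card * a i)) := by
    intro i hi
    rw [sq_abs, unifOn]
    calc (a i - (V.card : ℝ)⁻¹) ^ 2
        = ((V.card : ℝ)⁻¹) ^ 2 / 3 * (3 * (V.card * a i - 1) ^ 2) := by field_simp
      _ ≤ _ := (mul_le_mul_of_nonneg_left (three_mul_sub_one_sq_le_klFun (hf0 i hi))
          (by positivity)).trans_eq (by field_simp)
  refine (Finset.sum_sq_le_sum_mul_sum_of_sq_le_mul V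
    (fun i hi => by have := ha.nonneg i hi; positivity)
    (fun i hi => mul_nonneg (by positivity) (klFun_nonneg (hf0 i hi))) hpoint).trans_eq ?_
  rw [← Finset.mul_sum, ← Finset.mul_sum, ← entOn_eq_klFun ha, Finset.sum_add_distrib, ha.sum_eq,
    Finset.sum_const, nsmul_eq_mul]
  field_simp
  norm_num

/-- The probability of staying at `i` in the optimal transport of `a` to `b` for the total
variation. -/
def stayMass (a b : Y → ℝ) (i : Y) : ℝ := if a i ≤ b i then 1 else b i / a i

lemma stayMass_mem (ha : IsProbOn V a) (hb : IsProbOn V b) {i : Y} (hi : i ∈ V) :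
    0 ≤ stayMass a b i ∧ stayMass a b i ≤ 1 := by
  unfold stayMass
  split_ifs with h
  · simp
  · exact ⟨div_nonneg (hb.nonneg i hi) (ha.nonneg i hi),
      div_le_one_of_le₀ (not_le.1 h).le (ha.nonneg i hi)⟩

lemma mul_one_sub_stayMass (hb : IsProbOn V b) {i : Y} (hi : i ∈ V) :
    a i * (1 - stayMass a b i) = max (a i - b i) 0 := by
  unfold stayMass
  split_ifs with h
  · rw [max_eq_right (by linarith)]; ring
  · have : a i ≠ 0 := by linarith [hb.nonneg i hi]
    rw [max_eq_left (by linarith)]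
    field_simp

lemma max_sub_zero (x y : ℝ) : max (x - y) 0 = (|x - y| + (x - y)) / 2 := by
  rcases le_total x y with h | h
  · rw [max_eq_right (by linarith), abs_of_nonpos (by linarith)]; ring
  · rw [max_eq_left (by linarith), abs_of_nonneg (by linarith)]; ring

lemma sum_max_sub (ha : IsProbOn V a) (hb : IsProbOn V b) :
    ∑ i ∈ V, max (a i - b i) 0 = (∑ i ∈ V, |a i - b i|) / 2 := by
  simp only [max_sub_zero, ← Finset.sum_div, Finset.sum_add_distrib, Finset.sum_sub_distrib,
    ha.sum_eq, hb.sum_eq]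
  ring

lemma sum_max_sub_comm (ha : IsProbOn V a) (hb : IsProbOn V b) :
    ∑ i ∈ V, max (a i - b i) 0 = ∑ i ∈ V, max (b i - a i) 0 := by
  rw [sum_max_sub ha hb, sum_max_sub hb ha]
  simp only [abs_sub_comm]

/-- At least one of the weights `a` and `b` is uniform on `V`. Only such pairs are transported to
each other directly; the general case passes through the uniform weights. -/
def EitherUnifOn (V : Finset Y) (a b : Y → ℝ) : Prop :=
  (∀ i ∈ V, a i = unifOn V i) ∨ ∀ i ∈ V, b i = unifOn V i

lemma entOn_eq_zero (ha : ∀ i ∈ V, a i = unifOn V i) : entOn V a = 0 :=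
  (entOn_congr ha).trans (entOn_unifOn V)

lemma sum_mul_one_sub_stayMass_sq_le_of_unif_left (ha : ∀ i ∈ V, a i = unifOn V i)
    (hb : IsProbOn V b) : ∑ i ∈ V, a i * (1 - stayMass a b i) ^ 2 ≤ 2 * entOn V b := by
  have hN := hb.card_pos
  rw [entOn_eq_klFun hb, mul_left_comm, Finset.mul_sum, Finset.mul_sum]
  refine Finset.sum_le_sum fun i hi => ?_
  have hf0 : 0 ≤ V.card * b i := mul_nonneg hN.le (hb.nonneg i hi)
  rw [stayMass, ha i hi, unifOn]
  refine mul_le_mul_of_nonneg_left ?_ (inv_nonneg.2 hN.le)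
  split_ifs with h
  · simpa using klFun_nonneg hf0
  · rw [div_inv_eq_mul, mul_comm]
    refine one_sub_sq_le_two_mul_klFun hf0 ?_
    rw [← le_inv_mul_iff₀ hN, mul_one]
    exact (not_le.1 h).le

lemma sum_mul_one_sub_stayMass_sq_le_of_unif_right (ha : IsProbOn V a)
    (hb : ∀ i ∈ V, b i = unifOn V i) :
    ∑ i ∈ V, a i * (1 - stayMass a b i) ^ 2 ≤ 2 * entOn V a := by
  have hN := ha.card_pos
  rw [entOn_eq_klFun ha, mul_left_comm, Finset.mul_sum, Finset.mul_sum]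
  refine Finset.sum_le_sum fun i hi => ?_
  rw [stayMass, hb i hi, unifOn]
  split_ifs with h
  · rw [sub_self]
    have hkl := klFun_nonneg (mul_nonneg hN.le (ha.nonneg i hi))
    simpa using mul_nonneg (inv_nonneg.2 hN.le) (mul_nonneg zero_le_two hkl)
  · rw [not_le] at h
    have hai : 0 < a i := (inv_pos.2 hN).trans h
    have hf1 : 1 ≤ V.card * a i := ((inv_lt_iff_one_lt_mul₀' hN).1 h).le
    calc a i * (1 - (V.card : ℝ)⁻¹ / a i) ^ 2
        = (V.card : ℝ)⁻¹ * ((V.card * a i - 1) ^ 2 / (V.card * a i)) := by field_simp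
      _ ≤ _ := mul_le_mul_of_nonneg_left (sub_one_sq_div_le_two_mul_klFun hf1)
          (inv_nonneg.2 hN.le)

lemma sum_mul_one_sub_stayMass_sq_le (ha : IsProbOn V a) (hb : IsProbOn V b)
    (hu : EitherUnifOn V a b) :
    ∑ i ∈ V, a i * (1 - stayMass a b i) ^ 2 ≤ 2 * (entOn V a + entOn V b) := by
  rcases hu with hu | hu
  · simpa [entOn_eq_zero hu] using sum_mul_one_sub_stayMass_sq_le_of_unif_left hu hb
  · simpa [entOn_eq_zero hu] using sum_mul_one_sub_stayMass_sq_le_of_unif_right ha hu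

lemma sq_sum_mul_one_sub_stayMass_le (ha : IsProbOn V a) (hb : IsProbOn V b)
    (hu : EitherUnifOn V a b) :
    (∑ i ∈ V, a i * (1 - stayMass a b i)) ^ 2 ≤ (entOn V a + entOn V b) / 2 := by
  rw [Finset.sum_congr rfl fun i hi => mul_one_sub_stayMass hb hi, sum_max_sub ha hb]
  rcases hu with hu | hu
  · have hpinsker := hb.sq_sum_abs_sub_unifOn_le
    rw [Finset.sum_congr rfl fun i hi => by rw [← hu i hi, abs_sub_comm]] at hpinsker
    rw [entOn_eq_zero hu]
    linarith
  · have hpinsker := ha.sq_sum_abs_sub_unifOn_le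
    rw [Finset.sum_congr rfl fun i hi => by rw [← hu i hi]] at hpinsker
    rw [entOn_eq_zero hu]
    linarith

/-- The probability of leaving `i` for `j` in the transport of `a` to the uniform weights in which
every `i` sends the mass `(a i - a j) / |V|` to every `j` of smaller mass. -/
def outflow (V : Finset Y) (a : Y → ℝ) (i j : Y) : ℝ :=
  (V.card : ℝ)⁻¹ * if a j < a i then 1 - a j / a i else 0

lemma outflow_self (i : Y) : outflow V a i i = 0 := by simp [outflow]

lemma outflow_mem (ha : IsProbOn V a) {i j : Y} (hi : i ∈ V) (hj : j ∈ V) :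
    0 ≤ outflow V a i j ∧ outflow V a i j ≤ (V.card : ℝ)⁻¹ := by
  have hN := ha.card_pos
  unfold outflow
  have h0 : 0 ≤ a j / a i := div_nonneg (ha.nonneg j hj) (ha.nonneg i hi)
  split_ifs with h
  · have h1 : a j / a i ≤ 1 := div_le_one_of_le₀ h.le (ha.nonneg i hi)
    exact ⟨mul_nonneg (by positivity) (by linarith),
      mul_le_of_le_one_right (by positivity) (by linarith)⟩
  · simp

lemma mul_outflow (ha : IsProbOn V a) {i j : Y} (hj : j ∈ V) :
    a i * outflow V a i j = (V.card : ℝ)⁻¹ * max (a i - a j) 0 := by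
  unfold outflow
  split_ifs with h
  · have : a i ≠ 0 := by linarith [ha.nonneg j hj]
    rw [max_eq_left (by linarith)]
    field_simp
  · rw [max_eq_right (by linarith)]; simp

lemma sum_sum_sq_div_le {f : Y → ℝ} (hf0 : ∀ i ∈ V, 0 ≤ f i) (hf : ∑ i ∈ V, (f i - 1) = 0) :
    ∑ i ∈ V, ∑ j ∈ V, (if f j < f i then (f i - f j) ^ 2 / f i else 0) ≤
      2 * (V.card * ∑ i ∈ V, klFun (f i)) := by
  let K : Y → Y → ℝ := fun i j => if f j < f i then (f i - f j) ^ 2 / f i else 0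
  have hpair : ∀ i ∈ V, ∀ j ∈ V, K i j + K j i ≤ 2 * klFun (f i) + 2 * klFun (f j) +
      (f i - 1) * pairCorrection (f j) + (f j - 1) * pairCorrection (f i) := by
    intro i hi j hj
    simp only [K]
    rcases lt_trichotomy (f i) (f j) with h | h | h
    · rw [if_neg h.not_gt, if_pos h]
      linarith [sq_div_le_klFun_add_pairCorrection (hf0 i hi) h.le]
    · rw [h, if_neg (lt_irrefl _)]
      simpa using sq_div_le_klFun_add_pairCorrection (hf0 j hj) le_rfl
    · rw [if_neg h.not_gt, if_pos h]
      linarith [sq_div_le_klFun_add_pairCorrection (hf0 j hj) h.le]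
  have hdouble : 2 * ∑ i ∈ V, ∑ j ∈ V, K i j ≤ 4 * (V.card * ∑ i ∈ V, klFun (f i)) := by
    calc 2 * ∑ i ∈ V, ∑ j ∈ V, K i j = ∑ i ∈ V, ∑ j ∈ V, (K i j + K j i) := by
          simp only [Finset.sum_add_distrib]
          rw [Finset.sum_comm (f := fun i j => K j i), two_mul]
      _ ≤ ∑ i ∈ V, ∑ j ∈ V, (2 * klFun (f i) + 2 * klFun (f j) +
          (f i - 1) * pairCorrection (f j) + (f j - 1) * pairCorrection (f i)) :=
          Finset.sum_le_sum fun i hi => Finset.sum_le_sum fun j hj => hpair i hi j hj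
      _ = _ := by
          simp only [Finset.sum_add_distrib, ← Finset.mul_sum, ← Finset.sum_mul, hf,
            Finset.sum_const, nsmul_eq_mul]
          ring
  linarith

lemma sum_mul_outflow_sq_le (ha : IsProbOn V a) :
    ∑ i ∈ V, a i * (V.card * ∑ j ∈ V, outflow V a i j ^ 2) ≤ 2 * entOn V a := by
  have hN := ha.card_pos
  let f : Y → ℝ := fun i => V.card * a i
  have hterm : ∀ i ∈ V, ∀ j ∈ V, a i * (V.card * outflow V a i j ^ 2) =
      ((V.card : ℝ)⁻¹) ^ 2 * if f j < f i then (f i - f j) ^ 2 / f i else 0 := fun i _ j hj => by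
    simp only [f, outflow, mul_lt_mul_iff_right₀ hN]
    split_ifs with h
    · have : a i ≠ 0 := by linarith [ha.nonneg j hj]
      field_simp
    · simp
  calc ∑ i ∈ V, a i * (V.card * ∑ j ∈ V, outflow V a i j ^ 2)
      = ((V.card : ℝ)⁻¹) ^ 2 *
          ∑ i ∈ V, ∑ j ∈ V, (if f j < f i then (f i - f j) ^ 2 / f i else 0) := by
        simp only [Finset.mul_sum]
        exact Finset.sum_congr rfl fun i hi => Finset.sum_congr rfl fun j hj => hterm i hi j hj
    _ ≤ ((V.card : ℝ)⁻¹) ^ 2 * (2 * (V.card * ∑ i ∈ V, klFun (f i))) :=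
        mul_le_mul_of_nonneg_left (sum_sum_sq_div_le
          (fun i hi => mul_nonneg hN.le (ha.nonneg i hi)) ha.sum_card_mul_sub_one) (by positivity)
    _ = _ := by
        rw [entOn_eq_klFun ha]
        simp only [f]
        field_simp

variable [DecidableEq Y]

/-- The kernel of the optimal transport of `a` to `b` for the total variation. -/
def tvKernel (V : Finset Y) (a b : Y → ℝ) (i j : Y) : ℝ :=
  (if i = j then stayMass a b i else 0) +
    (1 - stayMass a b i) * (max (b j - a j) 0 / ∑ l ∈ V, max (b l - a l) 0)

lemma isKernelOn_tv (ha : IsProbOn V a) (hb : IsProbOn V b) : IsKernelOn V (tvKernel V a b) where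
  nonneg i hi j _ := by
    have hstay := stayMass_mem ha hb hi
    refine add_nonneg (by split_ifs <;> simp [hstay.1]) (mul_nonneg (sub_nonneg.2 hstay.2)
      (div_nonneg (le_max_right _ _) (Finset.sum_nonneg fun l _ => le_max_right _ _)))
  sum_eq i hi := by
    simp only [tvKernel]
    rw [Finset.sum_add_distrib, Finset.sum_ite_eq, if_pos hi, ← Finset.mul_sum, ← Finset.sum_div]
    by_cases h0 : ∑ l ∈ V, max (b l - a l) 0 = 0
    · have hexcess : max (a i - b i) 0 = 0 := by
        rw [← sum_max_sub_comm ha hb] at h0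
        exact (Finset.sum_eq_zero_iff_of_nonneg fun l _ => le_max_right _ _).1 h0 i hi
      have hab : a i ≤ b i := sub_nonpos.1 (max_eq_right_iff.1 hexcess)
      simp [stayMass, hab]
    · rw [div_self h0]; ring

lemma pushes_tv (ha : IsProbOn V a) (hb : IsProbOn V b) : Pushes V (tvKernel V a b) a b := by
  intro j hj
  have hterm : ∀ i ∈ V, a i * tvKernel V a b i j = (if i = j then a i * stayMass a b i else 0) +
      max (a i - b i) 0 * (max (b j - a j) 0 / ∑ l ∈ V, max (b l - a l) 0) := fun i hi => by
    rw [← mul_one_sub_stayMass hb hi, tvKernel]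
    split_ifs <;> ring
  have hgain : (∑ l ∈ V, max (b l - a l) 0) * (max (b j - a j) 0 / ∑ l ∈ V, max (b l - a l) 0) =
      max (b j - a j) 0 :=
    mul_div_cancel_of_imp' fun h0 =>
      (Finset.sum_eq_zero_iff_of_nonneg fun l _ => le_max_right _ _).1 h0 j hj
  have hstay := mul_one_sub_stayMass (a := a) hb hj
  rw [Finset.sum_congr rfl hterm, Finset.sum_add_distrib, Finset.sum_ite_eq', if_pos hj,
    ← Finset.sum_mul, sum_max_sub_comm ha hb, hgain, max_sub_zero, abs_sub_comm]
  rw [max_sub_zero] at hstay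
  linarith

lemma tvKernel_self (i : Y) :
    tvKernel V a b i i = stayMass a b i := by
  rw [tvKernel, if_pos rfl]
  unfold stayMass
  split_ifs with h
  · simp
  · rw [max_eq_right (by linarith)]; simp

lemma IsKernelOn.sum_erase {p : Y → Y → ℝ} (hp : IsKernelOn V p) {i : Y} (hi : i ∈ V) :
    ∑ j ∈ V.erase i, p i j = 1 - p i i := by
  rw [← hp.sum_eq i hi, ← Finset.add_sum_erase V _ hi]
  ring

/-- The kernel with transition probabilities `outflow V a` off the diagonal, which transports `a` to
the uniform weights. Unlike `tvKernel V a (unifOn V)`, it moves little mass along each single edge: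
compare `sum_mul_outflow_sq_le`. -/
def flowKernel (V : Finset Y) (a : Y → ℝ) (i j : Y) : ℝ :=
  (if i = j then 1 - ∑ l ∈ V, outflow V a i l else 0) + outflow V a i j

lemma flowKernel_self (i : Y) : flowKernel V a i i = 1 - ∑ l ∈ V, outflow V a i l := by
  simp [flowKernel, outflow_self]

lemma flowKernel_of_ne {i j : Y} (h : i ≠ j) : flowKernel V a i j = outflow V a i j := by
  simp [flowKernel, h]

lemma isKernelOn_flow (ha : IsProbOn V a) : IsKernelOn V (flowKernel V a) where
  nonneg i hi j hj := by
    refine add_nonneg ?_ (outflow_mem ha hi hj).1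
    split_ifs
    · rw [sub_nonneg]
      refine (Finset.sum_le_sum fun l hl => (outflow_mem ha hi hl).2).trans_eq ?_
      have := ha.card_pos.ne'
      simp [this]
    · exact le_rfl
  sum_eq i hi := by
    simp only [flowKernel]
    rw [Finset.sum_add_distrib, Finset.sum_ite_eq, if_pos hi]
    ring

lemma pushes_flow (ha : IsProbOn V a) : Pushes V (flowKernel V a) a (unifOn V) := by
  intro j hj
  have hN := ha.card_pos
  have hterm : ∀ i ∈ V, a i * flowKernel V a i j =
      (if i = j then a i - ∑ l ∈ V, (V.card : ℝ)⁻¹ * max (a i - a l) 0 else 0) +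
      (V.card : ℝ)⁻¹ * max (a i - a j) 0 := fun i _ => by
    rw [← mul_outflow ha hj, flowKernel, ← Finset.sum_congr rfl fun l hl => mul_outflow ha hl,
      ← Finset.mul_sum]
    split_ifs <;> ring
  have hnet : ∀ l ∈ V, (V.card : ℝ)⁻¹ * max (a l - a j) 0 - (V.card : ℝ)⁻¹ * max (a j - a l) 0 =
      (V.card : ℝ)⁻¹ * (a l - a j) := fun l _ => by
    rw [max_sub_zero, max_sub_zero, abs_sub_comm]
    ring
  have hbalance : ∑ l ∈ V, (V.card : ℝ)⁻¹ * max (a l - a j) 0 -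
      ∑ l ∈ V, (V.card : ℝ)⁻¹ * max (a j - a l) 0 = (V.card : ℝ)⁻¹ - a j := by
    rw [← Finset.sum_sub_distrib, Finset.sum_congr rfl hnet, ← Finset.mul_sum,
      Finset.sum_sub_distrib, ha.sum_eq, Finset.sum_const, nsmul_eq_mul]
    field_simp
  rw [Finset.sum_congr rfl hterm, Finset.sum_add_distrib, Finset.sum_ite_eq', if_pos hj, unifOn]
  linarith

end OneStep

section Mean

/-- The mean of `g` over `s`. -/
def meanOn (s : Finset X) (g : X → ℝ) : ℝ := (s.card : ℝ)⁻¹ * ∑ x ∈ s, g x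

variable {s : Finset X}

lemma meanOn_congr {g g' : X → ℝ} (h : ∀ x ∈ s, g x = g' x) :
    meanOn s g = meanOn s g' := by rw [meanOn, meanOn, Finset.sum_congr rfl h]

lemma meanOn_const (hs : s.Nonempty) (c : ℝ) :
    meanOn s (fun _ => c) = c := by
  have : (s.card : ℝ) ≠ 0 := by exact_mod_cast hs.card_pos.ne'
  simp [meanOn, this]

lemma IsTwisted.meanOn_eq [DecidableEq Y] {V : Finset Y} {φ : X → Y}
    {T : Y → X → X} (h : IsTwisted s V φ T) (g : X → ℝ) :
    meanOn s g = meanOn V fun i => meanOn (fiberOn s φ i) g := by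
  simp only [meanOn]
  rw [← sum_fiberOn h.map_mem, Finset.mul_sum, Finset.mul_sum]
  refine Finset.sum_congr rfl fun i hi => ?_
  rw [← h.card_mul hi, mul_inv, mul_assoc]

lemma sum_unifOn_mul (g : X → ℝ) : ∑ x ∈ s, unifOn s x * g x = meanOn s g := by
  rw [meanOn, Finset.mul_sum]
  rfl

lemma meanOn_add {f g : X → ℝ} : meanOn s (fun x => f x + g x) = meanOn s f + meanOn s g := by
  rw [meanOn, meanOn, meanOn, Finset.sum_add_distrib, mul_add]

lemma meanOn_sum {I : Finset ι} {f : ι → X → ℝ} :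
    meanOn s (fun x => ∑ i ∈ I, f i x) = ∑ i ∈ I, meanOn s (f i) := by
  simp only [meanOn]
  rw [Finset.sum_comm, Finset.mul_sum]

lemma meanOn_mul_left {f : X → ℝ} (c : ℝ) : meanOn s (fun x => c * f x) = c * meanOn s f := by
  simp only [meanOn, ← Finset.mul_sum]
  ring

lemma meanOn_mono {f g : X → ℝ} (h : ∀ x ∈ s, f x ≤ g x) : meanOn s f ≤ meanOn s g :=
  mul_le_mul_of_nonneg_left (Finset.sum_le_sum h) (by positivity)

lemma meanOn_meanOn_erase_mul_le [DecidableEq X] {f g : X → ℝ} (hf : ∀ x ∈ s, 0 ≤ f x)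
    (hg : ∀ x ∈ s, 0 ≤ g x) :
    meanOn s (fun x => meanOn (s.erase x) fun y => f x * g y) ≤
      ((s.card : ℝ) * (s.card - 1))⁻¹ * ((∑ x ∈ s, f x) * ∑ x ∈ s, g x) := by
  rw [meanOn, mul_inv, mul_assoc]
  refine mul_le_mul_of_nonneg_left ?_ (by positivity)
  rw [Finset.sum_mul, Finset.mul_sum]
  refine Finset.sum_le_sum fun x hx => ?_
  rw [meanOn_mul_left, meanOn, mul_left_comm, Finset.card_erase_of_mem hx,
    Nat.cast_pred (Finset.card_pos.2 ⟨x, hx⟩)]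
  have hcard : (1 : ℝ) ≤ s.card := by exact_mod_cast Finset.card_pos.2 ⟨x, hx⟩
  refine mul_le_mul_of_nonneg_left (mul_le_mul_of_nonneg_left ?_ (hf x hx))
    (inv_nonneg.2 (sub_nonneg.2 hcard))
  exact Finset.sum_le_sum_of_subset_of_nonneg (Finset.erase_subset _ _) fun y hy _ => hg y hy

end Mean

section Coset

variable {α : Type*} [DecidableEq α]

/-- The product of `σ` with a transposition that takes the value `j` at `l`. These maps identify
the fibres of `σ ↦ σ l` in a coset with each other. -/
def swapTo (l j : α) (σ : Equiv.Perm α) : Equiv.Perm α := Equiv.swap (σ l) j * σ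

lemma swapTo_apply_self (l j : α) (σ : Equiv.Perm α) : swapTo l j σ l = j := by simp [swapTo]

variable [Fintype α]

/-- The permutations that agree with `ρ` on `A`. They form a left coset of the pointwise stabiliser
of `A`. -/
def coset (A : Finset α) (ρ : Equiv.Perm α) : Finset (Equiv.Perm α) :=
  Finset.univ.filter fun σ => ∀ a ∈ A, σ a = ρ a

/-- The values that `ρ` does not take on `A`, which are those taken off `A` by any permutation in
`coset A ρ`. -/
def freeValues (A : Finset α) (ρ : Equiv.Perm α) : Finset α := (A.map ρ.toEmbedding)ᶜ

/-- The law under `ν` of the value at `l` of a permutation in the coset. -/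
abbrev evalLaw (A : Finset α) (ρ : Equiv.Perm α) (ν : Equiv.Perm α → ℝ) (l : α) : α → ℝ :=
  margOn (coset A ρ) (fun σ => σ l) ν

variable {A : Finset α} {ρ : Equiv.Perm α}

lemma mem_coset {σ : Equiv.Perm α} : σ ∈ coset A ρ ↔ ∀ a ∈ A, σ a = ρ a := by simp [coset]

lemma self_mem_coset : ρ ∈ coset A ρ := mem_coset.2 fun _ _ => rfl

lemma coset_nonempty : (coset A ρ).Nonempty := ⟨ρ, self_mem_coset⟩

lemma mem_freeValues {v : α} : v ∈ freeValues A ρ ↔ ∀ a ∈ A, ρ a ≠ v := by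
  simp [freeValues, -Finset.mem_map_equiv]

lemma card_freeValues : (freeValues A ρ).card = Aᶜ.card := by
  rw [freeValues, Finset.card_compl, Finset.card_compl, Finset.card_map]

lemma apply_mem_freeValues {σ : Equiv.Perm α} (hσ : σ ∈ coset A ρ) {l : α} :
    σ l ∈ freeValues A ρ ↔ l ∈ Aᶜ := by
  rw [mem_freeValues, Finset.mem_compl]
  rw [mem_coset] at hσ
  constructor
  · exact fun h hl => h l hl (hσ l hl).symm
  · intro hl a ha h
    rw [← hσ a ha] at h
    exact hl (σ.injective h ▸ ha)

lemma isTwisted_coset {l : α} (hl : l ∈ Aᶜ) :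
    IsTwisted (coset A ρ) (freeValues A ρ) (fun σ => σ l) (swapTo l) where
  map_mem σ hσ := (apply_mem_freeValues hσ).2 hl
  twist_mem σ hσ j hj := by
    rw [mem_coset] at hσ ⊢
    intro a ha
    rw [swapTo, Equiv.Perm.mul_apply, Equiv.swap_apply_of_ne_of_ne, hσ a ha]
    · exact fun h => Finset.mem_compl.1 hl (σ.injective h ▸ ha)
    · rw [hσ a ha]
      exact mem_freeValues.1 hj a ha
  map_twist σ _ j _ := swapTo_apply_self l j σ
  twist_twist σ _ j _ := by
    ext x
    simp [swapTo, Equiv.swap_comm j]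

lemma swapTo_apply_of_mem {l i : α} (hl : l ∈ Aᶜ) (hi : i ∈ freeValues A ρ) {a : α} (ha : a ∈ A) :
    swapTo l i ρ a = ρ a :=
  mem_coset.1 ((isTwisted_coset hl).twist_mem ρ self_mem_coset i hi) a ha

lemma fiberOn_coset {l i : α} (hl : l ∈ Aᶜ) (hi : i ∈ freeValues A ρ) :
    fiberOn (coset A ρ) (fun σ => σ l) i = coset (insert l A) (swapTo l i ρ) := by
  ext σ
  rw [mem_fiberOn, mem_coset, mem_coset, Finset.forall_mem_insert, swapTo_apply_self, and_comm]
  refine and_congr_right fun _ => forall₂_congr fun a ha => ?_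
  rw [swapTo_apply_of_mem hl hi ha]

lemma freeValues_insert {l i : α} (hl : l ∈ Aᶜ) (hi : i ∈ freeValues A ρ) :
    freeValues (insert l A) (swapTo l i ρ) = (freeValues A ρ).erase i := by
  ext v
  rw [Finset.mem_erase, mem_freeValues, mem_freeValues, Finset.forall_mem_insert,
    swapTo_apply_self, ne_comm]
  refine and_congr_right fun _ => forall₂_congr fun a ha => ?_
  rw [swapTo_apply_of_mem hl hi ha]

lemma sum_erase_comp_coset {σ : Equiv.Perm α} (hσ : σ ∈ coset A ρ) (l : α) (h : α → ℝ) :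
    ∑ m ∈ Aᶜ.erase l, h (σ m) = ∑ v ∈ (freeValues A ρ).erase (σ l), h v :=
  Finset.sum_equiv σ (fun m => by
    rw [Finset.mem_erase, Finset.mem_erase, apply_mem_freeValues hσ, σ.injective.ne_iff])
    fun _ _ => rfl

lemma meanOn_coset_insert {l : α} (hl : l ∈ Aᶜ) (g : α → Equiv.Perm α → ℝ) :
    meanOn (coset A ρ) (fun σ => g (σ l) σ) = meanOn (freeValues A ρ) fun i =>
      meanOn (coset (insert l A) (swapTo l i ρ)) (g i) := by
  rw [(isTwisted_coset hl).meanOn_eq]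
  refine meanOn_congr fun i hi => ?_
  rw [← fiberOn_coset hl hi]
  exact meanOn_congr fun σ hσ => by rw [(mem_fiberOn.1 hσ).2]

lemma meanOn_coset_eval {l : α} (hl : l ∈ Aᶜ) (h : α → ℝ) :
    meanOn (coset A ρ) (fun σ => h (σ l)) = meanOn (freeValues A ρ) h :=
  (meanOn_coset_insert hl fun i _ => h i).trans
    (meanOn_congr fun i _ => meanOn_const coset_nonempty (h i))

lemma meanOn_coset_eval₃ {m l l' : α} (hm : m ∈ Aᶜ) (hl : l ∈ Aᶜ.erase m)
    (hl' : l' ∈ (Aᶜ.erase m).erase l) (H : α → α → α → ℝ) :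
    meanOn (coset A ρ) (fun σ => H (σ m) (σ l) (σ l')) = meanOn (freeValues A ρ) fun v =>
      meanOn ((freeValues A ρ).erase v) fun i =>
        meanOn (((freeValues A ρ).erase v).erase i) (H v i) := by
  rw [meanOn_coset_insert hm (fun v σ => H v (σ l) (σ l'))]
  refine meanOn_congr fun v hv => ?_
  rw [← Finset.compl_insert] at hl hl'
  rw [meanOn_coset_insert hl (fun i σ => H v i (σ l')), freeValues_insert hm hv]
  refine meanOn_congr fun i hi => ?_
  rw [← Finset.compl_insert] at hl'
  rw [← freeValues_insert hm hv] at hi ⊢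
  rw [meanOn_coset_eval hl', freeValues_insert hl hi]

/-- Together with `IsProbOn.evalLaw`, this says that the laws of the values at the free positions
form a doubly stochastic matrix. -/
lemma sum_evalLaw {ν : Equiv.Perm α → ℝ} (hν : IsProbOn (coset A ρ) ν) {v : α}
    (hv : v ∈ freeValues A ρ) : ∑ l ∈ Aᶜ, evalLaw A ρ ν l v = 1 := by
  simp only [margOn, fiberOn, Finset.sum_filter]
  rw [Finset.sum_comm, ← hν.sum_eq]
  refine Finset.sum_congr rfl fun σ hσ => ?_
  rw [Finset.sum_eq_single (σ.symm v)]
  · simp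
  · intro l _ hl
    rw [if_neg]
    rintro rfl
    simp at hl
  · intro h
    exact absurd ((apply_mem_freeValues hσ).1 (by simpa using hv)) h

lemma IsProbOn.evalLaw {ν : Equiv.Perm α → ℝ} (hν : IsProbOn (coset A ρ) ν) {l : α}
    (hl : l ∈ Aᶜ) : IsProbOn (freeValues A ρ) (evalLaw A ρ ν l) :=
  hν.marg (isTwisted_coset hl).map_mem

end Coset

section Excess

variable {V : Finset Y} {b : Y → ℝ} {v : Y}

/-- The excess of the density of `b` over the uniform density. -/
def excess (V : Finset Y) (b : Y → ℝ) (v : Y) : ℝ := max (V.card * b v - 1) 0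

lemma stayMass_sq_add_excess_le (hb : IsProbOn V b) (hv : v ∈ V) :
    2 * (1 - stayMass (unifOn V) b v) ^ 2 + 2 * (excess V b v ^ 2 / (1 + excess V b v)) ≤
      4 * klFun (V.card * b v) := by
  have hN := hb.card_pos
  have hf0 : 0 ≤ V.card * b v := mul_nonneg hN.le (hb.nonneg v hv)
  unfold stayMass excess unifOn
  split_ifs with h
  · have hf1 : 1 ≤ V.card * b v := (inv_le_iff_one_le_mul₀' hN).1 h
    rw [max_eq_left (by linarith), add_sub_cancel]
    linarith [sub_one_sq_div_le_two_mul_klFun hf1]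
  · have hf1 : V.card * b v ≤ 1 := by
      rw [← le_inv_mul_iff₀ hN, mul_one]
      exact (not_le.1 h).le
    rw [max_eq_right (by linarith), div_inv_eq_mul, mul_comm (b v)]
    linarith [one_sub_sq_le_two_mul_klFun hf0 hf1]

lemma sq_sum_excess_le {s : Finset ι} {b : ι → Y → ℝ} (hb : ∀ l ∈ s, 0 ≤ b l v)
    (hsum : ∑ l ∈ s, b l v = 1) :
    (∑ l ∈ s, excess V (b l) v) ^ 2 ≤
      (s.card + V.card) * ∑ l ∈ s, excess V (b l) v ^ 2 / (1 + excess V (b l) v) := by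
  have he : ∀ l, 0 ≤ excess V (b l) v := fun l => le_max_right _ _
  have hpos : ∀ l, 0 < 1 + excess V (b l) v := fun l => add_pos_of_pos_of_nonneg one_pos (he l)
  have hnonneg : ∀ l ∈ s, 0 ≤ excess V (b l) v ^ 2 / (1 + excess V (b l) v) := fun l _ =>
    div_nonneg (sq_nonneg _) (hpos l).le
  have htotal : ∑ l ∈ s, excess V (b l) v ≤ V.card := by
    rw [← mul_one (V.card : ℝ), ← hsum, Finset.mul_sum]
    refine Finset.sum_le_sum fun l hl => ?_
    have hdensity := mul_nonneg (Nat.cast_nonneg (α := ℝ) V.card) (hb l hl)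
    exact max_le (by linarith) hdensity
  refine (Finset.sum_sq_le_sum_mul_sum_of_sq_le_mul s (fun l _ => (hpos l).le) hnonneg fun l _ => by
    rw [mul_div_cancel₀ _ (hpos l).ne']).trans
    (mul_le_mul_of_nonneg_right ?_ (Finset.sum_nonneg hnonneg))
  rw [Finset.sum_add_distrib, Finset.sum_const, nsmul_eq_mul, mul_one]
  linarith

variable [DecidableEq Y]

lemma sum_erase_tvKernel_unifOn (hb : IsProbOn V b) (hv : v ∈ V) :
    ∑ i ∈ V.erase v, tvKernel V (unifOn V) b i v = excess V b v := by
  have hN := hb.card_pos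
  have hpush := pushes_tv (isProbOn_unifOn hb.nonempty) hb v hv
  have hstay := mul_one_sub_stayMass (a := unifOn V) hb hv
  rw [← Finset.add_sum_erase V _ hv, tvKernel_self] at hpush
  simp only [unifOn] at hpush hstay ⊢
  rw [← Finset.mul_sum] at hpush
  have hexcess : excess V b v = V.card * max (b v - (V.card : ℝ)⁻¹) 0 := by
    rw [excess, mul_max_of_nonneg _ _ hN.le, mul_zero, mul_sub, mul_inv_cancel₀ hN.ne']
  have hparts : max (b v - (V.card : ℝ)⁻¹) 0 =
      b v - (V.card : ℝ)⁻¹ + max ((V.card : ℝ)⁻¹ - b v) 0 := by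
    rw [max_sub_zero, max_sub_zero, abs_sub_comm]
    ring
  rw [hexcess, hparts, ← hstay, ← hpush]
  field_simp
  ring

lemma IsKernelOn.sum_sq_erase_le {p : Y → Y → ℝ} (hp : IsKernelOn V p) {i : Y}
    (hi : i ∈ V) : ∑ v ∈ V.erase i, p i v ^ 2 ≤ (1 - p i i) ^ 2 := by
  have hp0 : ∀ v ∈ V.erase i, 0 ≤ p i v := fun v hv =>
    hp.nonneg i hi v (Finset.mem_of_mem_erase hv)
  rw [← hp.sum_erase hi, sq (∑ v ∈ V.erase i, p i v), Finset.sum_mul]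
  refine Finset.sum_le_sum fun v hv => ?_
  rw [sq]
  exact mul_le_mul_of_nonneg_left (Finset.single_le_sum hp0 hv) (hp0 v hv)

end Excess

section SumErase

variable [DecidableEq ι]

lemma sq_sum_erase_le {s : Finset ι} {i : ι} (f : ι → ℝ) :
    (∑ j ∈ s.erase i, f j) ^ 2 ≤ s.card * ∑ j ∈ s.erase i, f j ^ 2 := by
  refine sq_sum_le_card_mul_sum_sq.trans ?_
  gcongr
  exact Finset.erase_subset i s

lemma sum_sum_erase_comm (s : Finset ι) (f : ι → ι → ℝ) :
    ∑ i ∈ s, ∑ j ∈ s.erase i, f i j = ∑ j ∈ s, ∑ i ∈ s.erase j, f i j := by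
  refine Finset.sum_comm' fun i j => ?_
  simp only [Finset.mem_erase, ne_comm]
  tauto

lemma sq_sum_eq_sum_sq_add (s : Finset ι) (f : ι → ℝ) :
    (∑ i ∈ s, f i) ^ 2 = ∑ i ∈ s, f i ^ 2 + ∑ i ∈ s, ∑ j ∈ s.erase i, f i * f j := by
  rw [sq, Finset.sum_mul_sum, ← Finset.sum_add_distrib]
  refine Finset.sum_congr rfl fun i hi => ?_
  rw [← Finset.add_sum_erase s _ hi, sq]

lemma sum_sum_erase_sum_erase (s : Finset ι) (f : ι → ι → ℝ) :
    ∑ m ∈ s, ∑ i ∈ s.erase m, ∑ j ∈ (s.erase m).erase i, f i j =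
      ((s.card : ℝ) - 2) * ∑ i ∈ s, ∑ j ∈ s.erase i, f i j := by
  rw [sum_sum_erase_comm, Finset.mul_sum]
  refine Finset.sum_congr rfl fun i hi => ?_
  simp only [Finset.erase_right_comm (b := i)]
  rw [sum_sum_erase_comm, Finset.mul_sum]
  refine Finset.sum_congr rfl fun j hj => ?_
  rw [Finset.sum_const, nsmul_eq_mul, Finset.card_erase_of_mem hj,
    Nat.cast_pred (Finset.card_pos.2 ⟨j, hj⟩), Finset.card_erase_of_mem hi,
    Nat.cast_pred (Finset.card_pos.2 ⟨i, hi⟩)]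
  ring

lemma inv_mul_sum_sum_erase_mul_le (s : Finset ι) (f : ι → ℝ) :
    ((s.card : ℝ) * (s.card - 1))⁻¹ * ∑ i ∈ s, ∑ j ∈ s.erase i, f i * f j ≤
      ((s.card : ℝ) ^ 2)⁻¹ * (∑ i ∈ s, f i) ^ 2 := by
  have hdiag : (∑ i ∈ s, f i) ^ 2 ≤ s.card * ∑ i ∈ s, f i ^ 2 := sq_sum_le_card_mul_sum_sq
  rw [eq_sub_of_add_eq' (sq_sum_eq_sum_sq_add s f).symm]
  rcases Nat.lt_or_ge 1 s.card with h | h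
  · have hcard : (1 : ℝ) < s.card := by exact_mod_cast h
    rw [← div_eq_inv_mul, ← div_eq_inv_mul, div_le_div_iff₀ (by nlinarith) (by nlinarith)]
    nlinarith
  · have hdeg : (s.card : ℝ) * (s.card - 1) = 0 := by
      interval_cases s.card <;> simp
    rw [hdeg, inv_zero, zero_mul]
    positivity

lemma inv_mul_sum_sum_erase_sum_erase_mul_le {s : Finset ι} {f : ι → ℝ} (hf : ∀ i ∈ s, 0 ≤ f i) :
    ((s.card : ℝ) * (s.card - 1) * (s.card - 2))⁻¹ *
        ∑ m ∈ s, ∑ i ∈ s.erase m, ∑ j ∈ (s.erase m).erase i, f i * f j ≤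
      ((s.card : ℝ) ^ 2)⁻¹ * (∑ i ∈ s, f i) ^ 2 := by
  rw [sum_sum_erase_sum_erase, mul_inv, mul_assoc, ← mul_assoc ((s.card : ℝ) - 2)⁻¹]
  refine le_trans (mul_le_mul_of_nonneg_left (mul_le_of_le_one_left ?_ inv_mul_le_one) ?_)
    (inv_mul_sum_sum_erase_mul_le s f)
  · exact Finset.sum_nonneg fun i hi => Finset.sum_nonneg fun j hj =>
      mul_nonneg (hf i hi) (hf j (Finset.mem_of_mem_erase hj))
  · rcases s.eq_empty_or_nonempty with rfl | hs
    · simp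
    · have hcard : (1 : ℝ) ≤ s.card := by exact_mod_cast hs.card_pos
      exact inv_nonneg.2 (mul_nonneg (by positivity) (sub_nonneg.2 hcard))

end SumErase

section Displacement

variable {α : Type*} [Fintype α] [DecidableEq α] {A : Finset α} {ρ σ : Equiv.Perm α}
  {ν : Equiv.Perm α → ℝ}

/-- A bound for the probability that the value at the position `m` of `σ` is altered, summed over
the positions whose value may be moved: moving `σ l` to `j` by `p l` alters the values at `l` and
at the position where `σ` takes the value `j`. -/
def displacement (A : Finset α) (p : α → α → α → ℝ) (σ : Equiv.Perm α) (m : α) : ℝ :=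
  (1 - p m (σ m) (σ m)) + ∑ l ∈ Aᶜ.erase m, p l (σ l) (σ m)

lemma displacement_flow_eq {V : Finset α} (b : α → α → ℝ) (m : α) :
    displacement A (fun l => flowKernel V (b l)) σ m =
      ∑ j ∈ V, outflow V (b m) (σ m) j + ∑ l ∈ Aᶜ.erase m, outflow V (b l) (σ l) (σ m) := by
  rw [displacement, flowKernel_self, sub_sub_cancel]
  congr 1
  refine Finset.sum_congr rfl fun l hl => ?_
  rw [flowKernel_of_ne (σ.injective.ne (Finset.ne_of_mem_erase hl))]

lemma sum_sq_displacement_flow_le (hσ : σ ∈ coset A ρ) (b : α → α → ℝ) :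
    ∑ m ∈ Aᶜ, displacement A (fun l => flowKernel (freeValues A ρ) (b l)) σ m ^ 2 ≤
      4 * ∑ l ∈ Aᶜ, (freeValues A ρ).card *
        ∑ j ∈ freeValues A ρ, outflow (freeValues A ρ) (b l) (σ l) j ^ 2 := by
  set V := freeValues A ρ with hV
  let q : α → α → α → ℝ := fun l => outflow V (b l)
  have hterm : ∀ m ∈ Aᶜ, displacement A (fun l => flowKernel V (b l)) σ m ^ 2 ≤
      2 * (V.card * ∑ j ∈ V, q m (σ m) j ^ 2) +
        2 * (V.card * ∑ l ∈ Aᶜ.erase m, q l (σ l) (σ m) ^ 2) := by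
    intro m _
    have hout : (∑ j ∈ V, q m (σ m) j) ^ 2 ≤ V.card * ∑ j ∈ V, q m (σ m) j ^ 2 :=
      sq_sum_le_card_mul_sum_sq
    have hin := sq_sum_erase_le (s := Aᶜ) (i := m) fun l => q l (σ l) (σ m)
    rw [← card_freeValues (ρ := ρ), ← hV] at hin
    rw [displacement_flow_eq]
    exact add_sq_le.trans (by linarith)
  have hcomm : ∑ m ∈ Aᶜ, ∑ l ∈ Aᶜ.erase m, q l (σ l) (σ m) ^ 2 =
      ∑ l ∈ Aᶜ, ∑ j ∈ V, q l (σ l) j ^ 2 := by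
    rw [sum_sum_erase_comm]
    refine Finset.sum_congr rfl fun l _ => ?_
    rw [sum_erase_comp_coset hσ l fun v => q l (σ l) v ^ 2]
    exact Finset.sum_erase _ (by simp [q, outflow_self])
  refine (Finset.sum_le_sum hterm).trans_eq ?_
  simp only [Finset.sum_add_distrib, ← Finset.mul_sum]
  rw [hcomm]
  ring

lemma sum_mul_sum_sq_displacement_flow_le (hν : IsProbOn (coset A ρ) ν) :
    ∑ σ ∈ coset A ρ, ν σ * ∑ m ∈ Aᶜ,
      displacement A (fun l => flowKernel (freeValues A ρ) (evalLaw A ρ ν l)) σ m ^ 2 ≤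
      8 * ∑ l ∈ Aᶜ, entOn (freeValues A ρ) (evalLaw A ρ ν l) := by
  set V := freeValues A ρ
  let q : α → α → α → ℝ := fun l => outflow V (evalLaw A ρ ν l)
  calc _ ≤ ∑ σ ∈ coset A ρ, ν σ * (4 * ∑ l ∈ Aᶜ, V.card * ∑ j ∈ V, q l (σ l) j ^ 2) :=
        Finset.sum_le_sum fun σ hσ =>
          mul_le_mul_of_nonneg_left (sum_sq_displacement_flow_le hσ _) (hν.nonneg σ hσ)
    _ = 4 * ∑ l ∈ Aᶜ, ∑ σ ∈ coset A ρ, ν σ * (V.card * ∑ j ∈ V, q l (σ l) j ^ 2) := by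
        simp only [mul_left_comm _ (4 : ℝ), ← Finset.mul_sum, Finset.sum_comm (s := Aᶜ)]
    _ ≤ 4 * ∑ l ∈ Aᶜ, 2 * entOn V (evalLaw A ρ ν l) := by
        refine mul_le_mul_of_nonneg_left (Finset.sum_le_sum fun l hl => ?_) (by norm_num)
        rw [sum_mul_comp (isTwisted_coset hl).map_mem ν fun i => V.card * ∑ j ∈ V, q l i j ^ 2]
        exact sum_mul_outflow_sq_le (hν.evalLaw hl)
    _ = _ := by rw [← Finset.mul_sum]; ring

lemma sum_sq_displacement_le {p : α → α → α → ℝ}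
    (hp : ∀ l ∈ Aᶜ, IsKernelOn (freeValues A ρ) (p l)) (hσ : σ ∈ coset A ρ) :
    ∑ m ∈ Aᶜ, displacement A p σ m ^ 2 ≤ 4 * ∑ l ∈ Aᶜ, (1 - p l (σ l) (σ l)) ^ 2 +
      2 * ∑ m ∈ Aᶜ, ∑ l ∈ Aᶜ.erase m, ∑ l' ∈ (Aᶜ.erase m).erase l,
        p l (σ l) (σ m) * p l' (σ l') (σ m) := by
  have hterm : ∀ m ∈ Aᶜ, displacement A p σ m ^ 2 ≤ 2 * (1 - p m (σ m) (σ m)) ^ 2 +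
      2 * ∑ l ∈ Aᶜ.erase m, p l (σ l) (σ m) ^ 2 + 2 * ∑ l ∈ Aᶜ.erase m,
        ∑ l' ∈ (Aᶜ.erase m).erase l, p l (σ l) (σ m) * p l' (σ l') (σ m) := by
    intro m _
    refine add_sq_le.trans_eq ?_
    rw [sq_sum_eq_sum_sq_add]
    ring
  have hdiag : ∑ m ∈ Aᶜ, ∑ l ∈ Aᶜ.erase m, p l (σ l) (σ m) ^ 2 ≤
      ∑ l ∈ Aᶜ, (1 - p l (σ l) (σ l)) ^ 2 := by
    rw [sum_sum_erase_comm]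
    refine Finset.sum_le_sum fun l hl => ?_
    rw [sum_erase_comp_coset hσ l fun v => p l (σ l) v ^ 2]
    exact (hp l hl).sum_sq_erase_le ((apply_mem_freeValues hσ).2 hl)
  refine (Finset.sum_le_sum hterm).trans ?_
  simp only [Finset.sum_add_distrib, ← Finset.mul_sum]
  linarith

variable {b : α → α → ℝ}

lemma meanOn_tvKernel_mul_tvKernel_le (hb : ∀ l ∈ Aᶜ, IsProbOn (freeValues A ρ) (b l))
    {m l l' : α} (hm : m ∈ Aᶜ) (hl : l ∈ Aᶜ.erase m) (hl' : l' ∈ (Aᶜ.erase m).erase l) :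
    meanOn (coset A ρ) (fun σ =>
      tvKernel (freeValues A ρ) (unifOn (freeValues A ρ)) (b l) (σ l) (σ m) *
      tvKernel (freeValues A ρ) (unifOn (freeValues A ρ)) (b l') (σ l') (σ m)) ≤
    ((Aᶜ.card : ℝ) * (Aᶜ.card - 1) * (Aᶜ.card - 2))⁻¹ * ∑ v ∈ freeValues A ρ,
      excess (freeValues A ρ) (b l) v * excess (freeValues A ρ) (b l') v := by
  set V := freeValues A ρ with hV
  set p : α → α → α → ℝ := fun l => tvKernel V (unifOn V) (b l)
  have hlA : l ∈ Aᶜ := Finset.mem_of_mem_erase hl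
  have hlA' : l' ∈ Aᶜ := Finset.mem_of_mem_erase (Finset.mem_of_mem_erase hl')
  have hp0 : ∀ l ∈ Aᶜ, ∀ v ∈ V, ∀ i ∈ V.erase v, 0 ≤ p l i v := fun l hl v hv i hi =>
    (isKernelOn_tv (isProbOn_unifOn (hb l hl).nonempty) (hb l hl)).nonneg i
      (Finset.mem_of_mem_erase hi) v hv
  rw [meanOn_coset_eval₃ hm hl hl' fun v i i' => p l i v * p l' i' v, ← hV, meanOn,
    ← card_freeValues (ρ := ρ), ← hV, mul_assoc, mul_inv, mul_assoc]
  refine mul_le_mul_of_nonneg_left ?_ (by positivity)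
  rw [Finset.mul_sum]
  refine Finset.sum_le_sum fun v hv => ?_
  rw [← sum_erase_tvKernel_unifOn (hb l hlA) hv, ← sum_erase_tvKernel_unifOn (hb l' hlA') hv]
  refine (meanOn_meanOn_erase_mul_le (hp0 l hlA v hv) (hp0 l' hlA' v hv)).trans_eq ?_
  rw [Finset.card_erase_of_mem hv, Nat.cast_pred (Finset.card_pos.2 ⟨v, hv⟩), sub_sub,
    one_add_one_eq_two]

lemma sum_meanOn_tvKernel_mul_tvKernel_le (hb : ∀ l ∈ Aᶜ, IsProbOn (freeValues A ρ) (b l))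
    (hsum : ∀ v ∈ freeValues A ρ, ∑ l ∈ Aᶜ, b l v = 1) :
    ∑ m ∈ Aᶜ, ∑ l ∈ Aᶜ.erase m, ∑ l' ∈ (Aᶜ.erase m).erase l, meanOn (coset A ρ) (fun σ =>
      tvKernel (freeValues A ρ) (unifOn (freeValues A ρ)) (b l) (σ l) (σ m) *
      tvKernel (freeValues A ρ) (unifOn (freeValues A ρ)) (b l') (σ l') (σ m)) ≤
    2 * (Aᶜ.card : ℝ)⁻¹ * ∑ l ∈ Aᶜ, ∑ v ∈ freeValues A ρ,
      excess (freeValues A ρ) (b l) v ^ 2 / (1 + excess (freeValues A ρ) (b l) v) := by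
  set V := freeValues A ρ with hV
  set N : ℝ := (Aᶜ.card : ℝ) with hN
  let e : α → α → ℝ := fun l v => excess V (b l) v
  have hcard : (V.card : ℝ) = N := by rw [hN, hV, card_freeValues]
  calc _ ≤ ∑ m ∈ Aᶜ, ∑ l ∈ Aᶜ.erase m, ∑ l' ∈ (Aᶜ.erase m).erase l,
        (N * (N - 1) * (N - 2))⁻¹ * ∑ v ∈ V, e l v * e l' v :=
        Finset.sum_le_sum fun m hm => Finset.sum_le_sum fun l hl => Finset.sum_le_sum
          fun l' hl' => meanOn_tvKernel_mul_tvKernel_le hb hm hl hl'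
    _ = ∑ v ∈ V, (N * (N - 1) * (N - 2))⁻¹ * ∑ m ∈ Aᶜ, ∑ l ∈ Aᶜ.erase m,
        ∑ l' ∈ (Aᶜ.erase m).erase l, e l v * e l' v := by
        simp only [Finset.mul_sum, Finset.sum_comm (s := V)]
    _ ≤ ∑ v ∈ V, (N ^ 2)⁻¹ * (∑ l ∈ Aᶜ, e l v) ^ 2 := Finset.sum_le_sum fun v _ =>
        inv_mul_sum_sum_erase_sum_erase_mul_le fun l _ => le_max_right _ _
    _ ≤ ∑ v ∈ V, (N ^ 2)⁻¹ * ((N + V.card) * ∑ l ∈ Aᶜ, e l v ^ 2 / (1 + e l v)) :=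
        Finset.sum_le_sum fun v hv => mul_le_mul_of_nonneg_left
          (sq_sum_excess_le (fun l hl => (hb l hl).nonneg v hv) (hsum v hv)) (by positivity)
    _ = _ := by
        rw [hcard, ← Finset.mul_sum, ← Finset.mul_sum, Finset.sum_comm]
        field_simp
        ring

lemma meanOn_sum_sq_displacement_tv_le (hb : ∀ l ∈ Aᶜ, IsProbOn (freeValues A ρ) (b l))
    (hsum : ∀ v ∈ freeValues A ρ, ∑ l ∈ Aᶜ, b l v = 1) :
    meanOn (coset A ρ) (fun σ => ∑ m ∈ Aᶜ, displacement A
      (fun l => tvKernel (freeValues A ρ) (unifOn (freeValues A ρ)) (b l)) σ m ^ 2) ≤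
      8 * ∑ l ∈ Aᶜ, entOn (freeValues A ρ) (b l) := by
  set V := freeValues A ρ with hV
  set p : α → α → α → ℝ := fun l => tvKernel V (unifOn V) (b l) with hp
  have hk : ∀ l ∈ Aᶜ, IsKernelOn V (p l) := fun l hl =>
    isKernelOn_tv (isProbOn_unifOn (hb l hl).nonempty) (hb l hl)
  let O : α → α → ℝ := fun l v => (1 - stayMass (unifOn V) (b l) v) ^ 2
  let E : α → α → ℝ := fun l v => excess V (b l) v ^ 2 / (1 + excess V (b l) v)
  have hcard : (V.card : ℝ) = Aᶜ.card := by rw [hV, card_freeValues]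
  calc _ ≤ meanOn (coset A ρ) (fun σ => 4 * ∑ l ∈ Aᶜ, (1 - p l (σ l) (σ l)) ^ 2 +
        2 * ∑ m ∈ Aᶜ, ∑ l ∈ Aᶜ.erase m, ∑ l' ∈ (Aᶜ.erase m).erase l,
          p l (σ l) (σ m) * p l' (σ l') (σ m)) :=
        meanOn_mono fun σ hσ => sum_sq_displacement_le hk hσ
    _ ≤ 4 * ∑ l ∈ Aᶜ, (V.card : ℝ)⁻¹ * ∑ v ∈ V, O l v +
        2 * (2 * (Aᶜ.card : ℝ)⁻¹ * ∑ l ∈ Aᶜ, ∑ v ∈ V, E l v) := by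
        simp only [meanOn_add, meanOn_mul_left, meanOn_sum, hp, tvKernel_self]
        refine add_le_add (mul_le_mul_of_nonneg_left (Finset.sum_le_sum fun l hl => ?_)
          (by norm_num)) (mul_le_mul_of_nonneg_left (sum_meanOn_tvKernel_mul_tvKernel_le hb hsum)
          (by norm_num))
        exact (meanOn_coset_eval hl (O l)).le
    _ = 2 * (V.card : ℝ)⁻¹ * ∑ l ∈ Aᶜ, ∑ v ∈ V, (2 * O l v + 2 * E l v) := by
        rw [hcard]
        simp only [Finset.sum_add_distrib, ← Finset.mul_sum]
        ring
    _ ≤ 2 * (V.card : ℝ)⁻¹ * ∑ l ∈ Aᶜ, ∑ v ∈ V, 4 * klFun (V.card * b l v) :=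
        mul_le_mul_of_nonneg_left (Finset.sum_le_sum fun l hl => Finset.sum_le_sum fun v hv =>
          stayMass_sq_add_excess_le (hb l hl) hv) (by positivity)
    _ = _ := by
        rw [Finset.mul_sum, Finset.mul_sum]
        refine Finset.sum_congr rfl fun l hl => ?_
        rw [entOn_eq_klFun (hb l hl), ← Finset.mul_sum]
        ring

end Displacement

section FibreKernels

variable [DecidableEq Y] {s : Finset X} {V : Finset Y} {φ : X → Y} {T : Y → X → X}
  {ν₁ ν₂ : X → ℝ}

lemma margOn_congr {ν ν' : X → ℝ} (h : ∀ x ∈ s, ν x = ν' x) (i : Y) :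
    margOn s φ ν i = margOn s φ ν' i :=
  Finset.sum_congr rfl fun x hx => h x (mem_fiberOn.1 hx).1

lemma IsTwisted.margOn_eq_unifOn (h : IsTwisted s V φ T) (hs : s.Nonempty) {ν : X → ℝ}
    (hν : ∀ x ∈ s, ν x = unifOn s x) {i : Y} (hi : i ∈ V) : margOn s φ ν i = unifOn V i := by
  rw [margOn_congr hν, h.margOn_unifOn hi hs]

lemma IsTwisted.condOn_eq_unifOn (h : IsTwisted s V φ T) (hs : s.Nonempty) {ν : X → ℝ}
    (hν : ∀ x ∈ s, ν x = unifOn s x) {i : Y} (hi : i ∈ V) {x : X} (hx : x ∈ fiberOn s φ i) :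
    condOn s φ ν i x = unifOn (fiberOn s φ i) x := by
  rw [← h.condOn_unifOn hi hs, condOn, condOn, margOn_congr hν, hν x (mem_fiberOn.1 hx).1]

lemma IsTwisted.condOn_twist_eq_unifOn (h : IsTwisted s V φ T) (hs : s.Nonempty) {ν : X → ℝ}
    (hν : ∀ x ∈ s, ν x = unifOn s x) {i j : Y} (hi : i ∈ V) (hj : j ∈ V) {x : X}
    (hx : x ∈ fiberOn s φ i) : condOn s φ ν j (T j x) = unifOn (fiberOn s φ i) x := by
  have hxs := (mem_fiberOn.1 hx).1
  rw [h.condOn_eq_unifOn hs hν hj (mem_fiberOn.2 ⟨h.twist_mem x hxs j hj, h.map_twist x hxs j hj⟩),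
    unifOn, unifOn, h.card_fiberOn_eq hj hi]

lemma EitherUnifOn.margOn (hu : EitherUnifOn s ν₁ ν₂) (h : IsTwisted s V φ T)
    (hs : s.Nonempty) : EitherUnifOn V (margOn s φ ν₁) (margOn s φ ν₂) :=
  hu.imp (fun hu _ => h.margOn_eq_unifOn hs hu) fun hu _ => h.margOn_eq_unifOn hs hu

lemma EitherUnifOn.condOn_twist (hu : EitherUnifOn s ν₁ ν₂) (h : IsTwisted s V φ T)
    (hs : s.Nonempty) {i j : Y} (hi : i ∈ V) (hj : j ∈ V) :
    EitherUnifOn (fiberOn s φ i) (condOn s φ ν₁ i) fun x => condOn s φ ν₂ j (T j x) :=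
  hu.imp (fun hu _ => h.condOn_eq_unifOn hs hu hi) fun hu _ =>
    h.condOn_twist_eq_unifOn hs hu hi hj

lemma IsProbOn.isKernelOn_const (h : IsProbOn s ν₂) : IsKernelOn s fun _ => ν₂ where
  nonneg _ _ := h.nonneg
  sum_eq _ _ := h.sum_eq

lemma IsProbOn.pushes_const (h : IsProbOn s ν₁) (ν₂ : X → ℝ) : Pushes s (fun _ => ν₂) ν₁ ν₂ :=
  fun y _ => by rw [← Finset.sum_mul, h.sum_eq, one_mul]

/-- The induction hypothesis on the fibres, in the form in which `stepKernel` needs it: kernels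
between any two of the conditioned weights, once these are brought to the same fibre. -/
lemma IsTwisted.exists_fiberKernels (h : IsTwisted s V φ T) (hν₁ : IsProbOn s ν₁)
    (hν₂ : IsProbOn s ν₂) (hu : EitherUnifOn s ν₁ ν₂)
    {Q : Finset X → (X → ℝ) → (X → ℝ) → (X → X → ℝ) → Prop}
    (hQ : ∀ i ∈ V, ∀ μ₁ μ₂, IsProbOn (fiberOn s φ i) μ₁ → IsProbOn (fiberOn s φ i) μ₂ →
      EitherUnifOn (fiberOn s φ i) μ₁ μ₂ → ∃ P, IsKernelOn (fiberOn s φ i) P ∧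
        Pushes (fiberOn s φ i) P μ₁ μ₂ ∧ Q (fiberOn s φ i) μ₁ μ₂ P) :
    ∃ P : Y → Y → X → X → ℝ, ∀ i ∈ V, ∀ j ∈ V, IsKernelOn (fiberOn s φ i) (P i j) ∧
      (margOn s φ ν₁ i ≠ 0 → margOn s φ ν₂ j ≠ 0 →
        Pushes (fiberOn s φ i) (P i j) (condOn s φ ν₁ i) (fun x => condOn s φ ν₂ j (T j x)) ∧
        Q (fiberOn s φ i) (condOn s φ ν₁ i) (fun x => condOn s φ ν₂ j (T j x)) (P i j)) := by
  have hpair : ∀ i ∈ V, ∀ j ∈ V, ∃ P : X → X → ℝ, IsKernelOn (fiberOn s φ i) P ∧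
      (margOn s φ ν₁ i ≠ 0 → margOn s φ ν₂ j ≠ 0 →
        Pushes (fiberOn s φ i) P (condOn s φ ν₁ i) (fun x => condOn s φ ν₂ j (T j x)) ∧
        Q (fiberOn s φ i) (condOn s φ ν₁ i) (fun x => condOn s φ ν₂ j (T j x)) P) := by
    intro i hi j hj
    by_cases hne : margOn s φ ν₁ i ≠ 0 ∧ margOn s φ ν₂ j ≠ 0
    · obtain ⟨P, hP, hPQ⟩ := hQ i hi _ _ (hν₁.cond hne.1)
        (h.isProbOn_twist hi hj (hν₂.cond hne.2)) (hu.condOn_twist h hν₁.nonempty hi hj)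
      exact ⟨P, hP, fun _ _ => hPQ⟩
    · obtain ⟨P, hP⟩ := exists_isKernelOn (fiberOn s φ i)
      exact ⟨P, hP, fun h₁ h₂ => absurd ⟨h₁, h₂⟩ hne⟩
  choose! P hP using hpair
  exact ⟨P, hP⟩

variable {p : Y → Y → ℝ} {P : Y → Y → X → X → ℝ}

lemma IsTwisted.sum_stepKernel_mul_le (h : IsTwisted s V φ T) (hp : IsKernelOn V p)
    (hP : ∀ i ∈ V, ∀ j ∈ V, IsKernelOn (fiberOn s φ i) (P i j)) {x : X} (hx : x ∈ s)
    {g f : X → ℝ} {w : Y → ℝ}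
    (hg : ∀ j ∈ V, ∀ y ∈ fiberOn s φ (φ x), g (T j y) ≤ f y + w j) :
    ∑ y ∈ s, stepKernel φ T p P x y * g y ≤
      ∑ j ∈ V, p (φ x) j * ∑ y ∈ fiberOn s φ (φ x), P (φ x) j x y * f y +
        ∑ j ∈ V, p (φ x) j * w j := by
  have hφx := h.map_mem x hx
  have hxF : x ∈ fiberOn s φ (φ x) := mem_fiberOn.2 ⟨hx, rfl⟩
  rw [h.sum_stepKernel hx, ← Finset.sum_add_distrib]
  refine Finset.sum_le_sum fun j hj => ?_
  have hPj := hP _ hφx j hj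
  rw [← mul_add]
  refine mul_le_mul_of_nonneg_left ?_ (hp.nonneg _ hφx j hj)
  calc ∑ y ∈ fiberOn s φ (φ x), P (φ x) j x y * g (T j y)
      ≤ ∑ y ∈ fiberOn s φ (φ x), P (φ x) j x y * (f y + w j) :=
        Finset.sum_le_sum fun y hy => mul_le_mul_of_nonneg_left (hg j hj y hy)
          (hPj.nonneg x hxF y hy)
    _ = ∑ y ∈ fiberOn s φ (φ x), P (φ x) j x y * f y + w j := by
        simp only [mul_add, Finset.sum_add_distrib]
        rw [← Finset.sum_mul, hPj.sum_eq x hxF, one_mul]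

lemma IsKernelOn.sum_mul_ne (hp : IsKernelOn V p) {i : Y} (hi : i ∈ V) :
    ∑ j ∈ V, p i j * (if i = j then 0 else 1) = 1 - p i i := by
  rw [← hp.sum_erase hi, ← Finset.add_sum_erase _ _ hi, if_pos rfl, mul_zero, zero_add]
  exact Finset.sum_congr rfl fun j hj => by
    rw [if_neg (Finset.ne_of_mem_erase hj).symm, mul_one]

end FibreKernels

section Hat

variable {α : Type*} [DecidableEq α]

/-- The indicator that two permutations differ at `m`. -/
def differAt (m : α) (σ τ : Equiv.Perm α) : ℝ := if σ m = τ m then 0 else 1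

lemma differAt_nonneg (m : α) (σ τ : Equiv.Perm α) : 0 ≤ differAt m σ τ := by
  unfold differAt; split_ifs <;> norm_num

lemma differAt_le_one (m : α) (σ τ : Equiv.Perm α) : differAt m σ τ ≤ 1 := by
  unfold differAt; split_ifs <;> norm_num

lemma differAt_triangle (m : α) (σ τ υ : Equiv.Perm α) :
    differAt m σ υ ≤ differAt m σ τ + differAt m τ υ := by
  by_cases hστ : σ m = τ m
  · simp [differAt, hστ]
  · rw [differAt.eq_1 m σ τ, if_neg hστ]
    linarith [differAt_le_one m σ υ, differAt_nonneg m τ υ]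

lemma differAt_swapTo_le {l m : α} (hlm : l ≠ m) {σ τ : Equiv.Perm α} (hl : τ l = σ l) (j : α) :
    differAt m σ (swapTo l j τ) ≤ differAt m σ τ + if σ m = j then 1 else 0 := by
  by_cases hj : σ m = j
  · rw [if_pos hj]
    linarith [differAt_le_one m σ (swapTo l j τ), differAt_nonneg m σ τ]
  rw [if_neg hj, add_zero]
  by_cases hm : σ m = τ m
  · have hswap : swapTo l j τ m = σ m := by
      rw [swapTo, Equiv.Perm.mul_apply, ← hm, hl]
      exact Equiv.swap_apply_of_ne_of_ne (σ.injective.ne hlm.symm) hj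
    rw [differAt, hswap, if_pos rfl]
    exact differAt_nonneg m σ τ
  · rw [differAt.eq_1 m σ τ, if_neg hm]
    exact differAt_le_one m σ _

variable [Fintype α] {A : Finset α} {ρ σ : Equiv.Perm α} {ν₁ ν₂ : Equiv.Perm α → ℝ}

lemma exists_evalKernels_of_unif_left (h₁ : ∀ σ ∈ coset A ρ, ν₁ σ = unifOn (coset A ρ) σ)
    (h₂ : IsProbOn (coset A ρ) ν₂) :
    ∃ p : α → α → α → ℝ, (∀ l ∈ Aᶜ, IsKernelOn (freeValues A ρ) (p l)) ∧
      (∀ l ∈ Aᶜ, Pushes (freeValues A ρ) (p l) (evalLaw A ρ ν₁ l) (evalLaw A ρ ν₂ l)) ∧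
      ∑ σ ∈ coset A ρ, ν₁ σ * ∑ m ∈ Aᶜ, displacement A p σ m ^ 2 ≤
        8 * ∑ l ∈ Aᶜ, entOn (freeValues A ρ) (evalLaw A ρ ν₂ l) := by
  set V := freeValues A ρ
  have hlaw : ∀ l ∈ Aᶜ, ∀ v ∈ V, evalLaw A ρ ν₁ l v = unifOn V v := fun l hl v hv =>
    (isTwisted_coset hl).margOn_eq_unifOn coset_nonempty h₁ hv
  have hunif : ∀ l ∈ Aᶜ, IsProbOn V (unifOn V) := fun l hl =>
    isProbOn_unifOn (h₂.evalLaw hl).nonempty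
  refine ⟨fun l => tvKernel V (unifOn V) (evalLaw A ρ ν₂ l),
    fun l hl => isKernelOn_tv (hunif l hl) (h₂.evalLaw hl), fun l hl v hv => ?_, ?_⟩
  · rw [← pushes_tv (hunif l hl) (h₂.evalLaw hl) v hv]
    exact Finset.sum_congr rfl fun i hi => by rw [hlaw l hl i hi]
  · rw [Finset.sum_congr rfl fun σ hσ => by rw [h₁ σ hσ], sum_unifOn_mul]
    exact meanOn_sum_sq_displacement_tv_le (fun l hl => h₂.evalLaw hl)
      fun v hv => sum_evalLaw h₂ hv

lemma exists_evalKernels_of_unif_right (h₁ : IsProbOn (coset A ρ) ν₁)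
    (h₂ : ∀ σ ∈ coset A ρ, ν₂ σ = unifOn (coset A ρ) σ) :
    ∃ p : α → α → α → ℝ, (∀ l ∈ Aᶜ, IsKernelOn (freeValues A ρ) (p l)) ∧
      (∀ l ∈ Aᶜ, Pushes (freeValues A ρ) (p l) (evalLaw A ρ ν₁ l) (evalLaw A ρ ν₂ l)) ∧
      ∑ σ ∈ coset A ρ, ν₁ σ * ∑ m ∈ Aᶜ, displacement A p σ m ^ 2 ≤
        8 * ∑ l ∈ Aᶜ, entOn (freeValues A ρ) (evalLaw A ρ ν₁ l) := by
  refine ⟨fun l => flowKernel (freeValues A ρ) (evalLaw A ρ ν₁ l),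
    fun l hl => isKernelOn_flow (h₁.evalLaw hl), fun l hl v hv => ?_,
    sum_mul_sum_sq_displacement_flow_le h₁⟩
  exact (pushes_flow (h₁.evalLaw hl) v hv).trans
    ((isTwisted_coset hl).margOn_eq_unifOn coset_nonempty h₂ hv).symm

lemma exists_evalKernels (h₁ : IsProbOn (coset A ρ) ν₁) (h₂ : IsProbOn (coset A ρ) ν₂)
    (hu : EitherUnifOn (coset A ρ) ν₁ ν₂) :
    ∃ p : α → α → α → ℝ, (∀ l ∈ Aᶜ, IsKernelOn (freeValues A ρ) (p l)) ∧
      (∀ l ∈ Aᶜ, Pushes (freeValues A ρ) (p l) (evalLaw A ρ ν₁ l) (evalLaw A ρ ν₂ l)) ∧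
      ∑ σ ∈ coset A ρ, ν₁ σ * ∑ m ∈ Aᶜ, displacement A p σ m ^ 2 ≤
        8 * ∑ l ∈ Aᶜ, (entOn (freeValues A ρ) (evalLaw A ρ ν₁ l) +
          entOn (freeValues A ρ) (evalLaw A ρ ν₂ l)) := by
  have hent : ∀ {ν : Equiv.Perm α → ℝ}, IsProbOn (coset A ρ) ν →
      ∀ l ∈ Aᶜ, 0 ≤ entOn (freeValues A ρ) (evalLaw A ρ ν l) := fun hν l hl =>
    entOn_nonneg (hν.evalLaw hl)
  rcases hu with hu | hu
  · obtain ⟨p, hp, hpp, hle⟩ := exists_evalKernels_of_unif_left hu h₂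
    refine ⟨p, hp, hpp, hle.trans ?_⟩
    gcongr with l hl
    exact le_add_of_nonneg_left (hent h₁ l hl)
  · obtain ⟨p, hp, hpp, hle⟩ := exists_evalKernels_of_unif_right h₁ hu
    refine ⟨p, hp, hpp, hle.trans ?_⟩
    gcongr with l hl
    exact le_add_of_nonneg_right (hent h₂ l hl)

/-- The fibre over `i` of the evaluation at `l` on a coset. -/
abbrev evalFiber (A : Finset α) (ρ : Equiv.Perm α) (l i : α) : Finset (Equiv.Perm α) :=
  fiberOn (coset A ρ) (fun σ => σ l) i

/-- The kernel on permutations that lifts the kernel `p` for the value at `l`. -/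
abbrev evalStep (l : α) (p : α → α → ℝ) (P : α → α → Equiv.Perm α → Equiv.Perm α → ℝ) :
    Equiv.Perm α → Equiv.Perm α → ℝ :=
  stepKernel (fun σ => σ l) (swapTo l) p P

section Step

variable {l m : α} {p : α → α → ℝ} {P : α → α → Equiv.Perm α → Equiv.Perm α → ℝ}

lemma sum_evalStep_differAt_self_le (hm : m ∈ Aᶜ) (hp : IsKernelOn (freeValues A ρ) p)
    (hP : ∀ i ∈ freeValues A ρ, ∀ j ∈ freeValues A ρ, IsKernelOn (evalFiber A ρ m i) (P i j))
    (hσ : σ ∈ coset A ρ) :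
    ∑ τ ∈ coset A ρ, evalStep m p P σ τ * differAt m σ τ ≤ 1 - p (σ m) (σ m) := by
  have hT := isTwisted_coset (ρ := ρ) hm
  refine (hT.sum_stepKernel_mul_le hp hP hσ (f := fun _ => 0)
    (w := fun j => if σ m = j then 0 else 1) fun j _ τ _ => ?_).trans_eq ?_
  · rw [differAt, swapTo_apply_self, zero_add]
  · simp only [mul_zero, Finset.sum_const_zero, zero_add]
    exact hp.sum_mul_ne (hT.map_mem σ hσ)

lemma sum_evalStep_differAt_le (hm : m ∈ Aᶜ) (hl : l ∈ Aᶜ) (hlm : l ≠ m)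
    (hp : IsKernelOn (freeValues A ρ) p)
    (hP : ∀ i ∈ freeValues A ρ, ∀ j ∈ freeValues A ρ, IsKernelOn (evalFiber A ρ l i) (P i j))
    (hσ : σ ∈ coset A ρ) :
    ∑ τ ∈ coset A ρ, evalStep l p P σ τ * differAt m σ τ ≤
      ∑ j ∈ freeValues A ρ, p (σ l) j *
        ∑ τ ∈ evalFiber A ρ l (σ l), P (σ l) j σ τ * differAt m σ τ + p (σ l) (σ m) := by
  refine ((isTwisted_coset (ρ := ρ) hl).sum_stepKernel_mul_le hp hP hσ
    (w := fun j => if σ m = j then 1 else 0)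
    fun j _ τ hτ => differAt_swapTo_le hlm (mem_fiberOn.1 hτ).2 j).trans_eq ?_
  simp [apply_mem_freeValues hσ, Finset.mem_compl.1 hm]

end Step

lemma sq_sum_erase_add_le [DecidableEq ι] {s : Finset ι} {i : ι} (hi : i ∈ s) (f : ι → ℝ)
    (t : ℝ) : (∑ l ∈ s.erase i, f l + t) ^ 2 ≤ s.card * (∑ l ∈ s.erase i, f l ^ 2 + t ^ 2) := by
  have hupdate : ∀ l ∈ s.erase i, Function.update f i t l = f l := fun l hl =>
    Function.update_of_ne (Finset.ne_of_mem_erase hl) t f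
  have hcs := sq_sum_le_card_mul_sum_sq (s := s) (f := Function.update f i t)
  rwa [← Finset.sum_erase_add s _ hi, ← Finset.sum_erase_add s _ hi, Function.update_self,
    Finset.sum_congr rfl hupdate,
    Finset.sum_congr rfl fun l hl => congrArg (· ^ 2) (hupdate l hl)] at hcs

section AverageStep

variable {p : α → α → α → ℝ} {P : α → α → α → Equiv.Perm α → Equiv.Perm α → ℝ}

/-- The average over the free positions `l` of the lifts of the kernels `p l`. -/
abbrev avgStep (A : Finset α) (p : α → α → α → ℝ)
    (P : α → α → α → Equiv.Perm α → Equiv.Perm α → ℝ) : Equiv.Perm α → Equiv.Perm α → ℝ :=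
  avgKernel Aᶜ fun l => evalStep l (p l) (P l)

lemma sum_avgStep_differAt_le {m : α} (hm : m ∈ Aᶜ)
    (hp : ∀ l ∈ Aᶜ, IsKernelOn (freeValues A ρ) (p l))
    (hP : ∀ l ∈ Aᶜ, ∀ i ∈ freeValues A ρ, ∀ j ∈ freeValues A ρ,
      IsKernelOn (evalFiber A ρ l i) (P l i j)) (hσ : σ ∈ coset A ρ) :
    ∑ τ ∈ coset A ρ, avgStep A p P σ τ * differAt m σ τ ≤ (Aᶜ.card : ℝ)⁻¹ *
      (∑ l ∈ Aᶜ.erase m, ∑ j ∈ freeValues A ρ, p l (σ l) j *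
        ∑ τ ∈ evalFiber A ρ l (σ l), P l (σ l) j σ τ * differAt m σ τ + displacement A p σ m) := by
  rw [sum_avgKernel]
  refine mul_le_mul_of_nonneg_left ?_ (by positivity)
  have hself := sum_evalStep_differAt_self_le hm (hp m hm) (hP m hm) hσ
  have hother := Finset.sum_le_sum fun l (hl : l ∈ Aᶜ.erase m) =>
    have hlA := Finset.mem_of_mem_erase hl
    sum_evalStep_differAt_le hm hlA (Finset.ne_of_mem_erase hl) (hp l hlA) (hP l hlA) hσ
  rw [Finset.sum_add_distrib] at hother
  rw [← Finset.sum_erase_add _ _ hm, displacement]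
  linarith

lemma isKernelOn_avgStep (hA : Aᶜ.Nonempty) (hp : ∀ l ∈ Aᶜ, IsKernelOn (freeValues A ρ) (p l))
    (hP : ∀ l ∈ Aᶜ, ∀ i ∈ freeValues A ρ, ∀ j ∈ freeValues A ρ,
      IsKernelOn (evalFiber A ρ l i) (P l i j)) : IsKernelOn (coset A ρ) (avgStep A p P) :=
  isKernelOn_avg hA fun l hl => (isTwisted_coset hl).isKernelOn_step (hp l hl) (hP l hl)

lemma sq_sum_avgStep_differAt_le {m : α} (hm : m ∈ Aᶜ)
    (hp : ∀ l ∈ Aᶜ, IsKernelOn (freeValues A ρ) (p l))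
    (hP : ∀ l ∈ Aᶜ, ∀ i ∈ freeValues A ρ, ∀ j ∈ freeValues A ρ,
      IsKernelOn (evalFiber A ρ l i) (P l i j)) (hσ : σ ∈ coset A ρ) :
    (∑ τ ∈ coset A ρ, avgStep A p P σ τ * differAt m σ τ) ^ 2 ≤ (Aᶜ.card : ℝ)⁻¹ *
      (∑ l ∈ Aᶜ.erase m, ∑ j ∈ freeValues A ρ, p l (σ l) j *
        (∑ τ ∈ evalFiber A ρ l (σ l), P l (σ l) j σ τ * differAt m σ τ) ^ 2 +
          displacement A p σ m ^ 2) := by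
  have hA : (0 : ℝ) < Aᶜ.card := by exact_mod_cast Finset.card_pos.2 ⟨m, hm⟩
  refine (pow_le_pow_left₀ (Finset.sum_nonneg fun τ hτ => mul_nonneg
    ((isKernelOn_avgStep ⟨m, hm⟩ hp hP).nonneg σ hσ τ hτ) (differAt_nonneg m σ τ))
    (sum_avgStep_differAt_le hm hp hP hσ) 2).trans ?_
  rw [mul_pow, sq (Aᶜ.card : ℝ)⁻¹, mul_assoc]
  refine mul_le_mul_of_nonneg_left ?_ (inv_nonneg.2 hA.le)
  rw [inv_mul_le_iff₀ hA]
  refine (sq_sum_erase_add_le hm _ _).trans ?_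
  gcongr with l hl
  have hlA := Finset.mem_of_mem_erase hl
  have hv := (isTwisted_coset hlA).map_mem σ hσ
  exact sq_sum_mul_le ((hp l hlA).nonneg _ hv) ((hp l hlA).sum_eq _ hv).le

lemma weakCostOn_avgStep_le (hν : ∀ σ ∈ coset A ρ, 0 ≤ ν₁ σ)
    (hp : ∀ l ∈ Aᶜ, IsKernelOn (freeValues A ρ) (p l))
    (hP : ∀ l ∈ Aᶜ, ∀ i ∈ freeValues A ρ, ∀ j ∈ freeValues A ρ,
      IsKernelOn (evalFiber A ρ l i) (P l i j)) :
    weakCostOn (coset A ρ) Aᶜ differAt ν₁ (avgStep A p P) ≤ (Aᶜ.card : ℝ)⁻¹ *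
      (∑ l ∈ Aᶜ, ∑ σ ∈ coset A ρ, ν₁ σ * ∑ j ∈ freeValues A ρ, p l (σ l) j *
        ∑ m ∈ Aᶜ.erase l, (∑ τ ∈ evalFiber A ρ l (σ l), P l (σ l) j σ τ * differAt m σ τ) ^ 2 +
      ∑ σ ∈ coset A ρ, ν₁ σ * ∑ m ∈ Aᶜ, displacement A p σ m ^ 2) := by
  rw [Finset.sum_comm, ← Finset.sum_add_distrib, Finset.mul_sum]
  refine Finset.sum_le_sum fun σ hσ => ?_
  rw [← Finset.mul_sum, ← mul_add, mul_left_comm]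
  refine mul_le_mul_of_nonneg_left ?_ (hν σ hσ)
  refine (Finset.sum_le_sum fun m hm => sq_sum_avgStep_differAt_le hm hp hP hσ).trans_eq ?_
  rw [← Finset.mul_sum, Finset.sum_add_distrib, sum_sum_erase_comm]
  simp only [Finset.mul_sum, Finset.sum_comm (t := freeValues A ρ)]

lemma exists_kernel_differAt_of_fibers {ν₁ ν₂ : Equiv.Perm α → ℝ} (hA : Aᶜ.Nonempty)
    (h₁ : IsProbOn (coset A ρ) ν₁) (h₂ : IsProbOn (coset A ρ) ν₂)
    (hu : EitherUnifOn (coset A ρ) ν₁ ν₂)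
    (hfiber : ∀ l ∈ Aᶜ, ∀ i ∈ freeValues A ρ, ∀ μ₁ μ₂, IsProbOn (evalFiber A ρ l i) μ₁ →
      IsProbOn (evalFiber A ρ l i) μ₂ → EitherUnifOn (evalFiber A ρ l i) μ₁ μ₂ →
      ∃ P, IsKernelOn (evalFiber A ρ l i) P ∧ Pushes (evalFiber A ρ l i) P μ₁ μ₂ ∧
        weakCostOn (evalFiber A ρ l i) (Aᶜ.erase l) differAt μ₁ P ≤
          8 * (entOn (evalFiber A ρ l i) μ₁ + entOn (evalFiber A ρ l i) μ₂)) :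
    ∃ P, IsKernelOn (coset A ρ) P ∧ Pushes (coset A ρ) P ν₁ ν₂ ∧
      weakCostOn (coset A ρ) Aᶜ differAt ν₁ P ≤
        8 * (entOn (coset A ρ) ν₁ + entOn (coset A ρ) ν₂) := by
  obtain ⟨p, hp, hpp, hdisp⟩ := exists_evalKernels h₁ h₂ hu
  choose! P hP using fun l hl =>
    (isTwisted_coset (ρ := ρ) hl).exists_fiberKernels h₁ h₂ hu
      (Q := fun F μ₁ μ₂ P => weakCostOn F (Aᶜ.erase l) differAt μ₁ P ≤
        8 * (entOn F μ₁ + entOn F μ₂)) (hfiber l hl)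
  have hPk := fun l hl i hi j hj => (hP l hl i hi j hj).1
  refine ⟨avgStep A p P, isKernelOn_avgStep hA hp hPk, pushes_avg hA fun l hl =>
    (isTwisted_coset hl).pushes_step h₁ h₂ (hp l hl) (hpp l hl) fun i hi j hj ha hb =>
      ((hP l hl i hi j hj).2 ha hb).1, (weakCostOn_avgStep_le h₁.nonneg hp hPk).trans ?_⟩
  have hcard : (0 : ℝ) < Aᶜ.card := by exact_mod_cast hA.card_pos
  have hfibers := Finset.sum_le_sum fun l hl => (isTwisted_coset hl).sum_step_le h₁ (hp l hl)
    (hpp l hl) fun i hi j hj ha hb => ((hP l hl i hi j hj).2 ha hb).2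
  rw [inv_mul_le_iff₀ hcard, ← nsmul_eq_mul, ← Finset.sum_const]
  refine (add_le_add hfibers hdisp).trans_eq ?_
  rw [Finset.mul_sum, ← Finset.sum_add_distrib]
  refine Finset.sum_congr rfl fun l hl => ?_
  rw [(isTwisted_coset hl).entOn_eq_add_condEntOn h₁,
    (isTwisted_coset hl).entOn_eq_add_condEntOn h₂]
  ring

end AverageStep

lemma exists_kernel_differAt (A : Finset α) (ρ : Equiv.Perm α) (ν₁ ν₂ : Equiv.Perm α → ℝ)
    (h₁ : IsProbOn (coset A ρ) ν₁) (h₂ : IsProbOn (coset A ρ) ν₂)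
    (hu : EitherUnifOn (coset A ρ) ν₁ ν₂) :
    ∃ P, IsKernelOn (coset A ρ) P ∧ Pushes (coset A ρ) P ν₁ ν₂ ∧
      weakCostOn (coset A ρ) Aᶜ differAt ν₁ P ≤
        8 * (entOn (coset A ρ) ν₁ + entOn (coset A ρ) ν₂) := by
  rcases Aᶜ.eq_empty_or_nonempty with hA | hA
  · refine ⟨_, h₂.isKernelOn_const, h₁.pushes_const ν₂, ?_⟩
    have hent := add_nonneg (entOn_nonneg h₁) (entOn_nonneg h₂)
    simpa [weakCostOn, hA] using hent
  · refine exists_kernel_differAt_of_fibers hA h₁ h₂ hu fun l hl i hi => ?_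
    rw [evalFiber, fiberOn_coset hl hi, ← Finset.compl_insert]
    exact exists_kernel_differAt (insert l A) (swapTo l i ρ)
termination_by Aᶜ.card
decreasing_by
  rw [Finset.compl_insert]
  exact Finset.card_erase_lt_of_mem hl

end Hat

section UnitStep

lemma add_sq_le_of_sq_le {x r u w c : ℝ} (hc : 0 ≤ c) (hu : 0 ≤ u) (hw : 0 ≤ w)
    (hx : x ^ 2 ≤ u) (hr : r ^ 2 ≤ c * w) : (x + r) ^ 2 ≤ (c + 1) * (u + w) := by
  have hcross : 2 * (x * r) ≤ c * u + w := by
    refine (abs_le_of_sq_le_sq' ?_ (by positivity)).2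
    have hprod : x ^ 2 * r ^ 2 ≤ u * (c * w) := mul_le_mul hx hr (sq_nonneg _) hu
    nlinarith [sq_nonneg (c * u - w)]
  nlinarith

lemma sum_mul_add_sq_le_of_le {t : Finset X} {w f g : X → ℝ} {a b c : ℝ} (hc : 0 ≤ c)
    (ha : 0 ≤ a) (hb : 0 ≤ b) (hw : ∀ x ∈ t, 0 ≤ w x) (hf : ∑ x ∈ t, w x * f x ^ 2 ≤ a)
    (hg : ∑ x ∈ t, w x * g x ^ 2 ≤ c * b) :
    ∑ x ∈ t, w x * (f x + g x) ^ 2 ≤ (c + 1) * (a + b) := by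
  have hsq : ∀ u : X → ℝ, 0 ≤ ∑ x ∈ t, w x * u x ^ 2 := fun u =>
    Finset.sum_nonneg fun x hx => mul_nonneg (hw x hx) (sq_nonneg _)
  refine (sum_mul_add_sq_le hw).trans (add_sq_le_of_sq_le hc ha hb ?_ ?_)
  · rwa [Real.sq_sqrt (hsq _)]
  · rwa [Real.sq_sqrt (hsq _)]

variable [DecidableEq Y] {s : Finset X} {V : Finset Y} {φ : X → Y} {T : Y → X → X}
  {ν₁ ν₂ : X → ℝ} {p : Y → Y → ℝ} {P : Y → Y → X → X → ℝ} {d : X → X → ℝ} {c : ℝ}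

lemma IsTwisted.sum_stepKernel_mul_dist_le (h : IsTwisted s V φ T) (hp : IsKernelOn V p)
    (hP : ∀ i ∈ V, ∀ j ∈ V, IsKernelOn (fiberOn s φ i) (P i j))
    (hdT : ∀ x ∈ s, ∀ j ∈ V, ∀ y ∈ fiberOn s φ (φ x),
      d x (T j y) ≤ d x y + if φ x = j then 0 else 1) {x : X} (hx : x ∈ s) :
    ∑ y ∈ s, stepKernel φ T p P x y * d x y ≤ (1 - p (φ x) (φ x)) +
      ∑ j ∈ V, p (φ x) j * ∑ y ∈ fiberOn s φ (φ x), P (φ x) j x y * d x y := by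
  rw [← hp.sum_mul_ne (h.map_mem x hx), add_comm]
  exact h.sum_stepKernel_mul_le hp hP hx (hdT x hx)

lemma IsTwisted.sum_stepKernel_mul_dist_nonneg (h : IsTwisted s V φ T) (hp : IsKernelOn V p)
    (hP : ∀ i ∈ V, ∀ j ∈ V, IsKernelOn (fiberOn s φ i) (P i j)) (hd : ∀ x y, 0 ≤ d x y) {x : X}
    (hx : x ∈ s) : 0 ≤ ∑ y ∈ s, stepKernel φ T p P x y * d x y :=
  Finset.sum_nonneg fun y hy =>
    mul_nonneg ((h.isKernelOn_step hp hP).nonneg x hx y hy) (hd x y)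

lemma IsTwisted.sq_linCostOn_step_le (h : IsTwisted s V φ T) (hν₁ : IsProbOn s ν₁)
    (hν₂ : IsProbOn s ν₂) (hu : EitherUnifOn s ν₁ ν₂)
    (hp : p = tvKernel V (margOn s φ ν₁) (margOn s φ ν₂))
    (hP : ∀ i ∈ V, ∀ j ∈ V, IsKernelOn (fiberOn s φ i) (P i j)) (hd : ∀ x y, 0 ≤ d x y)
    (hdT : ∀ x ∈ s, ∀ j ∈ V, ∀ y ∈ fiberOn s φ (φ x),
      d x (T j y) ≤ d x y + if φ x = j then 0 else 1) (hc : 0 ≤ c)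
    (hcost : ∀ i ∈ V, ∀ j ∈ V, margOn s φ ν₁ i ≠ 0 → margOn s φ ν₂ j ≠ 0 →
      linCostOn (fiberOn s φ i) d (condOn s φ ν₁ i) (P i j) ^ 2 ≤
        c / 2 * (entOn (fiberOn s φ i) (condOn s φ ν₁ i) +
          entOn (fiberOn s φ i) fun x => condOn s φ ν₂ j (T j x))) :
    linCostOn s d ν₁ (stepKernel φ T p P) ^ 2 ≤ (c + 1) / 2 * (entOn s ν₁ + entOn s ν₂) := by
  have ha := hν₁.marg h.map_mem
  have hb := hν₂.marg h.map_mem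
  have hpk : IsKernelOn V p := hp ▸ isKernelOn_tv ha hb
  set e₀ := entOn V (margOn s φ ν₁) + entOn V (margOn s φ ν₂)
  set e₁ := condEntOn s V φ ν₁ + condEntOn s V φ ν₂
  have he₀ : 0 ≤ e₀ := add_nonneg (entOn_nonneg ha) (entOn_nonneg hb)
  have he₁ : 0 ≤ e₁ := add_nonneg (condEntOn_nonneg hν₁) (condEntOn_nonneg hν₂)
  have hmove : (∑ x ∈ s, ν₁ x * (1 - p (φ x) (φ x))) ^ 2 ≤ e₀ / 2 := by
    rw [sum_mul_comp h.map_mem ν₁ fun i => 1 - p i i]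
    simp only [hp, tvKernel_self]
    exact sq_sum_mul_one_sub_stayMass_le ha hb (hu.margOn h hν₁.nonempty)
  have hrest : (∑ x ∈ s, ν₁ x * ∑ j ∈ V, p (φ x) j *
      ∑ y ∈ fiberOn s φ (φ x), P (φ x) j x y * d x y) ^ 2 ≤ c * (e₁ / 2) :=
    (h.sq_sum_step_le hν₁ hpk (hp ▸ pushes_tv ha hb) hcost).trans_eq (by ring)
  calc linCostOn s d ν₁ (stepKernel φ T p P) ^ 2
      ≤ (∑ x ∈ s, ν₁ x * (1 - p (φ x) (φ x)) + ∑ x ∈ s, ν₁ x * ∑ j ∈ V, p (φ x) j *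
          ∑ y ∈ fiberOn s φ (φ x), P (φ x) j x y * d x y) ^ 2 := by
        refine pow_le_pow_left₀ (Finset.sum_nonneg fun x hx => mul_nonneg (hν₁.nonneg x hx)
          (h.sum_stepKernel_mul_dist_nonneg hpk hP hd hx)) ?_ 2
        rw [← Finset.sum_add_distrib]
        refine Finset.sum_le_sum fun x hx => ?_
        rw [← mul_add]
        exact mul_le_mul_of_nonneg_left (h.sum_stepKernel_mul_dist_le hpk hP hdT hx)
          (hν₁.nonneg x hx)
    _ ≤ (c + 1) * (e₀ / 2 + e₁ / 2) :=
        add_sq_le_of_sq_le hc (by positivity) (by positivity) hmove hrest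
    _ = (c + 1) / 2 * (entOn s ν₁ + entOn s ν₂) := by
        rw [h.entOn_eq_add_condEntOn hν₁, h.entOn_eq_add_condEntOn hν₂]
        ring

lemma IsTwisted.weakCostOn_step_le (h : IsTwisted s V φ T) (hν₁ : IsProbOn s ν₁)
    (hν₂ : IsProbOn s ν₂) (hu : EitherUnifOn s ν₁ ν₂)
    (hp : p = tvKernel V (margOn s φ ν₁) (margOn s φ ν₂))
    (hP : ∀ i ∈ V, ∀ j ∈ V, IsKernelOn (fiberOn s φ i) (P i j)) (hd : ∀ x y, 0 ≤ d x y)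
    (hdT : ∀ x ∈ s, ∀ j ∈ V, ∀ y ∈ fiberOn s φ (φ x),
      d x (T j y) ≤ d x y + if φ x = j then 0 else 1) (hc : 0 ≤ c)
    (hcost : ∀ i ∈ V, ∀ j ∈ V, margOn s φ ν₁ i ≠ 0 → margOn s φ ν₂ j ≠ 0 →
      weakCostOn (fiberOn s φ i) (Finset.univ : Finset Unit) (fun _ => d) (condOn s φ ν₁ i)
        (P i j) ≤ 2 * c * (entOn (fiberOn s φ i) (condOn s φ ν₁ i) +
          entOn (fiberOn s φ i) fun x => condOn s φ ν₂ j (T j x))) :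
    weakCostOn s (Finset.univ : Finset Unit) (fun _ => d) ν₁ (stepKernel φ T p P) ≤
      2 * (c + 1) * (entOn s ν₁ + entOn s ν₂) := by
  have ha := hν₁.marg h.map_mem
  have hb := hν₂.marg h.map_mem
  have hpk : IsKernelOn V p := hp ▸ isKernelOn_tv ha hb
  simp only [weakCostOn, Finset.univ_unique, Finset.sum_singleton] at hcost ⊢
  set e₀ := entOn V (margOn s φ ν₁) + entOn V (margOn s φ ν₂)
  set e₁ := condEntOn s V φ ν₁ + condEntOn s V φ ν₂
  have he₀ : 0 ≤ e₀ := add_nonneg (entOn_nonneg ha) (entOn_nonneg hb)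
  have he₁ : 0 ≤ e₁ := add_nonneg (condEntOn_nonneg hν₁) (condEntOn_nonneg hν₂)
  set rest : X → ℝ := fun x => ∑ j ∈ V, p (φ x) j *
    ∑ y ∈ fiberOn s φ (φ x), P (φ x) j x y * d x y
  have hmove : ∑ x ∈ s, ν₁ x * (1 - p (φ x) (φ x)) ^ 2 ≤ 2 * e₀ := by
    rw [sum_mul_comp h.map_mem ν₁ fun i => (1 - p i i) ^ 2]
    simp only [hp, tvKernel_self]
    exact sum_mul_one_sub_stayMass_sq_le ha hb (hu.margOn h hν₁.nonempty)
  have hrest : ∑ x ∈ s, ν₁ x * rest x ^ 2 ≤ c * (2 * e₁) := by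
    refine (Finset.sum_le_sum fun x hx => mul_le_mul_of_nonneg_left ?_ (hν₁.nonneg x hx)).trans
      ((h.sum_step_le hν₁ hpk (hp ▸ pushes_tv ha hb) hcost).trans_eq (by ring))
    have hφx := h.map_mem x hx
    exact sq_sum_mul_le (hpk.nonneg _ hφx) (hpk.sum_eq _ hφx).le
  calc ∑ x ∈ s, ν₁ x * (∑ y ∈ s, stepKernel φ T p P x y * d x y) ^ 2
      ≤ ∑ x ∈ s, ν₁ x * (1 - p (φ x) (φ x) + rest x) ^ 2 :=
        Finset.sum_le_sum fun x hx => mul_le_mul_of_nonneg_left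
          (pow_le_pow_left₀ (h.sum_stepKernel_mul_dist_nonneg hpk hP hd hx)
            (h.sum_stepKernel_mul_dist_le hpk hP hdT hx) 2) (hν₁.nonneg x hx)
    _ ≤ (c + 1) * (2 * e₀ + 2 * e₁) :=
        sum_mul_add_sq_le_of_le hc (by positivity) (by positivity) hν₁.nonneg hmove hrest
    _ = 2 * (c + 1) * (entOn s ν₁ + entOn s ν₂) := by
        rw [h.entOn_eq_add_condEntOn hν₁, h.entOn_eq_add_condEntOn hν₂]
        ring

end UnitStep

section Image

variable {α : Type*} [DecidableEq α]

/-- The number of points of the image of `K` under `σ` that are not in its image under `τ`. For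
`K` of cardinality `k` this is the distance between the two associated points of a slice. -/
def imageDist (K : Finset α) (σ τ : Equiv.Perm α) : ℝ :=
  ((K.map σ.toEmbedding \ K.map τ.toEmbedding).card : ℝ)

lemma imageDist_nonneg (K : Finset α) (σ τ : Equiv.Perm α) : 0 ≤ imageDist K σ τ :=
  Nat.cast_nonneg _

lemma imageDist_triangle (K : Finset α) (σ τ υ : Equiv.Perm α) :
    imageDist K σ υ ≤ imageDist K σ τ + imageDist K τ υ := by
  unfold imageDist
  exact_mod_cast (Finset.card_le_card (sdiff_triangle _ (K.map τ.toEmbedding) _)).trans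
    (Finset.card_union_le _ _)

lemma imageDist_self_swapTo_le {K : Finset α} {l : α} (hl : l ∈ K) (j : α) (σ : Equiv.Perm α) :
    imageDist K σ (swapTo l j σ) ≤ if σ l = j then 0 else 1 := by
  split_ifs with h
  · have hswap : swapTo l j σ = σ := by rw [swapTo, h, Equiv.swap_self]; rfl
    simp [imageDist, hswap]
  · have hsub : K.map σ.toEmbedding \ K.map (swapTo l j σ).toEmbedding ⊆ {σ l} := by
      intro v hv
      rw [Finset.mem_sdiff, Finset.mem_map, Finset.mem_map] at hv
      obtain ⟨⟨a, ha, rfl⟩, hv⟩ := hv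
      rw [Finset.mem_singleton]
      by_contra hne
      by_cases hj : σ a = j
      · exact hv ⟨l, hl, by simp [swapTo, hj]⟩
      · refine hv ⟨a, ha, ?_⟩
        simp only [Equiv.toEmbedding_apply, swapTo, Equiv.Perm.mul_apply]
        exact Equiv.swap_apply_of_ne_of_ne hne hj
    rw [imageDist]
    exact_mod_cast Finset.card_le_card hsub

lemma imageDist_swapTo_le {K : Finset α} {l : α} (hl : l ∈ K) (j : α) {σ τ : Equiv.Perm α}
    (hτ : τ l = σ l) :
    imageDist K σ (swapTo l j τ) ≤ imageDist K σ τ + if σ l = j then 0 else 1 := by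
  rw [← hτ]
  exact (imageDist_triangle K σ τ _).trans
    (add_le_add_right (imageDist_self_swapTo_le hl j τ) _)

variable [Fintype α] {A K : Finset α} {ρ : Equiv.Perm α} {ν₁ ν₂ : Equiv.Perm α → ℝ}

lemma imageDist_eq_zero (hKA : K ⊆ A) {σ τ : Equiv.Perm α} (hσ : σ ∈ coset A ρ)
    (hτ : τ ∈ coset A ρ) : imageDist K σ τ = 0 := by
  rw [mem_coset] at hσ hτ
  have himage : K.map σ.toEmbedding = K.map τ.toEmbedding := by
    simp only [Finset.map_eq_image, Equiv.coe_toEmbedding]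
    exact Finset.image_congr fun a ha => by simp [hσ a (hKA ha), hτ a (hKA ha)]
  simp [imageDist, himage]

lemma exists_kernel_imageDist_of_subset (hKA : K ⊆ A) (h₁ : IsProbOn (coset A ρ) ν₁)
    (h₂ : IsProbOn (coset A ρ) ν₂) :
    ∃ P, IsKernelOn (coset A ρ) P ∧ Pushes (coset A ρ) P ν₁ ν₂ ∧
      linCostOn (coset A ρ) (imageDist K) ν₁ P = 0 ∧
      weakCostOn (coset A ρ) (Finset.univ : Finset Unit) (fun _ => imageDist K) ν₁ P = 0 := by
  have hcost : ∀ σ ∈ coset A ρ, ∑ τ ∈ coset A ρ, ν₂ τ * imageDist K σ τ = 0 := fun σ hσ =>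
    Finset.sum_eq_zero fun τ hτ => by rw [imageDist_eq_zero hKA hσ hτ, mul_zero]
  exact ⟨_, h₂.isKernelOn_const, h₁.pushes_const ν₂,
    Finset.sum_eq_zero fun σ hσ => by rw [hcost σ hσ, mul_zero],
    Finset.sum_eq_zero fun σ hσ => by simp [hcost σ hσ]⟩

lemma exists_kernel_imageDist (K A : Finset α) (ρ : Equiv.Perm α) (ν₁ ν₂ : Equiv.Perm α → ℝ)
    (h₁ : IsProbOn (coset A ρ) ν₁) (h₂ : IsProbOn (coset A ρ) ν₂)
    (hu : EitherUnifOn (coset A ρ) ν₁ ν₂) :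
    ∃ P, IsKernelOn (coset A ρ) P ∧ Pushes (coset A ρ) P ν₁ ν₂ ∧
      linCostOn (coset A ρ) (imageDist K) ν₁ P ^ 2 ≤
        ((K \ A).card : ℝ) / 2 * (entOn (coset A ρ) ν₁ + entOn (coset A ρ) ν₂) ∧
      weakCostOn (coset A ρ) (Finset.univ : Finset Unit) (fun _ => imageDist K) ν₁ P ≤
        2 * ((K \ A).card : ℝ) * (entOn (coset A ρ) ν₁ + entOn (coset A ρ) ν₂) := by
  rcases (K \ A).eq_empty_or_nonempty with hKA | ⟨l, hlKA⟩
  · obtain ⟨P, hP, hPν, hlin, hweak⟩ :=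
      exists_kernel_imageDist_of_subset (Finset.sdiff_eq_empty_iff_subset.1 hKA) h₁ h₂
    exact ⟨P, hP, hPν, by simp [hlin, hKA], by rw [hweak]; simp [hKA]⟩
  obtain ⟨hlK, hlA⟩ := Finset.mem_sdiff.1 hlKA
  have hl := Finset.mem_compl.2 hlA
  have hT := isTwisted_coset (ρ := ρ) hl
  have hcard : (((K \ insert l A).card : ℝ)) + 1 = (K \ A).card := by
    rw [Finset.sdiff_insert]
    exact_mod_cast Finset.card_erase_add_one hlKA
  obtain ⟨P, hP⟩ := hT.exists_fiberKernels h₁ h₂ hu (Q := fun F μ₁ μ₂ P =>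
      linCostOn F (imageDist K) μ₁ P ^ 2 ≤
        ((K \ insert l A).card : ℝ) / 2 * (entOn F μ₁ + entOn F μ₂) ∧
      weakCostOn F (Finset.univ : Finset Unit) (fun _ => imageDist K) μ₁ P ≤
        2 * ((K \ insert l A).card : ℝ) * (entOn F μ₁ + entOn F μ₂)) fun i hi => by
    rw [fiberOn_coset hl hi]
    exact exists_kernel_imageDist K (insert l A) (swapTo l i ρ)
  have hPk := fun i hi j hj => (hP i hi j hj).1
  have hdT : ∀ σ ∈ coset A ρ, ∀ j ∈ freeValues A ρ, ∀ τ ∈ evalFiber A ρ l (σ l),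
      imageDist K σ (swapTo l j τ) ≤ imageDist K σ τ + if σ l = j then 0 else 1 :=
    fun σ _ j _ τ hτ => imageDist_swapTo_le hlK j (mem_fiberOn.1 hτ).2
  rw [← hcard]
  exact ⟨_, hT.isKernelOn_step (isKernelOn_tv (h₁.evalLaw hl) (h₂.evalLaw hl)) hPk,
    hT.pushes_step h₁ h₂ (isKernelOn_tv (h₁.evalLaw hl) (h₂.evalLaw hl))
      (pushes_tv (h₁.evalLaw hl) (h₂.evalLaw hl))
      fun i hi j hj ha hb => ((hP i hi j hj).2 ha hb).1,
    hT.sq_linCostOn_step_le h₁ h₂ hu rfl hPk (imageDist_nonneg K) hdT (Nat.cast_nonneg _)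
      fun i hi j hj ha hb => ((hP i hi j hj).2 ha hb).2.1,
    hT.weakCostOn_step_le h₁ h₂ hu rfl hPk (imageDist_nonneg K) hdT (Nat.cast_nonneg _)
      fun i hi j hj ha hb => ((hP i hi j hj).2 ha hb).2.2⟩
termination_by (K \ A).card
decreasing_by
  rw [Finset.sdiff_insert]
  exact Finset.card_erase_lt_of_mem hlKA

end Image

section Gluing

variable {s : Finset X} {ν₁ ν₂ : X → ℝ}

lemma sqrt_mul_add_sqrt_mul_sq {t : ℝ} (ht : 0 ≤ t) (a b : ℝ) :
    (√(t * a) + √(t * b)) ^ 2 = t * (√a + √b) ^ 2 := by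
  rw [Real.sqrt_mul ht, Real.sqrt_mul ht, ← mul_add, mul_pow, Real.sq_sqrt ht]

lemma exists_kernel_through_unif {d : X → X → ℝ} {I : Finset ι} {D : ι → X → X → ℝ} {c t : ℝ}
    (hc : 0 ≤ c) (ht : 0 ≤ t) (hd0 : ∀ x ∈ s, ∀ y ∈ s, 0 ≤ d x y)
    (hd : ∀ x ∈ s, ∀ y ∈ s, ∀ z ∈ s, d x z ≤ d x y + d y z)
    (hD0 : ∀ i ∈ I, ∀ x ∈ s, ∀ y ∈ s, 0 ≤ D i x y)
    (hD : ∀ i ∈ I, ∀ x ∈ s, ∀ y ∈ s, ∀ z ∈ s, D i x z ≤ D i x y + D i y z)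
    (hunif : ∀ ν₁ ν₂ : X → ℝ, IsProbOn s ν₁ → IsProbOn s ν₂ → EitherUnifOn s ν₁ ν₂ →
      ∃ P, IsKernelOn s P ∧ Pushes s P ν₁ ν₂ ∧
        linCostOn s d ν₁ P ^ 2 ≤ c * (entOn s ν₁ + entOn s ν₂) ∧
        weakCostOn s I D ν₁ P ≤ t * (entOn s ν₁ + entOn s ν₂))
    (h₁ : IsProbOn s ν₁) (h₂ : IsProbOn s ν₂) :
    ∃ P, IsKernelOn s P ∧ Pushes s P ν₁ ν₂ ∧
      linCostOn s d ν₁ P ^ 2 ≤ c * (√(entOn s ν₁) + √(entOn s ν₂)) ^ 2 ∧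
      weakCostOn s I D ν₁ P ≤ t * (√(entOn s ν₁) + √(entOn s ν₂)) ^ 2 := by
  have hU := isProbOn_unifOn h₁.nonempty
  obtain ⟨P, hP, hPν, hPlin, hPweak⟩ := hunif _ _ h₁ hU (Or.inr fun _ _ => rfl)
  obtain ⟨Q, hQ, hQν, hQlin, hQweak⟩ := hunif _ _ hU h₂ (Or.inl fun _ _ => rfl)
  simp only [entOn_unifOn, add_zero, zero_add] at hPweak hPlin hQweak hQlin
  refine ⟨_, hP.comp hQ, hPν.comp hQν, ?_, ?_⟩
  · rw [← sqrt_mul_add_sqrt_mul_sq hc]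
    refine pow_le_pow_left₀ (linCostOn_nonneg h₁.nonneg (hP.comp hQ) hd0) ?_ 2
    exact (linCostOn_comp_le h₁.nonneg hP hQ hPν hd).trans
      (add_le_add (Real.le_sqrt_of_sq_le hPlin) (Real.le_sqrt_of_sq_le hQlin))
  · rw [← sqrt_mul_add_sqrt_mul_sq ht]
    exact (weakCostOn_comp_le h₁.nonneg hP hQ hPν hD0 hD).trans (pow_le_pow_left₀ (by positivity)
      (add_le_add (Real.sqrt_le_sqrt hPweak) (Real.sqrt_le_sqrt hQweak)) 2)

variable {α : Type*} [Fintype α] [DecidableEq α] {ν₁ ν₂ : Equiv.Perm α → ℝ}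

lemma coset_empty (ρ : Equiv.Perm α) : coset ∅ ρ = Finset.univ := by
  ext σ
  simp [mem_coset]

lemma exists_kernel_differAt_univ (h₁ : IsProbOn Finset.univ ν₁) (h₂ : IsProbOn Finset.univ ν₂) :
    ∃ P, IsKernelOn Finset.univ P ∧ Pushes Finset.univ P ν₁ ν₂ ∧
      weakCostOn Finset.univ Finset.univ differAt ν₁ P ≤
        8 * (√(entOn Finset.univ ν₁) + √(entOn Finset.univ ν₂)) ^ 2 := by
  rw [← coset_empty 1] at h₁ h₂ ⊢
  rw [← Finset.compl_empty (α := α)]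
  obtain ⟨P, hP, hPν, -, hweak⟩ := exists_kernel_through_unif (d := 0) (I := (∅ : Finset α)ᶜ)
    (D := differAt) le_rfl (by norm_num : (0 : ℝ) ≤ 8) (by simp) (by simp)
    (fun _ _ _ _ _ _ => differAt_nonneg _ _ _) (fun _ _ _ _ _ _ _ _ => differAt_triangle _ _ _ _)
    (fun ν₁ ν₂ h₁ h₂ hu => by
      obtain ⟨P, hP, hPν, hweak⟩ := exists_kernel_differAt ∅ 1 ν₁ ν₂ h₁ h₂ hu
      exact ⟨P, hP, hPν, by simp [linCostOn], hweak⟩) h₁ h₂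
  exact ⟨P, hP, hPν, hweak⟩

lemma exists_kernel_imageDist_univ (K : Finset α) (h₁ : IsProbOn Finset.univ ν₁)
    (h₂ : IsProbOn Finset.univ ν₂) :
    ∃ P, IsKernelOn Finset.univ P ∧ Pushes Finset.univ P ν₁ ν₂ ∧
      linCostOn Finset.univ (imageDist K) ν₁ P ^ 2 ≤
        (K.card : ℝ) / 2 * (√(entOn Finset.univ ν₁) + √(entOn Finset.univ ν₂)) ^ 2 ∧
      weakCostOn Finset.univ (Finset.univ : Finset Unit) (fun _ => imageDist K) ν₁ P ≤
        2 * (K.card : ℝ) * (√(entOn Finset.univ ν₁) + √(entOn Finset.univ ν₂)) ^ 2 := by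
  rw [← coset_empty 1] at h₁ h₂ ⊢
  obtain ⟨P, hP, hPν, hlin, hweak⟩ := exists_kernel_through_unif (d := imageDist K)
    (I := (Finset.univ : Finset Unit)) (D := fun _ => imageDist K) (c := K.card / 2)
    (t := 2 * K.card) (by positivity) (by positivity)
    (fun _ _ _ _ => imageDist_nonneg _ _ _) (fun _ _ _ _ _ _ => imageDist_triangle _ _ _ _)
    (fun _ _ _ _ _ _ => imageDist_nonneg _ _ _) (fun _ _ _ _ _ _ _ _ => imageDist_triangle _ _ _ _)
    (fun ν₁ ν₂ h₁ h₂ hu => by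
      obtain ⟨P, hP, hPν, hlin, hweak⟩ := exists_kernel_imageDist K ∅ 1 ν₁ ν₂ h₁ h₂ hu
      rw [Finset.sdiff_empty] at hlin hweak
      exact ⟨P, hP, hPν, hlin, hweak⟩) h₁ h₂
  exact ⟨P, hP, hPν, hlin, hweak⟩

end Gluing

section Quotient

variable [DecidableEq X] {s : Finset Y} {V : Finset X} {q : Y → X} {r : ℕ}
  {ν ν₁ ν₂ : X → ℝ} {P : Y → Y → ℝ}

/-- `q` maps `s` to `V` and all its fibres have `r > 0` points, so that it carries the uniform
law on `s` to the uniform law on `V`. -/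
structure IsUniformMap (s : Finset Y) (V : Finset X) (q : Y → X) (r : ℕ) : Prop where
  map_mem : ∀ y ∈ s, q y ∈ V
  card_fiber : ∀ x ∈ V, (fiberOn s q x).card = r
  pos : 0 < r

/-- The image under `q` of a kernel on `s`, for `q` with fibres of `r` points: start from a uniform
point of the fibre of `x`, move with `P` and apply `q`. -/
def quotKernel (s : Finset Y) (q : Y → X) (r : ℕ) (P : Y → Y → ℝ) (x x' : X) : ℝ :=
  (r : ℝ)⁻¹ * ∑ y ∈ fiberOn s q x, ∑ y' ∈ fiberOn s q x', P y y'

namespace IsUniformMap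

lemma cast_ne_zero (h : IsUniformMap s V q r) : (r : ℝ) ≠ 0 := by exact_mod_cast h.pos.ne'

lemma inv_mul_sum_fiber (h : IsUniformMap s V q r) (g : X → ℝ) {x : X}
    (hx : x ∈ V) : (r : ℝ)⁻¹ * ∑ y ∈ fiberOn s q x, g (q y) = g x := by
  rw [Finset.sum_congr rfl fun y hy => by rw [(mem_fiberOn.1 hy).2], Finset.sum_const,
    h.card_fiber x hx, nsmul_eq_mul, inv_mul_cancel_left₀ h.cast_ne_zero]

lemma sum_comp_div (h : IsUniformMap s V q r) (g : X → ℝ) :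
    ∑ y ∈ s, g (q y) / r = ∑ x ∈ V, g x := by
  rw [← sum_fiberOn h.map_mem]
  refine Finset.sum_congr rfl fun x hx => ?_
  rw [← Finset.sum_div, div_eq_inv_mul, h.inv_mul_sum_fiber g hx]

lemma isProbOn_lift (h : IsUniformMap s V q r) (hν : IsProbOn V ν) :
    IsProbOn s fun y => ν (q y) / r where
  nonneg y hy := div_nonneg (hν.nonneg _ (h.map_mem y hy)) (Nat.cast_nonneg r)
  sum_eq := (h.sum_comp_div ν).trans hν.sum_eq

lemma entOn_lift (h : IsUniformMap s V q r) :
    entOn s (fun y => ν (q y) / r) = entOn V ν := by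
  have hcard : (s.card : ℝ) = V.card * r := by
    have := h.sum_comp_div fun _ => (r : ℝ)
    simpa [h.cast_ne_zero] using this
  rw [entOn, entOn, ← h.sum_comp_div]
  refine Finset.sum_congr rfl fun y _ => ?_
  rw [hcard, mul_assoc, mul_div_cancel₀ _ h.cast_ne_zero, div_mul_eq_mul_div]

lemma sum_quotKernel_mul (h : IsUniformMap s V q r) (g : X → X → ℝ) (x : X) :
    ∑ x' ∈ V, quotKernel s q r P x x' * g x x' =
      (r : ℝ)⁻¹ * ∑ y ∈ fiberOn s q x, ∑ y' ∈ s, P y y' * g (q y) (q y') := by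
  simp only [quotKernel, mul_assoc, ← Finset.mul_sum]
  congr 1
  simp only [Finset.sum_mul]
  rw [Finset.sum_comm]
  refine Finset.sum_congr rfl fun y hy => ?_
  rw [← sum_fiberOn h.map_mem]
  refine Finset.sum_congr rfl fun x' _ => Finset.sum_congr rfl fun y' hy' => ?_
  rw [(mem_fiberOn.1 hy).2, (mem_fiberOn.1 hy').2]

lemma isKernelOn_quot (h : IsUniformMap s V q r) (hP : IsKernelOn s P) :
    IsKernelOn V (quotKernel s q r P) where
  nonneg x _ x' _ := mul_nonneg (by positivity) (Finset.sum_nonneg fun y hy =>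
    Finset.sum_nonneg fun y' hy' => hP.nonneg y (mem_fiberOn.1 hy).1 y' (mem_fiberOn.1 hy').1)
  sum_eq x hx := by
    have hsum := h.sum_quotKernel_mul (P := P) (fun _ _ => 1) x
    simp only [mul_one] at hsum
    rw [hsum, Finset.sum_congr rfl fun y hy => hP.sum_eq y (mem_fiberOn.1 hy).1]
    exact h.inv_mul_sum_fiber (fun _ => 1) hx

lemma pushes_quot (h : IsUniformMap s V q r)
    (hP : Pushes s P (fun y => ν₁ (q y) / r) (fun y => ν₂ (q y) / r)) :
    Pushes V (quotKernel s q r P) ν₁ ν₂ := fun x' hx' => by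
  have hpush : ∀ y' ∈ fiberOn s q x', (r : ℝ)⁻¹ * ν₂ (q y') = ∑ y ∈ s, ν₁ (q y) / r * P y y' :=
    fun y' hy' => by rw [hP y' (mem_fiberOn.1 hy').1]; exact (div_eq_inv_mul _ _).symm
  rw [← h.inv_mul_sum_fiber ν₂ hx', Finset.mul_sum, Finset.sum_congr rfl hpush, Finset.sum_comm,
    ← sum_fiberOn h.map_mem]
  refine Finset.sum_congr rfl fun x _ => ?_
  rw [quotKernel, Finset.mul_sum, Finset.mul_sum]
  refine Finset.sum_congr rfl fun y hy => ?_
  rw [(mem_fiberOn.1 hy).2, ← Finset.mul_sum]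
  ring

lemma linCostOn_quot_le (h : IsUniformMap s V q r) (hP : IsKernelOn s P)
    (hν : ∀ x ∈ V, 0 ≤ ν x) {d : X → X → ℝ} {d' : Y → Y → ℝ}
    (hd : ∀ y ∈ s, ∀ y' ∈ s, d (q y) (q y') ≤ d' y y') :
    linCostOn V d ν (quotKernel s q r P) ≤ linCostOn s d' (fun y => ν (q y) / r) P := by
  unfold linCostOn
  rw [← sum_fiberOn h.map_mem]
  refine Finset.sum_le_sum fun x hx => ?_
  rw [h.sum_quotKernel_mul, Finset.mul_sum, Finset.mul_sum]
  refine Finset.sum_le_sum fun y hy => ?_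
  obtain ⟨hys, rfl⟩ := mem_fiberOn.1 hy
  rw [← mul_assoc, ← div_eq_mul_inv]
  exact mul_le_mul_of_nonneg_left (Finset.sum_le_sum fun y' hy' =>
    mul_le_mul_of_nonneg_left (hd y hys y' hy') (hP.nonneg y hys y' hy'))
    (div_nonneg (hν _ hx) (Nat.cast_nonneg r))

lemma weakCostOn_quot_le (h : IsUniformMap s V q r) (hP : IsKernelOn s P)
    (hν : ∀ x ∈ V, 0 ≤ ν x) {I : Finset ι} {D : ι → X → X → ℝ} {D' : ι → Y → Y → ℝ}
    (hD0 : ∀ i ∈ I, ∀ x x', 0 ≤ D i x x')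
    (hD : ∀ i ∈ I, ∀ y ∈ s, ∀ y' ∈ s, D i (q y) (q y') ≤ D' i y y') :
    weakCostOn V I D ν (quotKernel s q r P) ≤ weakCostOn s I D' (fun y => ν (q y) / r) P := by
  unfold weakCostOn
  rw [← sum_fiberOn h.map_mem]
  refine Finset.sum_le_sum fun x hx => ?_
  have hfiber : ∑ y ∈ fiberOn s q x, ν (q y) / r * ∑ i ∈ I, (∑ y' ∈ s, P y y' * D' i y y') ^ 2 =
      ν x * ∑ i ∈ I, ∑ y ∈ fiberOn s q x, (r : ℝ)⁻¹ * (∑ y' ∈ s, P y y' * D' i y y') ^ 2 := by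
    rw [Finset.sum_comm, Finset.mul_sum]
    refine Finset.sum_congr rfl fun y hy => ?_
    rw [(mem_fiberOn.1 hy).2, ← Finset.mul_sum]
    ring
  rw [hfiber]
  refine mul_le_mul_of_nonneg_left (Finset.sum_le_sum fun i hi => ?_) (hν x hx)
  rw [h.sum_quotKernel_mul, Finset.mul_sum]
  refine (sq_sum_mul_le (fun y _ => by positivity) (le_of_eq ?_)).trans
    (Finset.sum_le_sum fun y hy => ?_)
  · rw [Finset.sum_const, h.card_fiber x hx, nsmul_eq_mul, mul_inv_cancel₀ h.cast_ne_zero]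
  · have hy := (mem_fiberOn.1 hy).1
    refine mul_le_mul_of_nonneg_left (pow_le_pow_left₀ (Finset.sum_nonneg fun y' hy' =>
      mul_nonneg (hP.nonneg y hy y' hy') (hD0 i hi _ _)) (Finset.sum_le_sum fun y' hy' =>
      mul_le_mul_of_nonneg_left (hD i hi y hy y' hy') (hP.nonneg y hy y' hy')) 2) (by positivity)

lemma comp_equiv {Z : Type*} [Fintype Y] [Fintype Z] (h : IsUniformMap Finset.univ V q r)
    (e : Z ≃ Y) : IsUniformMap Finset.univ V (q ∘ e) r where
  map_mem z _ := h.map_mem _ (Finset.mem_univ _)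
  card_fiber x hx := by
    rw [← h.card_fiber x hx]
    exact Finset.card_equiv e fun z => by simp [mem_fiberOn]
  pos := h.pos

end IsUniformMap

end Quotient

section Words

variable {n : ℕ} {E : Type*} [DecidableEq E]

/-- The set of words `S` is empty or an orbit of the action of the permutations of the positions
on the words of length `n`. -/
def IsWordOrbit (S : Set (Fin n → E)) : Prop :=
  ∀ x ∈ S, ∀ y, y ∈ S ↔ ∃ σ : Equiv.Perm (Fin n), x ∘ σ = y

lemma exists_perm_comp_eq_iff {x y : Fin n → E} :
    (∃ σ : Equiv.Perm (Fin n), x ∘ σ = y) ↔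
      ∀ l, (Finset.univ.filter fun i => y i = l).card =
        (Finset.univ.filter fun i => x i = l).card := by
  constructor
  · rintro ⟨σ, rfl⟩ l
    exact Finset.card_equiv σ fun i => by simp
  · intro h
    have e : ∀ l, Nonempty ({i // y i = l} ≃ {i // x i = l}) := fun l =>
      Fintype.card_eq.1 (by rw [Fintype.card_subtype, Fintype.card_subtype, h l])
    exact ⟨Equiv.ofFiberEquiv fun l => (e l).some, funext fun i => Equiv.ofFiberEquiv_map _ i⟩

lemma isWordOrbit_multislice {m : ℕ} (k : Fin m → ℕ) : IsWordOrbit (multislice n k) := by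
  intro x hx y
  rw [exists_perm_comp_eq_iff]
  exact forall_congr' fun l => by rw [hx l]

lemma card_filter_zero (x : Fin n → Fin 2) : (Finset.univ.filter fun i => x i = 0).card =
    n - (Finset.univ.filter fun i => x i = 1).card := by
  have hcount := Finset.card_filter_add_card_filter_not (s := Finset.univ) fun i => x i = 1
  have hzero : (Finset.univ.filter fun i => ¬x i = 1) = Finset.univ.filter fun i => x i = 0 :=
    Finset.filter_congr fun i _ => by lia
  rw [hzero, Finset.card_univ, Fintype.card_fin] at hcount
  lia

lemma slice_eq_multislice (n k : ℕ) : slice n k = multislice n ![n - k, k] := by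
  ext x
  have hval : ∀ i, (x i : ℕ) = if x i = 1 then 1 else 0 := fun i => by
    split_ifs <;> lia
  rw [slice, Set.mem_ofPred_eq, Finset.sum_congr rfl fun i _ => hval i, ← Finset.card_filter,
    multislice, Set.mem_ofPred_eq, Fin.forall_fin_two, card_filter_zero]
  exact ⟨fun h => ⟨by rw [h]; rfl, h⟩, fun h => h.2⟩

lemma card_filter_sdiff_mul_two {x y : Fin n → Fin 2} {e : Fin 2}
    (hcard : (Finset.univ.filter fun i => x i = e).card =
      (Finset.univ.filter fun i => y i = e).card) :
    ((Finset.univ.filter fun i => x i = e) \ Finset.univ.filter fun i => y i = e).card * 2 =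
      hammingDist x y := by
  have hne : (Finset.univ.filter fun i => x i ≠ y i) =
      ((Finset.univ.filter fun i => x i = e) \ Finset.univ.filter fun i => y i = e) ∪
        ((Finset.univ.filter fun i => y i = e) \ Finset.univ.filter fun i => x i = e) := by
    ext i
    simp only [Finset.mem_filter, Finset.mem_univ, true_and, Finset.mem_union, Finset.mem_sdiff]
    lia
  rw [hammingDist, hne, Finset.card_union_of_disjoint disjoint_sdiff_sdiff,
    ← Finset.card_sdiff_comm hcard, mul_two]

lemma map_filter_eq (x : Fin n → E) (e : E) (σ : Equiv.Perm (Fin n)) :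
    (Finset.univ.filter fun i => x i = e).map σ.toEmbedding =
      Finset.univ.filter fun i => (x ∘ ⇑σ⁻¹) i = e := by
  ext i
  simp [Equiv.Perm.inv_def]

lemma imageDist_eq_half_hammingDist (x : Fin n → Fin 2) (e : Fin 2) (σ τ : Equiv.Perm (Fin n)) :
    imageDist (Finset.univ.filter fun i => x i = e) σ τ =
      (hammingDist (x ∘ ⇑σ⁻¹) (x ∘ ⇑τ⁻¹) : ℝ) / 2 := by
  have hcard : (Finset.univ.filter fun i => (x ∘ ⇑σ⁻¹) i = e).card =
      (Finset.univ.filter fun i => (x ∘ ⇑τ⁻¹) i = e).card := by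
    rw [← map_filter_eq, ← map_filter_eq, Finset.card_map, Finset.card_map]
  rw [imageDist, map_filter_eq, map_filter_eq, ← card_filter_sdiff_mul_two hcard, Nat.cast_mul,
    Nat.cast_two, mul_div_cancel_right₀ _ two_ne_zero]

variable {S : Set (Fin n → E)} [Fintype S]

/-- The word `x ∘ σ` as an element of the orbit `S` of `x`. -/
def IsWordOrbit.act (h : IsWordOrbit S) (x : S) (σ : Equiv.Perm (Fin n)) : S :=
  ⟨x.1 ∘ σ, (h x.1 x.2 _).2 ⟨σ, rfl⟩⟩

lemma IsWordOrbit.exists_isUniformMap (h : IsWordOrbit S) (x : S) :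
    ∃ r, IsUniformMap Finset.univ Finset.univ (h.act x) r := by
  refine ⟨(fiberOn Finset.univ (h.act x) x).card, fun _ _ => Finset.mem_univ _, fun y _ => ?_,
    Finset.card_pos.2 ⟨1, mem_fiberOn.2 ⟨Finset.mem_univ _, rfl⟩⟩⟩
  obtain ⟨τ, hτ⟩ := (h x.1 x.2 y.1).1 y.2
  refine (Finset.card_equiv (Equiv.mulRight τ) fun σ => ?_).symm
  simp only [mem_fiberOn, Finset.mem_univ, true_and, Subtype.ext_iff, IsWordOrbit.act, ← hτ,
    Equiv.coe_mulRight, Equiv.Perm.coe_mul, ← Function.comp_assoc]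
  exact ⟨fun h => by rw [h], fun h => τ.surjective.injective_comp_right h⟩

lemma IsWordOrbit.exists_kernel_hat (h : IsWordOrbit S) {ν₁ ν₂ : S → ℝ}
    (h₁ : IsProbOn Finset.univ ν₁) (h₂ : IsProbOn Finset.univ ν₂) :
    ∃ P, IsKernelOn Finset.univ P ∧ Pushes Finset.univ P ν₁ ν₂ ∧
      weakCostOn Finset.univ Finset.univ (fun i (x y : S) => if x.1 i = y.1 i then 0 else 1) ν₁ P ≤
        8 * (√(entOn Finset.univ ν₁) + √(entOn Finset.univ ν₂)) ^ 2 := by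
  obtain ⟨x, -⟩ := h₁.nonempty
  obtain ⟨r, hr⟩ := h.exists_isUniformMap x
  obtain ⟨P, hP, hPν, hweak⟩ :=
    exists_kernel_differAt_univ (hr.isProbOn_lift h₁) (hr.isProbOn_lift h₂)
  rw [hr.entOn_lift, hr.entOn_lift] at hweak
  refine ⟨_, hr.isKernelOn_quot hP, hr.pushes_quot hPν, (hr.weakCostOn_quot_le hP h₁.nonneg
    (fun i _ x y => by positivity) fun i _ σ _ τ _ => ?_).trans hweak⟩
  simp only [IsWordOrbit.act, differAt, Function.comp_apply]
  by_cases hστ : σ i = τ i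
  · simp [hστ]
  · by_cases hx : x.1 (σ i) = x.1 (τ i) <;> simp [hστ, hx]

lemma exists_kernel_binary_multislice {k : Fin 2 → ℕ} [Fintype (multislice n k)] (e : Fin 2)
    {ν₁ ν₂ : multislice n k → ℝ} (h₁ : IsProbOn Finset.univ ν₁) (h₂ : IsProbOn Finset.univ ν₂) :
    ∃ P, IsKernelOn Finset.univ P ∧ Pushes Finset.univ P ν₁ ν₂ ∧
      linCostOn Finset.univ (fun x y => (hammingDist x.1 y.1 : ℝ) / 2) ν₁ P ^ 2 ≤
        (k e : ℝ) / 2 * (√(entOn Finset.univ ν₁) + √(entOn Finset.univ ν₂)) ^ 2 ∧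
      weakCostOn Finset.univ (Finset.univ : Finset Unit)
          (fun _ x y => (hammingDist x.1 y.1 : ℝ) / 2) ν₁ P ≤
        2 * (k e : ℝ) * (√(entOn Finset.univ ν₁) + √(entOn Finset.univ ν₂)) ^ 2 := by
  obtain ⟨x, -⟩ := h₁.nonempty
  obtain ⟨r, hr⟩ := (isWordOrbit_multislice k).exists_isUniformMap x
  replace hr := hr.comp_equiv (Equiv.inv (Equiv.Perm (Fin n)))
  have hd : ∀ σ ∈ Finset.univ, ∀ τ ∈ Finset.univ, _ ≤ _ := fun σ _ τ _ =>
    (imageDist_eq_half_hammingDist x.1 e σ τ).ge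
  obtain ⟨P, hP, hPν, hlin, hweak⟩ :=
    exists_kernel_imageDist_univ _ (hr.isProbOn_lift h₁) (hr.isProbOn_lift h₂)
  rw [hr.entOn_lift, hr.entOn_lift, x.2 e] at hlin hweak
  have hQ := hr.isKernelOn_quot hP
  refine ⟨_, hQ, hr.pushes_quot hPν, le_trans ?_ hlin, le_trans ?_ hweak⟩
  · exact pow_le_pow_left₀ (linCostOn_nonneg h₁.nonneg hQ fun _ _ _ _ => by positivity)
      (hr.linCostOn_quot_le hP h₁.nonneg hd) 2
  · exact hr.weakCostOn_quot_le hP h₁.nonneg (fun _ _ _ _ => by positivity) fun _ _ => hd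

end Words

section FiniteMeasures

variable [Fintype X] [MeasurableSpace X] [MeasurableSingletonClass X]
  {ν ν₁ ν₂ : Measure X} {P : X → X → ℝ}

lemma isProbOn_real (ν : Measure X) [IsProbabilityMeasure ν] :
    IsProbOn Finset.univ fun x => ν.real {x} where
  nonneg _ _ := measureReal_nonneg
  sum_eq := by
    rw [sum_measureReal_singleton, Finset.coe_univ, probReal_univ]

lemma uniformLaw_singleton (x : X) : uniformLaw X {x} = (Fintype.card X : ℝ≥0∞)⁻¹ := by
  rw [uniformLaw, uniformOn_univ, Measure.count_singleton, one_div]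

lemma absolutelyContinuous_uniformLaw {X : Type*} [Finite X] [MeasurableSpace X]
    [MeasurableSingletonClass X] (ν : Measure X) : ν ≪ uniformLaw X := fun A hA => by
  have := Fintype.ofFinite X
  have hempty : A = ∅ := Set.eq_empty_of_forall_notMem fun x hx =>
    ENNReal.inv_ne_zero.2 (ENNReal.natCast_ne_top (Fintype.card X)) <| by
      rw [← uniformLaw_singleton x]
      exact measure_mono_null (Set.singleton_subset_iff.2 hx) hA
  rw [hempty, measure_empty]

lemma toReal_rnDeriv_uniformLaw (ν : Measure X) [IsFiniteMeasure ν] (x : X) :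
    (ν.rnDeriv (uniformLaw X) x).toReal = Fintype.card X * ν.real {x} := by
  have : Nonempty X := ⟨x⟩
  have : IsProbabilityMeasure (uniformLaw X) := isProbabilityMeasure_uniformOn
    Set.finite_univ Set.univ_nonempty
  have hderiv := Measure.setLIntegral_rnDeriv (absolutelyContinuous_uniformLaw ν) {x}
  rw [lintegral_singleton, uniformLaw_singleton] at hderiv
  rw [measureReal_def, ← hderiv, ENNReal.toReal_mul, ENNReal.toReal_inv, ENNReal.toReal_natCast,
    mul_comm, inv_mul_cancel_right₀ (by exact_mod_cast Fintype.card_ne_zero)]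

lemma klDiv_uniformLaw (ν : Measure X) [IsProbabilityMeasure ν] :
    klDiv ν (uniformLaw X) = ENNReal.ofReal (entOn Finset.univ fun x => ν.real {x}) := by
  have : Nonempty X := ν.nonempty_of_neZero
  have : IsProbabilityMeasure (uniformLaw X) := isProbabilityMeasure_uniformOn
    Set.finite_univ Set.univ_nonempty
  rw [klDiv_eq_lintegral_klFun_of_ac (absolutelyContinuous_uniformLaw ν), lintegral_fintype,
    entOn_eq_klFun (isProbOn_real ν), ENNReal.ofReal_mul (by positivity),
    ENNReal.ofReal_sum_of_nonneg fun x _ =>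
      klFun_nonneg (mul_nonneg (Nat.cast_nonneg _) measureReal_nonneg), Finset.card_univ,
    ENNReal.ofReal_inv_of_pos (by exact_mod_cast Fintype.card_pos), ENNReal.ofReal_natCast,
    Finset.mul_sum]
  exact Finset.sum_congr rfl fun x _ => by
    rw [toReal_rnDeriv_uniformLaw, uniformLaw_singleton, mul_comm]

lemma entropyBound_uniformLaw (ν₁ ν₂ : Measure X) [IsProbabilityMeasure ν₁]
    [IsProbabilityMeasure ν₂] : entropyBound (uniformLaw X) ν₁ ν₂ =
      ENNReal.ofReal ((√(entOn Finset.univ fun x => ν₁.real {x}) +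
        √(entOn Finset.univ fun x => ν₂.real {x})) ^ 2) := by
  have h₁ := entOn_nonneg (isProbOn_real ν₁)
  have h₂ := entOn_nonneg (isProbOn_real ν₂)
  rw [entropyBound, klDiv_uniformLaw, klDiv_uniformLaw, ENNReal.ofReal_rpow_of_nonneg h₁ (by simp),
    ENNReal.ofReal_rpow_of_nonneg h₂ (by simp), ← Real.sqrt_eq_rpow, ← Real.sqrt_eq_rpow,
    ← ENNReal.ofReal_add (by positivity) (by positivity), ← ENNReal.ofReal_pow (by positivity)]

/-- The measure on a finite type that gives the mass `w x` to the point `x`; negative weights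
count as zero. -/
def weighted {X : Type*} [Fintype X] [MeasurableSpace X] (w : X → ℝ) : Measure X :=
  ∑ x, ENNReal.ofReal (w x) • Measure.dirac x

lemma weighted_apply (w : X → ℝ) (A : Set X) [DecidablePred (· ∈ A)] :
    weighted w A = ∑ x, if x ∈ A then ENNReal.ofReal (w x) else 0 := by
  rw [weighted, Measure.finsetSum_apply]
  refine Finset.sum_congr rfl fun x _ => ?_
  rw [Measure.smul_apply, Measure.dirac_apply, smul_eq_mul, Set.indicator_apply]
  split_ifs <;> simp

lemma weighted_singleton (w : X → ℝ) (x : X) : weighted w {x} = ENNReal.ofReal (w x) := by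
  classical
  simp [weighted_apply]

lemma isProbabilityMeasure_weighted {w : X → ℝ} (h : IsProbOn Finset.univ w) :
    IsProbabilityMeasure (weighted w) where
  measure_univ := by
    classical
    simp only [weighted_apply, Set.mem_univ, if_true]
    rw [← ENNReal.ofReal_sum_of_nonneg h.nonneg, h.sum_eq, ENNReal.ofReal_one]

lemma lintegral_weighted {w f : X → ℝ} (hw : ∀ x, 0 ≤ w x) (hf : ∀ x, 0 ≤ f x) :
    ∫⁻ x, ENNReal.ofReal (f x) ∂(weighted w) = ENNReal.ofReal (∑ x, w x * f x) := by
  rw [lintegral_fintype, ENNReal.ofReal_sum_of_nonneg fun x _ => mul_nonneg (hw x) (hf x)]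
  refine Finset.sum_congr rfl fun x _ => ?_
  rw [weighted_singleton, ENNReal.ofReal_mul (hw x), mul_comm]

lemma lintegral_ofReal_eq [IsFiniteMeasure ν] {f : X → ℝ} (hf : ∀ x, 0 ≤ f x) :
    ∫⁻ x, ENNReal.ofReal (f x) ∂ν = ENNReal.ofReal (∑ x, ν.real {x} * f x) := by
  rw [lintegral_fintype, ENNReal.ofReal_sum_of_nonneg fun x _ =>
    mul_nonneg measureReal_nonneg (hf x)]
  refine Finset.sum_congr rfl fun x _ => ?_
  rw [ENNReal.ofReal_mul measureReal_nonneg, ofReal_measureReal, mul_comm]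

/-- The law of `(x, y)` when `x` is drawn from `ν` and then `y` with the kernel `P` from `x`. -/
def kernelCoupling {X : Type*} [Fintype X] [MeasurableSpace X] (ν : Measure X)
    (P : X → X → ℝ) : Measure (X × X) :=
  weighted fun z => ν.real {z.1} * P z.1 z.2

lemma measureReal_mul_kernel_nonneg {X : Type*} [Fintype X] [MeasurableSpace X] {P : X → X → ℝ}
    (ν : Measure X) (hP : IsKernelOn Finset.univ P) (x y : X) : 0 ≤ ν.real {x} * P x y :=
  mul_nonneg measureReal_nonneg (hP.nonneg _ (Finset.mem_univ _) _ (Finset.mem_univ _))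

lemma map_fst_kernelCoupling [IsFiniteMeasure ν] (hP : IsKernelOn Finset.univ P) :
    (kernelCoupling ν P).map Prod.fst = ν := by
  classical
  refine Measure.ext_of_singleton fun x => ?_
  rw [Measure.map_apply measurable_fst (measurableSet_singleton x), kernelCoupling,
    weighted_apply, Fintype.sum_prod_type]
  simp only [Set.mem_preimage, Set.mem_singleton_iff]
  rw [Finset.sum_eq_single x (fun x' _ hx => by simp [hx]) (by simp)]
  simp only [if_true]
  rw [← ENNReal.ofReal_sum_of_nonneg fun y _ => measureReal_mul_kernel_nonneg ν hP x y,
    ← Finset.mul_sum, hP.sum_eq x (Finset.mem_univ x), mul_one, ofReal_measureReal]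

lemma map_snd_kernelCoupling [IsFiniteMeasure ν₂] (hP : IsKernelOn Finset.univ P)
    (hν : Pushes Finset.univ P (fun x => ν₁.real {x}) (fun x => ν₂.real {x})) :
    (kernelCoupling ν₁ P).map Prod.snd = ν₂ := by
  classical
  refine Measure.ext_of_singleton fun y => ?_
  rw [Measure.map_apply measurable_snd (measurableSet_singleton y), kernelCoupling,
    weighted_apply, Fintype.sum_prod_type]
  simp only [Set.mem_preimage, Set.mem_singleton_iff, Finset.sum_ite_eq', Finset.mem_univ, if_true]
  rw [← ENNReal.ofReal_sum_of_nonneg fun x _ => measureReal_mul_kernel_nonneg ν₁ hP x y,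
    hν y (Finset.mem_univ y), ofReal_measureReal]

lemma isDisintegration_kernelCoupling [IsFiniteMeasure ν] (hP : IsKernelOn Finset.univ P) :
    IsDisintegration (kernelCoupling ν P) ν fun x => weighted (P x) := by
  refine ⟨fun x => isProbabilityMeasure_weighted
    ⟨hP.nonneg x (Finset.mem_univ x), hP.sum_eq x (Finset.mem_univ x)⟩, fun x y => ?_⟩
  rw [kernelCoupling, weighted_singleton, weighted_singleton,
    ENNReal.ofReal_mul measureReal_nonneg, ofReal_measureReal]

lemma lintegral_sum_sq_eq [IsFiniteMeasure ν] [Fintype ι] {D : ι → X → X → ℝ}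
    (hD : ∀ i x y, 0 ≤ D i x y) (hP : IsKernelOn Finset.univ P) :
    ∫⁻ x, ∑ i, (∫⁻ y, ENNReal.ofReal (D i x y) ∂(weighted (P x))) ^ 2 ∂ν =
      ENNReal.ofReal (weakCostOn Finset.univ Finset.univ D (fun x => ν.real {x}) P) := by
  have hP0 : ∀ x y, 0 ≤ P x y := fun x y => hP.nonneg x (Finset.mem_univ x) y (Finset.mem_univ y)
  rw [weakCostOn, ← lintegral_ofReal_eq fun x => Finset.sum_nonneg fun i _ => sq_nonneg _]
  congr 1
  funext x
  rw [ENNReal.ofReal_sum_of_nonneg fun i _ => sq_nonneg _]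
  refine Finset.sum_congr rfl fun i _ => ?_
  rw [lintegral_weighted (hP0 x) (hD i x), ENNReal.ofReal_pow
    (Finset.sum_nonneg fun y _ => mul_nonneg (hP0 x y) (hD i x y))]

variable [IsProbabilityMeasure ν₁] [IsProbabilityMeasure ν₂]

lemma kernelCoupling_mem_couplings (hP : IsKernelOn Finset.univ P)
    (hν : Pushes Finset.univ P (fun x => ν₁.real {x}) (fun x => ν₂.real {x})) :
    kernelCoupling ν₁ P ∈ couplings ν₁ ν₂ := by
  refine ⟨⟨?_⟩, map_fst_kernelCoupling hP, map_snd_kernelCoupling hP hν⟩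
  rw [← Set.preimage_univ (f := Prod.fst), ← Measure.map_apply measurable_fst .univ,
    map_fst_kernelCoupling hP, measure_univ]

lemma wasserstein_le {d : X → X → ℝ≥0∞} {D : X → X → ℝ}
    (hd : ∀ x y, d x y = ENNReal.ofReal (D x y)) (hD : ∀ x y, 0 ≤ D x y)
    (hP : IsKernelOn Finset.univ P)
    (hν : Pushes Finset.univ P (fun x => ν₁.real {x}) (fun x => ν₂.real {x})) :
    wasserstein d ν₁ ν₂ ≤
      ENNReal.ofReal (linCostOn Finset.univ D (fun x => ν₁.real {x}) P) := by
  refine (iInf₂_le _ (kernelCoupling_mem_couplings hP hν)).trans_eq ?_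
  simp only [hd]
  rw [kernelCoupling, lintegral_weighted (f := fun z : X × X => D z.1 z.2)
    (fun z => measureReal_mul_kernel_nonneg ν₁ hP z.1 z.2) fun z => hD z.1 z.2,
    Fintype.sum_prod_type, linCostOn]
  simp only [Finset.mul_sum, mul_assoc]

lemma weakCostTilde_le {d : X → X → ℝ≥0∞} {D : X → X → ℝ}
    (hd : ∀ x y, d x y = ENNReal.ofReal (D x y)) (hD : ∀ x y, 0 ≤ D x y)
    (hP : IsKernelOn Finset.univ P)
    (hν : Pushes Finset.univ P (fun x => ν₁.real {x}) (fun x => ν₂.real {x})) :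
    weakCostTilde d ν₂ ν₁ ≤ ENNReal.ofReal (weakCostOn Finset.univ (Finset.univ : Finset Unit)
      (fun _ => D) (fun x => ν₁.real {x}) P) := by
  refine (iInf₂_le _ (kernelCoupling_mem_couplings hP hν)).trans
    ((iInf₂_le _ (isDisintegration_kernelCoupling hP)).trans_eq ?_)
  rw [← lintegral_sum_sq_eq (fun _ => hD) hP]
  simp only [hd, Finset.univ_unique, Finset.sum_singleton]

end FiniteMeasures

section WordMeasures

variable {n : ℕ}

section WordCosts

variable {E : Type*} [DecidableEq E] [MeasurableSpace E] {S : Set (Fin n → E)}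

lemma weakCostHat_le [Fintype S] [MeasurableSingletonClass S] {ν₁ ν₂ : Measure S}
    [IsProbabilityMeasure ν₁] [IsProbabilityMeasure ν₂] {P : S → S → ℝ}
    (hP : IsKernelOn Finset.univ P)
    (hν : Pushes Finset.univ P (fun x => ν₁.real {x}) (fun x => ν₂.real {x})) :
    weakCostHat ν₂ ν₁ ≤ ENNReal.ofReal (weakCostOn Finset.univ Finset.univ
      (fun i (x y : S) => if x.1 i = y.1 i then 0 else 1) (fun x => ν₁.real {x}) P) := by
  refine (iInf₂_le _ (kernelCoupling_mem_couplings hP hν)).trans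
    ((iInf₂_le _ (isDisintegration_kernelCoupling hP)).trans_eq ?_)
  rw [← lintegral_sum_sq_eq (fun i x y => by positivity) hP]
  congr! with x i - y
  split_ifs <;> simp_all

lemma IsWordOrbit.weakCostHat_le_entropyBound [Finite E] [MeasurableSingletonClass E]
    (h : IsWordOrbit S) (ν₁ ν₂ : Measure S) [IsProbabilityMeasure ν₁] [IsProbabilityMeasure ν₂] :
    (1 / 8) * weakCostHat ν₂ ν₁ ≤ entropyBound (uniformLaw S) ν₁ ν₂ := by
  have := Fintype.ofFinite S
  obtain ⟨P, hP, hν, hweak⟩ := h.exists_kernel_hat (isProbOn_real ν₁) (isProbOn_real ν₂)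
  rw [entropyBound_uniformLaw, one_div, mul_comm, ← div_eq_mul_inv]
  refine ENNReal.div_le_of_le_mul' ((weakCostHat_le hP hν).trans ?_)
  rw [← ENNReal.ofReal_ofNat 8, ← ENNReal.ofReal_mul (by norm_num)]
  exact ENNReal.ofReal_le_ofReal hweak

end WordCosts

variable {k : Fin 2 → ℕ}

lemma halvedHamming_eq_ofReal {E : Type*} [DecidableEq E] {S : Set (Fin n → E)} (x y : S) :
    halvedHamming x y = ENNReal.ofReal ((hammingDist x.1 y.1 : ℝ) / 2) := by
  rw [halvedHamming, ENNReal.ofReal_div_of_pos two_pos, ENNReal.ofReal_natCast,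
    ENNReal.ofReal_ofNat]

lemma wasserstein_binary_multislice_le (e : Fin 2) (ν₁ ν₂ : Measure (multislice n k))
    [IsProbabilityMeasure ν₁] [IsProbabilityMeasure ν₂] :
    2 * wasserstein halvedHamming ν₁ ν₂ ^ 2 ≤
      (k e : ℝ≥0∞) * entropyBound (uniformLaw (multislice n k)) ν₁ ν₂ := by
  have := Fintype.ofFinite (multislice n k)
  obtain ⟨P, hP, hν, hlin, -⟩ :=
    exists_kernel_binary_multislice e (isProbOn_real ν₁) (isProbOn_real ν₂)
  have hD : ∀ x y : multislice n k, 0 ≤ (hammingDist x.1 y.1 : ℝ) / 2 := fun x y => by positivity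
  have hcost := linCostOn_nonneg (isProbOn_real ν₁).nonneg hP fun x _ y _ => hD x y
  rw [entropyBound_uniformLaw, ← ENNReal.ofReal_natCast, ← ENNReal.ofReal_mul (Nat.cast_nonneg _)]
  calc 2 * wasserstein halvedHamming ν₁ ν₂ ^ 2 ≤ 2 * ENNReal.ofReal (linCostOn _ _ _ P) ^ 2 := by
        gcongr
        exact wasserstein_le halvedHamming_eq_ofReal hD hP hν
    _ = ENNReal.ofReal (2 * linCostOn _ _ _ P ^ 2) := by
        rw [ENNReal.ofReal_mul zero_le_two, ENNReal.ofReal_pow hcost, ENNReal.ofReal_ofNat]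
    _ ≤ _ := ENNReal.ofReal_le_ofReal (by linarith)

lemma weakCostTilde_binary_multislice_le (e : Fin 2) (ν₁ ν₂ : Measure (multislice n k))
    [IsProbabilityMeasure ν₁] [IsProbabilityMeasure ν₂] :
    (1 / 2) * weakCostTilde halvedHamming ν₂ ν₁ ≤
      (k e : ℝ≥0∞) * entropyBound (uniformLaw (multislice n k)) ν₁ ν₂ := by
  have := Fintype.ofFinite (multislice n k)
  obtain ⟨P, hP, hν, -, hweak⟩ :=
    exists_kernel_binary_multislice e (isProbOn_real ν₁) (isProbOn_real ν₂)
  rw [entropyBound_uniformLaw, ← ENNReal.ofReal_natCast, ← ENNReal.ofReal_mul (Nat.cast_nonneg _),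
    one_div, mul_comm, ← div_eq_mul_inv]
  refine ENNReal.div_le_of_le_mul' ((weakCostTilde_le halvedHamming_eq_ofReal
    (fun x y => by positivity) hP hν).trans ?_)
  rw [← ENNReal.ofReal_ofNat 2, ← ENNReal.ofReal_mul zero_le_two, ← mul_assoc]
  exact ENNReal.ofReal_le_ofReal hweak

end WordMeasures

end FiniteKernels

end

theorem theorem1p5 :
    (∀ n k : ℕ, 1 ≤ n → k ≤ n →
      ∀ (ν₁ ν₂ : Measure (slice n k)) [IsProbabilityMeasure ν₁] [IsProbabilityMeasure ν₂],
        2 * wasserstein halvedHamming ν₁ ν₂ ^ 2 ≤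
            ((min k (n - k) : ℕ) : ℝ≥0∞) * entropyBound (uniformLaw (slice n k)) ν₁ ν₂ ∧
          (1 / 2) * weakCostTilde halvedHamming ν₂ ν₁ ≤
            ((min k (n - k) : ℕ) : ℝ≥0∞) * entropyBound (uniformLaw (slice n k)) ν₁ ν₂ ∧
          (1 / 8) * weakCostHat ν₂ ν₁ ≤ entropyBound (uniformLaw (slice n k)) ν₁ ν₂) ∧
    (∀ (m n : ℕ) (k : Fin m → ℕ), 1 ≤ n → (∀ l, 1 ≤ k l) → ∑ l, k l = n →
      ∀ (ν₁ ν₂ : Measure (multislice n k)) [IsProbabilityMeasure ν₁] [IsProbabilityMeasure ν₂],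
        (1 / 8) * weakCostHat ν₂ ν₁ ≤ entropyBound (uniformLaw (multislice n k)) ν₁ ν₂) := by
  refine ⟨fun n k _ _ => ?_, fun m n k _ _ _ ν₁ ν₂ _ _ =>
    (isWordOrbit_multislice k).weakCostHat_le_entropyBound ν₁ ν₂⟩
  rw [slice_eq_multislice]
  intro ν₁ ν₂ _ _
  obtain ⟨e, he⟩ : ∃ e, min k (n - k) = ![n - k, k] e := by
    rcases min_choice k (n - k) with hk | hk
    · exact ⟨1, hk⟩
    · exact ⟨0, hk⟩
  rw [he]
  exact ⟨wasserstein_binary_multislice_le e ν₁ ν₂, weakCostTilde_binary_multislice_le e ν₁ ν₂,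
    (isWordOrbit_multislice _).weakCostHat_le_entropyBound ν₁ ν₂⟩
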